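/- Let $G=(V,E)$ be a finite simple graph and $k\ge 0$ an integer. A $2$-valid edge colouring of $G$ with exactly $k$ colours is a surjective map $c:E\to\{1,\dots,k\}$ such that, for every vertex $v\in V$, the edges incident to $v$ receive at most two distinct colours. The problem Exact Edge $2$-Coloring takes $(G,k)$ as input and asks whether such a colouring exists. **Theorem.** There is an algorithm that decides Exact Edge $2$-Coloring in time $O^*((20k)^k)$. That is, there are a program for the random access machine (with addition, truncated subtraction, indirect addressing and conditional jumps, started with $n$, $k$ and the adjacency matrix of $G$ in its memory, and with logarithmic cost) and a polynomial $p$ such that, for every graph $G$ on $n$ vertices and every integer $k\ge 0$, the program halts on input $(G,k)$ in time at most $(20k)^k\cdot p(n)$ (with $0^0=1$) and answers correctly whether $G$ has a $2$-valid edge colouring with exactly $k$ colours. -/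

import Mathlib

/-! ### The colouring problem -/

/-- An edge colouring `c` of `G` is `q`-valid if every vertex is incident to edges of at most
`q` distinct colours. -/
def EdgeColoringValid {V C : Type*} (G : SimpleGraph V) (q : ℕ) (c : G.edgeSet → C) : Prop :=
  ∀ v : V, (c '' {e : G.edgeSet | v ∈ (e : Sym2 V)}).encard ≤ q

/-- The yes-instances of Exact Edge 2-Coloring: there is a `2`-valid edge colouring of `G` that
uses exactly `k` colours, i.e. a surjective one onto a set of `k` colours. -/
def ExactEdgeTwoColorable {V : Type*} (G : SimpleGraph V) (k : ℕ) : Prop :=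
  ∃ c : G.edgeSet → Fin k, Function.Surjective c ∧ EdgeColoringValid G 2 c

/-! ### Random access machines with logarithmic cost

The memory is a sequence `X 0, X 1, X 2, …` of natural numbers. Every instruction is charged one
unit plus the binary lengths of the numbers it handles. -/

namespace RAM

/-- The instruction set. Operands are addresses of memory cells, except for the constant in
`const` and the jump target in `jumpPos`. -/
inductive Instr : Type
  /-- `X i ← a` -/
  | const (i a : ℕ)
  /-- `X i ← X j + X l` -/
  | add (i j l : ℕ)
  /-- `X i ← X j - X l`, truncated at `0` -/
  | sub (i j l : ℕ)
  /-- `X i ← X (X j)` -/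
  | load (i j : ℕ)
  /-- `X (X i) ← X j` -/
  | store (i j : ℕ)
  /-- go to instruction number `m` if `X j > 0`, otherwise to the next instruction -/
  | jumpPos (j m : ℕ)

/-- A program is a finite list of instructions, numbered from `0`. -/
abbrev Program : Type := List Instr

/-- A configuration: the program counter and the content of the memory. -/
structure Config : Type where
  pc : ℕ
  mem : ℕ → ℕ

/-- The effect of one instruction. -/
def Instr.exec : Instr → Config → Config
  | .const i a, s => ⟨s.pc + 1, Function.update s.mem i a⟩
  | .add i j l, s => ⟨s.pc + 1, Function.update s.mem i (s.mem j + s.mem l)⟩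
  | .sub i j l, s => ⟨s.pc + 1, Function.update s.mem i (s.mem j - s.mem l)⟩
  | .load i j, s => ⟨s.pc + 1, Function.update s.mem i (s.mem (s.mem j))⟩
  | .store i j, s => ⟨s.pc + 1, Function.update s.mem (s.mem i) (s.mem j)⟩
  | .jumpPos j m, s => ⟨if 0 < s.mem j then m else s.pc + 1, s.mem⟩

/-- The logarithmic cost of one instruction; `Nat.size` is the binary length. The addresses that
are written in the program are constants of the program and are not charged. -/
def Instr.cost : Instr → (ℕ → ℕ) → ℕ
  | .const _ a, _ => 1 + Nat.size a
  | .add _ j l, X => 1 + Nat.size (X j) + Nat.size (X l)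
  | .sub _ j l, X => 1 + Nat.size (X j) + Nat.size (X l)
  | .load _ j, X => 1 + Nat.size (X j) + Nat.size (X (X j))
  | .store i j, X => 1 + Nat.size (X i) + Nat.size (X j)
  | .jumpPos j _, X => 1 + Nat.size (X j)

/-- `Runs P s s' t`: started in configuration `s`, the program `P` halts in configuration `s'`
after instructions of total cost `t`. It halts when the program counter points to no
instruction of `P`. -/
inductive Runs (P : Program) : Config → Config → ℕ → Prop
  | halt (s : Config) (h : P[s.pc]? = none) : Runs P s s 0
  | step (s s' : Config) (ins : Instr) (t : ℕ) (h : P[s.pc]? = some ins)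
      (hr : Runs P (ins.exec s) s' t) : Runs P s s' (ins.cost s.mem + t)

end RAM

open Classical in
/-- The input `(G, k)` in the memory: `X 0 = n`, `X 1 = k`, followed by the `n × n` adjacency
matrix of `G` row by row from cell `2` on; all further cells are `0`. -/
noncomputable def inputMemory {n : ℕ} (G : SimpleGraph (Fin n)) (k : ℕ) : ℕ → ℕ
  | 0 => n
  | 1 => k
  | a + 2 => if ∃ u v : Fin n, a = n * (u : ℕ) + (v : ℕ) ∧ G.Adj u v then 1 else 0

/-- The program `P` decides the problem `L`, whose instances are pairs `(G, k)` of a finite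
graph `G` on `n` vertices and a number `k`, within time `T n k`: on every input it halts within
this time, with `1` in cell `0` on yes-instances and `0` there on no-instances. -/
def DecidesWithin (P : RAM.Program) (L : ∀ {n : ℕ}, SimpleGraph (Fin n) → ℕ → Prop)
    (T : ℕ → ℕ → ℕ) : Prop :=
  ∀ (n : ℕ) (G : SimpleGraph (Fin n)) (k : ℕ), ∃ (s : RAM.Config) (t : ℕ),
    RAM.Runs P ⟨0, inputMemory G k⟩ s t ∧ t ≤ T n k ∧
      (L G k → s.mem 0 = 1) ∧ (¬ L G k → s.mem 0 = 0)

/-! Take a depth-first forest of the graph and call a vertex interior if it has a child. Vertices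
that are not interior are pairwise non-adjacent: of two such neighbours, each would have been
visited before the other. So every edge has an interior end (`SearchForest.cover`).

Let ev and od be the numbers of interior vertices of even and of odd depth, and ro the number of
interior roots. Within one parity class, joining every interior vertex to one of its children gives
a matching. Distinct colours on the matching and, on all other edges, the colour of their component
form a 2-valid colouring. It shows at least ev colours for the even class and od + ro for the odd
one, and superfluous colours can be merged (`colorable_of_card_le`). Hence k ≤ ev and k ≤ od + ro
are easy yes-instances, and otherwise ev + od + ro ≤ 2k.

In the remaining case the palettes are enumerated, that is, the pairs of colours allowed at the
interior vertices. An interior vertex with a parent shares the colour of the edge to it with the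
palette of the parent. So a free colour for each such vertex, two for each interior root, and a bit
that selects the shared colour determine all palettes; this makes ev + od + ro free colours. The
names of the colours do not matter, so the free colours may be assumed to form a restricted growth
sequence with exactly k values (`SearchForest.exists_palettes`). The pairs of such a sequence of
length i and i bits number `weight i k` = 2^i S(i,k), with the Stirling number S of the second kind,
and they are recovered from their ranks.

Once the palettes are fixed, the choices for the edges between interior vertices and for the
non-interior vertices are independent of each other, and each contributes at most two colours.
Whether together they can use all k colours is decided by a dynamic program over the 2^k sets of
colours (`covers_step`); that this is equivalent to a colouring is `covers_of_color` and
`Covers.colorable`.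

The time is 2^k · `weight i k` with i ≤ 2k, up to a polynomial. The generating function of the
Stirling numbers, evaluated at 1/(3k), bounds the weight by 2^k (3k)^(2k) divided by k(k+2)⋯(3k-2).
That product behaves like (3^(3/2) k/e)^k, which leads to the base 4·√3·e·k < 20k
(`exists_weight_le`).

For the machine, a language with bounded loops is compiled into instructions (`Cmd.wp_compile`). Its
additions saturate at a number of O(n²) bits, so with addresses and the input k included no cell
needs more than O(n² + log k) bits. The time of a program is bounded by a monomial in the loop
bounds whose exponents can be read off its syntax (`Cmd.time_le`). The main loop has degree one both
in the number of sequences and in 2^k. -/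

set_option linter.constructorNameAsVariable false

/-! ### Code blocks for the random access machine -/

namespace RAM

/-- Memory contents. -/
abbrev Mem : Type := ℕ → ℕ

/-- The list `l` of instructions is found in `P` from position `o` on. -/
def CodeAt (P : Program) (o : ℕ) (l : List Instr) : Prop :=
  ∀ i < l.length, P[o + i]? = l[i]?

theorem CodeAt.left {P : Program} {o : ℕ} {l l' : List Instr} (h : CodeAt P o (l ++ l')) :
    CodeAt P o l := by
  intro i hi
  rw [h i (by simp; omega), List.getElem?_append_left hi]

theorem CodeAt.right {P : Program} {o : ℕ} {l l' : List Instr} (h : CodeAt P o (l ++ l')) :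
    CodeAt P (o + l.length) l' := by
  intro i hi
  rw [add_assoc, h _ (by simp; omega), List.getElem?_append_right (by omega)]
  simp

theorem CodeAt.head {P : Program} {o : ℕ} {a : Instr} {l : List Instr}
    (h : CodeAt P o (a :: l)) : P[o]? = some a := by
  simpa using h 0 (by simp)

theorem CodeAt.tail {P : Program} {o : ℕ} {a : Instr} {l : List Instr}
    (h : CodeAt P o (a :: l)) : CodeAt P (o + 1) l :=
  CodeAt.right (l := [a]) h

/-! ### Counting steps separately from their cost -/

/-- `τ` machine steps, each of cost at most `1 + 2 * Nat.size W`. -/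
inductive Steps (P : Program) (W : ℕ) : Config → Config → ℕ → Prop
  | refl (s : Config) : Steps P W s s 0
  | step {s s' : Config} {τ : ℕ} (ins : Instr) (h : P[s.pc]? = some ins)
      (hc : ins.cost s.mem ≤ 1 + 2 * Nat.size W) (hr : Steps P W (ins.exec s) s' τ) :
      Steps P W s s' (τ + 1)

theorem Steps.trans {P : Program} {W : ℕ} {s s' s'' : Config} {a b : ℕ}
    (h : Steps P W s s' a) (h' : Steps P W s' s'' b) : Steps P W s s'' (a + b) := by
  induction h with
  | refl s => simpa using h'
  | step ins h hc _ ih =>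
    rw [show ∀ x : ℕ, x + 1 + b = x + b + 1 by intro; omega]
    exact .step ins h hc (ih h')

theorem Steps.one {P : Program} {W : ℕ} {s : Config} (ins : Instr) (h : P[s.pc]? = some ins)
    (hc : ins.cost s.mem ≤ 1 + 2 * Nat.size W) : Steps P W s (ins.exec s) 1 :=
  .step ins h hc (.refl _)

/-- A uniform bound on the contents of the cells turns logarithmic cost into the number of steps
times one factor, so that everything below only counts steps. -/
theorem Steps.runs {P : Program} {W : ℕ} {s s' : Config} {τ : ℕ} (h : Steps P W s s' τ)
    (hs : P[s'.pc]? = none) : ∃ t ≤ τ * (1 + 2 * Nat.size W), Runs P s s' t := by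
  induction h with
  | refl s => exact ⟨0, by simp, .halt s hs⟩
  | step ins h hc _ ih =>
    obtain ⟨t, ht, hr⟩ := ih hs
    exact ⟨_, by rw [add_mul, one_mul]; omega, .step _ _ ins t h hr⟩

/-- All memory cells hold numbers of at most the given size. -/
def Bd (W : ℕ) (m : Mem) : Prop := ∀ a, m a ≤ W

theorem Bd.update {W : ℕ} {m : Mem} (h : Bd W m) (a : ℕ) {v : ℕ} (hv : v ≤ W) :
    Bd W (Function.update m a v) := by
  intro b
  by_cases hb : b = a
  · subst hb; simpa using hv
  · simpa [hb] using h b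

/-- The effect on the memory of an instruction. -/
def Instr.eff : Instr → Mem → Mem
  | .const i a, m => Function.update m i a
  | .add i j l, m => Function.update m i (m j + m l)
  | .sub i j l, m => Function.update m i (m j - m l)
  | .load i j, m => Function.update m i (m (m j))
  | .store i j, m => Function.update m (m i) (m j)
  | .jumpPos _ _, m => m

/-- The instruction is no jump. -/
def Instr.Plain : Instr → Prop
  | .jumpPos _ _ => False
  | _ => True

/-- The constants in the instruction are at most `W`. -/
def Instr.ConstLe (W : ℕ) : Instr → Prop
  | .const _ a => a ≤ W
  | _ => True

theorem Instr.cost_le {W : ℕ} {m : Mem} (h : Bd W m) (i : Instr) (hi : i.ConstLe W) :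
    i.cost m ≤ 1 + 2 * Nat.size W := by
  have h' : ∀ a, Nat.size (m a) ≤ Nat.size W := fun a => Nat.size_le_size (h a)
  cases i with
  | const i a => have := Nat.size_le_size (show a ≤ W from hi); simp only [Instr.cost]; omega
  | add i j l => have := h' j; have := h' l; simp only [Instr.cost]; omega
  | sub i j l => have := h' j; have := h' l; simp only [Instr.cost]; omega
  | load i j => have := h' j; have := h' (m j); simp only [Instr.cost]; omega
  | store i j => have := h' j; have := h' i; simp only [Instr.cost]; omega
  | jumpPos j _ => have := h' j; simp only [Instr.cost]; omega

theorem Instr.exec_plain {i : Instr} (hi : i.Plain) (s : Config) :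
    i.exec s = ⟨s.pc + 1, i.eff s.mem⟩ := by
  cases i <;> first | rfl | exact hi.elim

/-- A relocatable piece of code. -/
structure Block : Type where
  len : ℕ
  code : ℕ → List Instr
  length_code : ∀ o, (code o).length = len

namespace Block

/-- Started with memory `m`, the block is left at its end after at most `τ` steps, with a memory
satisfying `Q`. -/
def wp (b : Block) (W : ℕ) (m : Mem) (τ : ℕ) (Q : Mem → Prop) : Prop :=
  -- The final memory is fixed before the surrounding program and the position are, so
  -- postconditions can be composed without mentioning either.
  ∃ m', Q m' ∧ ∀ P o, CodeAt P o (b.code o) →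
    ∃ τ' ≤ τ, Steps P W ⟨o, m⟩ ⟨o + b.len, m'⟩ τ'

theorem wp.mono {b : Block} {W τ τ' : ℕ} {m : Mem} {Q Q' : Mem → Prop} (h : b.wp W m τ Q)
    (hτ : τ ≤ τ') (hQ : ∀ m', Q m' → Q' m') : b.wp W m τ' Q' := by
  obtain ⟨m', hm, hs⟩ := h
  refine ⟨m', hQ _ hm, fun P o hc => ?_⟩
  obtain ⟨t, ht, hs⟩ := hs P o hc
  exact ⟨t, ht.trans hτ, hs⟩

/-- The empty block. -/
def skip : Block := ⟨0, fun _ => [], fun _ => rfl⟩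

theorem wp_skip {W : ℕ} {m : Mem} {Q : Mem → Prop} (h : Q m) : skip.wp W m 0 Q :=
  ⟨m, h, fun _ _ _ => ⟨0, le_rfl, .refl _⟩⟩

/-- A single instruction. -/
def ins (i : Instr) : Block := ⟨1, fun _ => [i], fun _ => rfl⟩

theorem wp_ins {W : ℕ} {m : Mem} {Q : Mem → Prop} {i : Instr} (hp : i.Plain) (hb : Bd W m)
    (hi : i.ConstLe W) (h : Q (i.eff m)) : (ins i).wp W m 1 Q := by
  refine ⟨_, h, fun P o hc => ⟨1, le_rfl, ?_⟩⟩
  have := Steps.one (s := ⟨o, m⟩) i hc.head (Instr.cost_le hb i hi)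
  rwa [Instr.exec_plain hp] at this

/-- Two blocks in sequence. -/
def seq (b c : Block) : Block :=
  ⟨b.len + c.len, fun o => b.code o ++ c.code (o + b.len), fun o => by
    simp [b.length_code, c.length_code]⟩

theorem wp_seq {b c : Block} {W : ℕ} {m : Mem} {Q : Mem → Prop} {τ τ' : ℕ}
    (h : b.wp W m τ fun m' => c.wp W m' τ' Q) : (b.seq c).wp W m (τ + τ') Q := by
  obtain ⟨m₁, ⟨m₂, hQ, h₂⟩, h₁⟩ := h
  refine ⟨m₂, hQ, fun P o hc => ?_⟩
  obtain ⟨t₁, ht₁, s₁⟩ := h₁ P o hc.left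
  have hr := CodeAt.right hc
  rw [b.length_code] at hr
  obtain ⟨t₂, ht₂, s₂⟩ := h₂ P _ hr
  refine ⟨t₁ + t₂, by omega, ?_⟩
  have := s₁.trans s₂
  rwa [add_assoc] at this

/-- The cell used for unconditional jumps. -/
abbrev jmp : ℕ := 50

/-- `if X j > 0 then b else c` -/
def branch (j : ℕ) (b c : Block) : Block :=
  ⟨c.len + b.len + 3, fun o => .jumpPos j (o + c.len + 3) :: (c.code (o + 1) ++
    (.const jmp 1 :: .jumpPos jmp (o + c.len + b.len + 3) :: b.code (o + c.len + 3))),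
    fun o => by simp [b.length_code, c.length_code]; omega⟩

/-- The code for `X j = 0` comes first and has to jump over the other one. This jump sets the cell
`jmp`, which is why only the second hypothesis speaks of an updated memory. -/
theorem wp_branch {b c : Block} {W : ℕ} {m : Mem} {Q : Mem → Prop} {τ j : ℕ} (hb : Bd W m)
    (hW : 1 ≤ W) (h₁ : 0 < m j → b.wp W m τ Q)
    (h₂ : m j = 0 → c.wp W m τ fun m' => Bd W m' ∧ Q (Function.update m' jmp 1)) :
    (branch j b c).wp W m (τ + 3) Q := by
  rcases Nat.eq_zero_or_pos (m j) with hj | hj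
  · obtain ⟨m', ⟨hB, hQ⟩, h⟩ := h₂ hj
    refine ⟨_, hQ, fun P o hc => ?_⟩
    have hr := hc.tail.right
    rw [c.length_code] at hr
    obtain ⟨t, ht, hs⟩ := h P _ hc.tail.left
    have e₁ := Steps.one (s := ⟨o, m⟩) _ hc.head
      (Instr.cost_le hb (.jumpPos j (o + c.len + 3)) trivial)
    have e₂ := Steps.one (s := ⟨o + 1 + c.len, m'⟩) _ hr.head
      (Instr.cost_le hB (.const jmp 1) hW)
    have e₃ := Steps.one (s := ⟨o + 1 + c.len + 1, Function.update m' jmp 1⟩) _ hr.tail.head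
      (Instr.cost_le (hB.update _ hW) (.jumpPos jmp (o + c.len + b.len + 3)) trivial)
    simp only [Instr.exec, hj, lt_irrefl, if_false] at e₁
    simp only [Instr.exec, Function.update_self, Nat.one_pos, if_true] at e₂ e₃
    refine ⟨1 + t + 1 + 1, by omega, ?_⟩
    have := ((e₁.trans hs).trans e₂).trans e₃
    have e : (branch j b c).len = c.len + b.len + 3 := rfl
    rwa [e, ← add_assoc, ← add_assoc]
  · obtain ⟨m', hQ, h⟩ := h₁ hj
    refine ⟨_, hQ, fun P o hc => ?_⟩
    have hr := hc.tail.right.tail.tail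
    rw [c.length_code, show o + 1 + c.len + 1 + 1 = o + c.len + 3 by omega] at hr
    obtain ⟨t, ht, hs⟩ := h P _ hr
    have e₁ := Steps.one (s := ⟨o, m⟩) _ hc.head
      (Instr.cost_le hb (.jumpPos j (o + c.len + 3)) trivial)
    simp only [Instr.exec, hj, if_true] at e₁
    refine ⟨1 + t, by omega, ?_⟩
    have := e₁.trans hs
    have e : (branch j b c).len = c.len + b.len + 3 := rfl
    rwa [e, show o + (c.len + b.len + 3) = o + c.len + 3 + b.len by omega]

/-- Repeat `b` until `X c = 0`, where `X c` is decreased by one after each round. -/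
def rep (c : ℕ) (b : Block) : Block :=
  ⟨b.len + 6, fun o => .jumpPos c (o + 3) :: .const jmp 1 :: .jumpPos jmp (o + b.len + 6) ::
    (b.code (o + 3) ++ [.const jmp 1, .sub c c jmp, .jumpPos jmp o]),
    fun o => by simp [b.length_code]⟩

/-- `I i` is the invariant after `i` rounds, when the counter is `N - i`. The body must leave the
counter alone; the two updates in `hs` are the effect of the code behind the body that decreases it.
-/
theorem wp_rep {b : Block} {W : ℕ} {m : Mem} {Q : Mem → Prop} {τ c N : ℕ}
    (I : ℕ → Mem → Prop) (hc : c ≠ jmp) (hW : 1 ≤ W) (hb : Bd W m) (hm : m c = N) (hI : I 0 m)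
    (hs : ∀ i < N, ∀ m, Bd W m → m c = N - i → I i m → b.wp W m τ fun m' =>
      Bd W m' ∧ m' c = N - i ∧
        I (i + 1) (Function.update (Function.update m' jmp 1) c (N - (i + 1))))
    (hQ : ∀ m, Bd W m → m c = 0 → I N m → Q (Function.update m jmp 1)) :
    (rep c b).wp W m (N * (τ + 4) + 3) Q := by
  -- Induction on the number `d` of rounds still to come, for an arbitrary starting round.
  suffices H : ∀ d i m, i + d = N → Bd W m → m c = d → I i m →
      (rep c b).wp W m (d * (τ + 4) + 3) Q from
    H N 0 m (by simp) hb hm hI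
  intro d
  induction d with
  | zero =>
    intro i m₁ hi hb₁ hm₁ hI₁
    obtain rfl : i = N := by omega
    refine ⟨_, hQ m₁ hb₁ hm₁ hI₁, fun P o hcode => ⟨3, by omega, ?_⟩⟩
    have e₁ := Steps.one (s := ⟨o, m₁⟩) _ hcode.head
      (Instr.cost_le hb₁ (.jumpPos c (o + 3)) trivial)
    have e₂ := Steps.one (s := ⟨o + 1, m₁⟩) _ hcode.tail.head
      (Instr.cost_le hb₁ (.const jmp 1) hW)
    have e₃ := Steps.one (s := ⟨o + 1 + 1, Function.update m₁ jmp 1⟩) _ hcode.tail.tail.head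
      (Instr.cost_le (hb₁.update _ hW) (.jumpPos jmp (o + b.len + 6)) trivial)
    simp only [Instr.exec, hm₁, lt_irrefl, if_false] at e₁
    simp only [Instr.exec, Function.update_self, Nat.one_pos, if_true] at e₂ e₃
    have := (e₁.trans e₂).trans e₃
    have e : (rep c b).len = b.len + 6 := rfl
    rwa [e, ← add_assoc]
  | succ d ih =>
    intro i m hi hb hm hI
    have hd : N - i = d + 1 := by omega
    have hd' : N - (i + 1) = d := by omega
    obtain ⟨m', ⟨hB, hc', hI'⟩, h⟩ := hs i (by omega) m hb (by omega) hI
    rw [hd'] at hI'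
    have hdW : d ≤ W := by have := hB c; omega
    obtain ⟨m'', hQ'', h''⟩ := ih (i + 1) _ (by omega)
      ((hB.update jmp hW).update c hdW) (by simp) hI'
    refine ⟨m'', hQ'', fun P o hcode => ?_⟩
    obtain ⟨t'', ht'', s''⟩ := h'' P o hcode
    have hbody := hcode.tail.tail.tail
    rw [show o + 1 + 1 + 1 = o + 3 by omega] at hbody
    obtain ⟨t, ht, s⟩ := h P _ hbody.left
    have hr := hbody.right
    rw [b.length_code] at hr
    have e₁ := Steps.one (s := ⟨o, m⟩) _ hcode.head
      (Instr.cost_le hb (.jumpPos c (o + 3)) trivial)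
    have e₂ := Steps.one (s := ⟨o + 3 + b.len, m'⟩) _ hr.head
      (Instr.cost_le hB (.const jmp 1) hW)
    have e₃ := Steps.one (s := ⟨o + 3 + b.len + 1, Function.update m' jmp 1⟩) _ hr.tail.head
      (Instr.cost_le (hB.update _ hW) (.sub c c jmp) trivial)
    have e₄ := Steps.one (s := ⟨o + 3 + b.len + 1 + 1,
      Function.update (Function.update m' jmp 1) c d⟩) _ hr.tail.tail.head
      (Instr.cost_le ((hB.update _ hW).update _ hdW) (.jumpPos jmp o) trivial)
    simp only [Instr.exec, hm, Nat.succ_pos, if_true] at e₁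
    simp only [Instr.exec] at e₂
    have hc2 : m' c - 1 = d := by omega
    simp only [Instr.exec, Function.update_self, Function.update_of_ne hc, hc2] at e₃
    simp only [Instr.exec, Function.update_self, Function.update_of_ne hc.symm, Nat.one_pos,
      if_true] at e₄
    refine ⟨1 + t + 1 + 1 + 1 + t'', by rw [add_mul]; omega, ?_⟩
    exact ((((e₁.trans s).trans e₂).trans e₃).trans e₄).trans s''

end Block

end RAM

/-! ### A small programming language with bounded loops -/

namespace RAM

/-- The variables of the language. -/
inductive Reg : Type
  | res | u | v | w | i | j | t | p | x | y | z | acc | ev | od | ro | ns | g | r | l | d | s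
  | mask | rem | tot | dim | lim
  deriving DecidableEq

/-- The arrays of the language. -/
inductive Arr : Type
  | adj | row | off | pw | vis | ord | int | par | dep | root | wt | ht | val | bit | pa | pb
  | cov | bt
  deriving DecidableEq

/-- The parameters: numbers that bound loops and are not changed by a program. -/
inductive Par : Type
  | n | k | lim | dim | tot
  deriving DecidableEq

theorem Reg.ctorIdx_injective : Function.Injective Reg.ctorIdx := fun a b h => by
  rw [← Reg.ofNat_ctorIdx a, h, Reg.ofNat_ctorIdx]

theorem Arr.ctorIdx_injective : Function.Injective Arr.ctorIdx := fun a b h => by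
  rw [← Arr.ofNat_ctorIdx a, h, Arr.ofNat_ctorIdx]

theorem Par.ctorIdx_injective : Function.Injective Par.ctorIdx := fun a b h => by
  rw [← Par.ofNat_ctorIdx a, h, Par.ofNat_ctorIdx]

theorem Reg.ctorIdx_lt (x : Reg) : x.ctorIdx < 40 := by cases x <;> decide

theorem Arr.ctorIdx_lt (x : Arr) : x.ctorIdx < 32 := by cases x <;> decide

theorem Par.ctorIdx_lt (x : Par) : x.ctorIdx < 8 := by cases x <;> decide

/-- The state of a program. -/
structure St : Type where
  r : Reg → ℕ
  a : Arr → ℕ → ℕ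

/-- Assignment to a variable. -/
def St.set (σ : St) (x : Reg) (n : ℕ) : St := ⟨Function.update σ.r x n, σ.a⟩

/-- Assignment to an entry of an array. -/
def St.put (σ : St) (a : Arr) (i n : ℕ) : St :=
  ⟨σ.r, Function.update σ.a a (Function.update (σ.a a) i n)⟩

/-- The values of the parameters, and the largest number that is computed with. -/
structure Env : Type where
  β : Par → ℕ
  V : ℕ

/-- Expressions. -/
inductive Expr : Type
  /-- zero or one -/
  | bool (b : Bool)
  | var (x : Reg)
  | par (i : Par)
  | get (a : Arr) (e : Expr)
  /-- addition, truncated at the largest number -/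
  | add (e f : Expr)
  | sub (e f : Expr)
  /-- `if e > 0 then f else g` -/
  | ite (e f g : Expr)
  /-- the least value of `x` below the parameter `i` for which `e` is positive, or the value of
  the parameter if there is none -/
  | find (x : Reg) (i : Par) (e : Expr)

/-- The result of a search that goes down from `N` in `i` steps. -/
def searchDown (f : ℕ → ℕ) (N : ℕ) : ℕ → ℕ
  | 0 => N
  | i + 1 => if 0 < f (N - (i + 1)) then N - (i + 1) else searchDown f N i

theorem searchDown_le (f : ℕ → ℕ) (N i : ℕ) : searchDown f N i ≤ N := by
  induction i with
  | zero => exact le_rfl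
  | succ i ih => rw [searchDown]; split_ifs <;> omega

/-- In a downward scan a later hit replaces an earlier one, so the result is the least hit although
the loop has no early exit. -/
theorem searchDown_spec (f : ℕ → ℕ) (N i : ℕ) :
    (searchDown f N i < N → 0 < f (searchDown f N i)) ∧
      ∀ j, N - i ≤ j → j < searchDown f N i → f j = 0 := by
  induction i with
  | zero => exact ⟨fun h => (lt_irrefl _ h).elim, fun j h h' => by simp [searchDown] at *; omega⟩
  | succ i ih =>
    rw [searchDown]
    split_ifs with h
    · exact ⟨fun _ => h, fun j _ _ => by omega⟩
    · refine ⟨ih.1, fun j hj hj' => ?_⟩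
      by_cases hji : N - i ≤ j
      · exact ih.2 j hji hj'
      · obtain rfl : j = N - (i + 1) := by omega
        omega

namespace Expr

/-- The value of an expression. -/
def eval (E : Env) : Expr → St → ℕ
  | bool b, _ => b.toNat
  | var x, σ => σ.r x
  | par i, _ => E.β i
  | get a e, σ => σ.a a (e.eval E σ)
  | add e f, σ => min (e.eval E σ + f.eval E σ) E.V
  | sub e f, σ => e.eval E σ - f.eval E σ
  | ite e f g, σ => if 0 < e.eval E σ then f.eval E σ else g.eval E σ
  | find x i e, σ => searchDown (fun j => e.eval E (σ.set x j)) (E.β i) (E.β i)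

/-- A bound for the number of steps that the evaluation takes. -/
def time (E : Env) : Expr → ℕ
  | bool _ => 1
  | var _ => 2
  | par _ => 2
  | get _ e => e.time E + 9
  | add e f => e.time E + f.time E + 3
  | sub e f => e.time E + f.time E + 1
  | ite e f g => e.time E + f.time E + g.time E + 3
  | find _ i e => E.β i * (e.time E + 11) + 11

/-- The number of auxiliary cells that the evaluation needs. -/
def depth : Expr → ℕ
  | bool _ => 1
  | var _ => 1
  | par _ => 1
  | get _ e => e.depth + 2
  | add e f => e.depth + f.depth + 1
  | sub e f => e.depth + f.depth + 1
  | ite e f g => e.depth + f.depth + g.depth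
  | find _ _ e => e.depth + 4

end Expr

/-- Commands. -/
inductive Cmd : Type
  | skip
  | set (x : Reg) (e : Expr)
  | put (a : Arr) (e f : Expr)
  | seq (c d : Cmd)
  | ite (e : Expr) (c d : Cmd)
  /-- run `c` with `x = 0, 1, …` up to the value of the parameter `i` (excluded) -/
  | loop (x : Reg) (i : Par) (c : Cmd)

/-- Apply `f 0`, `f 1`, …, `f (N - 1)` one after the other. -/
def iter {α : Type*} (f : ℕ → α → α) : ℕ → α → α
  | 0, s => s
  | N + 1, s => f N (iter f N s)

theorem iter_inv {α : Type*} {f : ℕ → α → α} {N : ℕ} {s : α} (I : ℕ → α → Prop) (h₀ : I 0 s)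
    (h : ∀ j < N, ∀ s, I j s → I (j + 1) (f j s)) : I N (iter f N s) := by
  induction N with
  | zero => exact h₀
  | succ N ih => exact h N (by omega) _ (ih fun j hj => h j (by omega))

namespace Cmd

/-- The effect of a command. -/
def run (E : Env) : Cmd → St → St
  | skip, σ => σ
  | set x e, σ => σ.set x (e.eval E σ)
  | put a e f, σ => σ.put a (e.eval E σ) (f.eval E σ)
  | seq c d, σ => d.run E (c.run E σ)
  | ite e c d, σ => if 0 < e.eval E σ then c.run E σ else d.run E σ
  | loop x i c, σ => iter (fun j σ => c.run E (σ.set x j)) (E.β i) σ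

/-- A bound for the number of steps that the execution takes. -/
def time (E : Env) : Cmd → ℕ
  | skip => 0
  | set _ e => e.time E + 2
  | put _ e f => e.time E + f.time E + 9
  | seq c d => c.time E + d.time E
  | ite e c d => e.time E + c.time E + d.time E + 3
  | loop _ i c => E.β i * (c.time E + 8) + 6

/-- The number of auxiliary cells that the execution needs. -/
def depth : Cmd → ℕ
  | skip => 0
  | set _ e => e.depth
  | put _ e f => e.depth + f.depth + 2
  | seq c d => c.depth + d.depth
  | ite e c d => e.depth + c.depth + d.depth
  | loop _ _ c => c.depth + 3

end Cmd

/-! ### Compilation -/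

/-- The memory cell of a variable. -/
def Reg.cell (x : Reg) : ℕ := x.ctorIdx

/-- The memory cell of a parameter. -/
def Par.cell (i : Par) : ℕ := 40 + i.ctorIdx

/-- The cell that holds the largest number. -/
abbrev capCell : ℕ := 48

/-- The cell that holds the address at which the arrays begin. -/
abbrev baseCell : ℕ := 49

theorem Reg.cell_lt (x : Reg) : x.cell < 40 := x.ctorIdx_lt

theorem Par.cell_lt (i : Par) : i.cell < 48 := by have := i.ctorIdx_lt; unfold Par.cell; omega

theorem Par.le_cell (i : Par) : 40 ≤ i.cell := by unfold Par.cell; omega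

/-- The memory `m` holds the state `σ`, with the arrays from address `B` on. -/
structure Rep (E : Env) (B : ℕ) (σ : St) (m : Mem) : Prop where
  reg : ∀ x : Reg, m x.cell = σ.r x
  par : ∀ i : Par, m i.cell = E.β i
  cap : m capCell = E.V
  base : m baseCell = B
  -- The arrays are interleaved with stride 32: none of them needs a length, and five doublings
  -- suffice for the address.
  arr : ∀ (a : Arr) (i : ℕ), m (B + 32 * i + a.ctorIdx) = σ.a a i

/-- The memories agree except for the jump cell and the auxiliary cells from `t` on. -/
def Agree (t B : ℕ) (m m' : Mem) : Prop :=
  ∀ a, a ≠ Block.jmp → a < t ∨ B ≤ a → m' a = m a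

theorem Agree.refl (t B : ℕ) (m : Mem) : Agree t B m m := fun _ _ _ => rfl

theorem Agree.trans {t t' B : ℕ} {m m' m'' : Mem} (h : Agree t B m m') (h' : Agree t' B m' m'')
    (ht : t ≤ t') : Agree t B m m'' := fun a ha hb => by
  rw [h' a ha (by omega), h a ha hb]

theorem Agree.update {t B : ℕ} {m m' : Mem} (h : Agree t B m m') {a : ℕ}
    (ha : a = Block.jmp ∨ t ≤ a ∧ a < B) (v : ℕ) : Agree t B m (Function.update m' a v) :=
  fun b hb hb' => by
    rw [Function.update_of_ne (by rintro rfl; omega), h b hb hb']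

/-- The bounds under which compiled programs work as intended. -/
structure Env.Ok (E : Env) (B W : ℕ) : Prop where
  pos : 1 ≤ E.V
  par : ∀ i, E.β i ≤ E.V
  le : 32 * E.V + B + 64 ≤ W
  base : 51 ≤ B

/-- All numbers of the state are at most `V`. -/
structure St.Le (σ : St) (V : ℕ) : Prop where
  reg : ∀ x, σ.r x ≤ V
  arr : ∀ a i, σ.a a i ≤ V

theorem St.Le.set {σ : St} {V : ℕ} (h : σ.Le V) (x : Reg) {n : ℕ} (hn : n ≤ V) :
    (σ.set x n).Le V :=
  ⟨fun y => by
    simp only [St.set, Function.update_apply]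
    split_ifs
    exacts [hn, h.reg y], h.arr⟩

theorem St.Le.put {σ : St} {V : ℕ} (h : σ.Le V) (a : Arr) (i : ℕ) {n : ℕ} (hn : n ≤ V) :
    (σ.put a i n).Le V :=
  ⟨h.reg, fun b j => by
    simp only [St.put, Function.update_apply]
    split_ifs with hb
    · subst hb
      simp only [Function.update_apply]
      split_ifs
      exacts [hn, h.arr _ j]
    · exact h.arr b j⟩

theorem Expr.eval_le {E : Env} {B W : ℕ} (hE : E.Ok B W) (e : Expr) (σ : St) (h : σ.Le E.V) :
    e.eval E σ ≤ E.V := by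
  induction e generalizing σ with
  | bool b => have := hE.pos; cases b <;> simp [eval]; omega
  | var x => exact h.reg x
  | par i => exact hE.par i
  | get a e ih => exact h.arr a _
  | add e f _ _ => exact min_le_right _ _
  | sub e f ih _ => exact (Nat.sub_le _ _).trans (ih σ h)
  | ite e f g _ ihf ihg =>
    rw [eval]; split_ifs
    exacts [ihf σ h, ihg σ h]
  | find x i e _ => exact (searchDown_le _ _ _).trans (hE.par i)

/-- Saturating addition is what makes this true for every command; whether the saturation ever
alters a result is a separate matter. -/
theorem Cmd.run_le {E : Env} {B W : ℕ} (hE : E.Ok B W) (c : Cmd) (σ : St) (h : σ.Le E.V) :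
    (c.run E σ).Le E.V := by
  induction c generalizing σ with
  | skip => exact h
  | set x e => exact h.set x (e.eval_le hE σ h)
  | put a e f => exact h.put a _ (f.eval_le hE σ h)
  | seq c d hc hd => exact hd _ (hc _ h)
  | ite e c d hc hd =>
    rw [run]; split_ifs
    exacts [hc σ h, hd σ h]
  | loop x i c hc =>
    exact iter_inv (fun _ (s : St) => s.Le E.V) h fun j hj s hs =>
      hc _ (hs.set x (hj.le.trans (hE.par i)))

theorem Rep.of_agree {E : Env} {B t : ℕ} {σ : St} {m m' : Mem} (h : Rep E B σ m)
    (ha : Agree t B m m') (ht : 51 ≤ t) (hB : 51 ≤ B) : Rep E B σ m' where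
  reg x := by
    have := x.cell_lt
    rw [ha _ (by unfold Block.jmp; omega) (by omega), h.reg]
  par x := by
    have := x.cell_lt
    rw [ha _ (by unfold Block.jmp; omega) (by omega), h.par]
  cap := by rw [ha _ (by decide) (by unfold capCell; omega), h.cap]
  base := by rw [ha _ (by decide) (by unfold baseCell; omega), h.base]
  arr a i := by rw [ha _ (by unfold Block.jmp; omega) (by omega), h.arr]

theorem Rep.set {E : Env} {B : ℕ} {σ : St} {m : Mem} (h : Rep E B σ m) (hB : 51 ≤ B) (x : Reg)
    (n : ℕ) : Rep E B (σ.set x n) (Function.update m x.cell n) where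
  reg y := by
    simp only [St.set, Function.update_apply]
    by_cases hy : y = x
    · simp [hy]
    · rw [if_neg hy, if_neg (show y.cell ≠ x.cell from fun e => hy (Reg.ctorIdx_injective e)), h.reg]
  par y := by
    have := x.cell_lt
    have := y.le_cell
    rw [Function.update_of_ne (by omega), h.par]
  cap := by have := x.cell_lt; rw [Function.update_of_ne (by unfold capCell; omega), h.cap]
  base := by have := x.cell_lt; rw [Function.update_of_ne (by unfold baseCell; omega), h.base]
  arr a i := by have := x.cell_lt; rw [Function.update_of_ne (by omega), h.arr]; rfl

theorem Rep.put {E : Env} {B : ℕ} {σ : St} {m : Mem} (h : Rep E B σ m) (hB : 51 ≤ B) (a : Arr)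
    (i n : ℕ) : Rep E B (σ.put a i n) (Function.update m (B + 32 * i + a.ctorIdx) n) where
  reg y := by have := y.cell_lt; rw [Function.update_of_ne (by omega), h.reg]; rfl
  par y := by have := y.cell_lt; rw [Function.update_of_ne (by omega), h.par]
  cap := by rw [Function.update_of_ne (by unfold capCell; omega), h.cap]
  base := by rw [Function.update_of_ne (by unfold baseCell; omega), h.base]
  arr b j := by
    simp only [St.put, Function.update_apply]
    have ha := a.ctorIdx_lt
    have hb := b.ctorIdx_lt
    by_cases hba : b = a
    · subst hba
      by_cases hj : j = i
      · simp [hj]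
      · rw [if_neg (by omega), if_pos rfl, Function.update_of_ne hj, h.arr]
    · have : b.ctorIdx ≠ a.ctorIdx := fun e => hba (Arr.ctorIdx_injective e)
      rw [if_neg (by omega), if_neg hba, h.arr]

/-! ### Copying cells and addressing array entries -/

namespace Block

theorem wp_seq_le {b c : Block} {W : ℕ} {m : Mem} {Q : Mem → Prop} (τ τ' : ℕ) {T : ℕ}
    (h : b.wp W m τ fun m' => c.wp W m' τ' Q) (hT : τ + τ' ≤ T) : (b.seq c).wp W m T Q :=
  (wp_seq h).mono hT fun _ => id

/-- Copy the content of the cell `s` to the cell `d`. -/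
def copy (d s : ℕ) : Block := (ins (.const d 0)).seq (ins (.add d d s))

theorem wp_copy {W : ℕ} {m : Mem} {Q : Mem → Prop} {d s : ℕ} (hds : s ≠ d) (hb : Bd W m)
    (h : Q (Function.update m d (m s))) : (copy d s).wp W m 2 Q := by
  refine wp_seq_le 1 1 (wp_ins trivial hb (Nat.zero_le _)
    (wp_ins trivial (hb.update _ (Nat.zero_le _)) trivial ?_)) le_rfl
  simpa [Instr.eff, Function.update_of_ne hds] using h

/-- Replace the index of the entry of an array, in the cell `t`, by its address. -/
def address (t : ℕ) (a : Arr) : Block :=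
  (ins (.add t t t)).seq <| (ins (.add t t t)).seq <| (ins (.add t t t)).seq <|
  (ins (.add t t t)).seq <| (ins (.add t t t)).seq <| (ins (.add t t baseCell)).seq <|
  (ins (.const jmp a.ctorIdx)).seq (ins (.add t t jmp))

/-- Five additions of the cell to itself multiply the index by 32. The machine has no
multiplication. -/
theorem wp_address {W : ℕ} {m : Mem} {Q : Mem → Prop} {t B : ℕ} {a : Arr} (ht : 51 ≤ t)
    (hb : Bd W m) (hB : m baseCell = B) (hW : 32 * m t + B + 64 ≤ W)
    (h : ∀ m', (∀ c, c ≠ t → c ≠ jmp → m' c = m c) → Bd W m' →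
      m' t = B + 32 * m t + a.ctorIdx → Q m') : (address t a).wp W m 8 Q := by
  have ha := a.ctorIdx_lt
  have h49 : baseCell ≠ t := by unfold baseCell; omega
  have h50 : jmp ≠ t := by unfold jmp; omega
  unfold address
  refine wp_seq_le 1 7 (wp_ins trivial hb trivial ?_) le_rfl
  refine wp_seq_le 1 6 (wp_ins trivial ?_ trivial ?_) le_rfl
  · exact hb.update _ (by omega)
  refine wp_seq_le 1 5 (wp_ins trivial ?_ trivial ?_) le_rfl
  · simp only [Instr.eff, Function.update_self, Function.update_idem]
    exact hb.update _ (by omega)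
  refine wp_seq_le 1 4 (wp_ins trivial ?_ trivial ?_) le_rfl
  · simp only [Instr.eff, Function.update_self, Function.update_idem]
    exact hb.update _ (by omega)
  refine wp_seq_le 1 3 (wp_ins trivial ?_ trivial ?_) le_rfl
  · simp only [Instr.eff, Function.update_self, Function.update_idem]
    exact hb.update _ (by omega)
  simp only [Instr.eff, Function.update_self, Function.update_idem]
  refine wp_seq_le 1 2 (wp_ins trivial (hb.update _ (by omega)) trivial ?_) le_rfl
  simp only [Instr.eff, Function.update_self, Function.update_idem, Function.update_of_ne h49, hB]
  refine wp_seq_le 1 1 (wp_ins trivial (hb.update _ (by omega)) (by unfold Instr.ConstLe; omega)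
    ?_) le_rfl
  refine wp_ins trivial ((hb.update _ (by omega)).update _ (by omega)) trivial ?_
  simp only [Instr.eff, Function.update_self, Function.update_of_ne h50.symm]
  refine h _ (fun c hc hc' => ?_) (((hb.update _ (by omega)).update _ (by omega)).update _
    (by omega)) ?_
  · rw [Function.update_of_ne hc, Function.update_of_ne hc', Function.update_of_ne hc]
  · rw [Function.update_self]; omega

end Block

open Block

/-- The code that evaluates an expression, with the result in the cell `t`. -/
def Expr.compile : Expr → ℕ → Block
  | bool b, t => ins (.const t b.toNat)
  | var x, t => copy t x.cell
  | par i, t => copy t i.cell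
  | get a e, t => (e.compile t).seq <| (address t a).seq <| ins (.load t t)
  | add e f, t => (e.compile t).seq <| (f.compile (t + 1)).seq <| (ins (.add t t (t + 1))).seq <|
      (ins (.sub (t + 1) t capCell)).seq <| ins (.sub t t (t + 1))
  | sub e f, t => (e.compile t).seq <| (f.compile (t + 1)).seq <| ins (.sub t t (t + 1))
  | ite e f g, t => (e.compile t).seq <| branch t (f.compile t) (g.compile t)
  | find x i e, t => (copy (t + 1) x.cell).seq <| (copy (t + 2) i.cell).seq <|
      (copy t i.cell).seq <|
      (rep (t + 2) <| (ins (.const (t + 3) 1)).seq <| (ins (.sub x.cell (t + 2) (t + 3))).seq <|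
        (e.compile (t + 3)).seq <| branch (t + 3) (copy t x.cell) Block.skip).seq <|
      copy x.cell (t + 1)

/-- The code that executes a command, with auxiliary cells from `t` on. -/
def Cmd.compile : Cmd → ℕ → Block
  | skip, _ => Block.skip
  | set x e, t => (e.compile t).seq <| copy x.cell t
  | put a e f, t => (e.compile t).seq <| (f.compile (t + 1)).seq <| (address t a).seq <|
      ins (.store t (t + 1))
  | seq c d, t => (c.compile t).seq (d.compile t)
  | ite e c d, t => (e.compile t).seq <| branch t (c.compile t) (d.compile t)
  | loop x i c, t => (copy t i.cell).seq <| (ins (.const (t + 1) 0)).seq <| rep t <|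
      (copy x.cell (t + 1)).seq <| (c.compile (t + 2)).seq <|
      (ins (.const jmp 1)).seq <| ins (.add (t + 1) (t + 1) jmp)

theorem Expr.depth_pos (e : Expr) : 1 ≤ e.depth := by
  induction e <;> simp only [depth] <;> omega

/-- The auxiliary cells are used like a stack: code compiled for `t` leaves all cells below `t`
alone, apart from `jmp`, so that a second operand can be evaluated at `t + 1` while the first one
waits in `t`. -/
theorem Expr.wp_compile {E : Env} {B W : ℕ} (hE : E.Ok B W) (e : Expr) :
    ∀ (σ : St) (m : Mem) (t : ℕ), Rep E B σ m → Bd W m → σ.Le E.V → 51 ≤ t →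
      t + e.depth ≤ B → (e.compile t).wp W m (e.time E) fun m' =>
        Bd W m' ∧ Agree t B m m' ∧ m' t = e.eval E σ := by
  have hV := hE.pos
  have hle := hE.le
  induction e with
  | bool b =>
    intro σ m t hR hb hσ ht hd
    have h1 : b.toNat ≤ W := by cases b <;> simp; omega
    simp only [depth] at hd
    refine wp_ins trivial hb h1 ⟨hb.update _ h1, ?_, by simp [Instr.eff, eval]⟩
    exact (Agree.refl _ _ _).update (by omega) _
  | var x =>
    intro σ m t hR hb hσ ht hd
    simp only [depth] at hd
    have := x.cell_lt
    refine wp_copy (by omega) hb ⟨hb.update _ (hb _), ?_, by simp [eval, hR.reg]⟩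
    exact (Agree.refl _ _ _).update (by omega) _
  | par x =>
    intro σ m t hR hb hσ ht hd
    simp only [depth] at hd
    have := x.cell_lt
    refine wp_copy (by omega) hb ⟨hb.update _ (hb _), ?_, by simp [eval, hR.par]⟩
    exact (Agree.refl _ _ _).update (by omega) _
  | get a e ih =>
    intro σ m t hR hb hσ ht hd
    simp only [depth] at hd
    have hev := e.eval_le hE σ hσ
    refine wp_seq_le _ 9 ((ih σ m t hR hb hσ ht (by omega)).mono le_rfl ?_) le_rfl
    rintro m₁ ⟨hb₁, ha₁, h₁⟩
    have hR₁ := hR.of_agree ha₁ ht hE.base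
    refine wp_seq_le 8 1 (wp_address ht hb₁ hR₁.base (by omega) ?_) le_rfl
    intro m₂ h₂ hb₂ ht₂
    refine wp_ins trivial hb₂ trivial ⟨hb₂.update _ (hb₂ _), ?_, ?_⟩
    · refine fun c hc hc' => ?_
      rw [Instr.eff, Function.update_of_ne (by omega), h₂ _ (by omega) hc, ha₁ c hc hc']
    · simp only [Instr.eff, Function.update_self, eval, ht₂, h₁]
      rw [h₂ _ (by omega) (by unfold jmp; omega), hR₁.arr]
  | add e f ihe ihf =>
    intro σ m t hR hb hσ ht hd
    simp only [depth] at hd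
    have hev := e.eval_le hE σ hσ
    have hfv := f.eval_le hE σ hσ
    have hfp := f.depth_pos
    refine wp_seq_le (e.time E) (f.time E + 3) ((ihe σ m t hR hb hσ ht (by omega)).mono le_rfl ?_)
      (by simp only [time]; omega)
    rintro m₁ ⟨hb₁, ha₁, h₁⟩
    have hR₁ := hR.of_agree ha₁ ht hE.base
    refine wp_seq_le _ 3 ((ihf σ m₁ (t + 1) hR₁ hb₁ hσ (by omega) (by omega)).mono le_rfl ?_) le_rfl
    rintro m₂ ⟨hb₂, ha₂, h₂⟩
    have hR₂ := hR₁.of_agree ha₂ (by omega) hE.base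
    have h₂' : m₂ t = m₁ t := ha₂ t (by unfold jmp; omega) (by omega)
    have h48 : capCell ≠ t := by unfold capCell; omega
    have hbt : Bd W (Function.update m₂ t (m₂ t + m₂ (t + 1))) := hb₂.update _ (by omega)
    refine wp_seq_le 1 2 (wp_ins trivial hb₂ trivial ?_) le_rfl
    -- Truncation by subtraction: `s - (s - V) = min s V`.
    refine wp_seq_le 1 1 (wp_ins trivial hbt trivial ?_) le_rfl
    simp only [Instr.eff, Function.update_self, Function.update_of_ne h48, hR₂.cap]
    have hbt' := hbt.update (t + 1) (v := m₂ t + m₂ (t + 1) - E.V) (by omega)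
    refine wp_ins trivial hbt' trivial ?_
    simp only [Instr.eff, Function.update_self, Function.update_of_ne (show t ≠ t + 1 by omega)]
    refine ⟨hbt'.update _ (by omega), ?_, ?_⟩
    · exact (((ha₁.trans ha₂ (by omega)).update (by omega) _).update (by omega) _).update
        (by omega) _
    · simp only [eval, h₂', h₁, h₂]; omega
  | sub e f ihe ihf =>
    intro σ m t hR hb hσ ht hd
    simp only [depth] at hd
    have hev := e.eval_le hE σ hσ
    have hfp := f.depth_pos
    refine wp_seq_le (e.time E) (f.time E + 1) ((ihe σ m t hR hb hσ ht (by omega)).mono le_rfl ?_)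
      (by simp only [time]; omega)
    rintro m₁ ⟨hb₁, ha₁, h₁⟩
    have hR₁ := hR.of_agree ha₁ ht hE.base
    refine wp_seq_le _ 1 ((ihf σ m₁ (t + 1) hR₁ hb₁ hσ (by omega) (by omega)).mono le_rfl ?_) le_rfl
    rintro m₂ ⟨hb₂, ha₂, h₂⟩
    have h₂' : m₂ t = m₁ t := ha₂ t (by unfold jmp; omega) (by omega)
    refine wp_ins trivial hb₂ trivial ⟨hb₂.update _ (by omega), ?_, ?_⟩
    · exact (ha₁.trans ha₂ (by omega)).update (by omega) _
    · simp [Instr.eff, eval, h₂', h₁, h₂]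
  | ite e f g ihe ihf ihg =>
    intro σ m t hR hb hσ ht hd
    simp only [depth] at hd
    refine wp_seq_le (e.time E) (f.time E + g.time E + 3)
      ((ihe σ m t hR hb hσ ht (by omega)).mono le_rfl ?_) (by simp only [time]; omega)
    rintro m₁ ⟨hb₁, ha₁, h₁⟩
    have hR₁ := hR.of_agree ha₁ ht hE.base
    refine wp_branch hb₁ (by omega) (fun h => ?_) (fun h => ?_)
    · refine (ihf σ m₁ t hR₁ hb₁ hσ ht (by omega)).mono (by omega) ?_
      rintro m₂ ⟨hb₂, ha₂, h₂⟩
      refine ⟨hb₂, ha₁.trans ha₂ le_rfl, ?_⟩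
      rw [h₂, eval, if_pos (h₁ ▸ h)]
    · refine (ihg σ m₁ t hR₁ hb₁ hσ ht (by omega)).mono (by omega) ?_
      rintro m₂ ⟨hb₂, ha₂, h₂⟩
      refine ⟨hb₂, hb₂.update _ (by omega), (ha₁.trans ha₂ le_rfl).update (Or.inl rfl) _, ?_⟩
      rw [Function.update_of_ne (by unfold jmp; omega), h₂, eval, if_neg (by omega)]
  | find x i e ih =>
    intro σ m t hR hb hσ ht hd
    simp only [depth] at hd
    have hx := x.cell_lt
    have hi := i.cell_lt
    have hep := e.depth_pos
    have hiV := hE.par i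
    have hN : m i.cell = E.β i := hR.par i
    refine wp_seq_le 2 (E.β i * (e.time E + 11) + 9) (wp_copy (by omega) hb ?_)
      (by simp only [time]; omega)
    have hb₁ := hb.update (t + 1) (hb x.cell)
    refine wp_seq_le 2 (E.β i * (e.time E + 11) + 7) (wp_copy (by omega) hb₁ ?_) (by omega)
    rw [Function.update_of_ne (show i.cell ≠ t + 1 by omega), hN]
    have hb₂ := hb₁.update (t + 2) (v := E.β i) (by omega)
    refine wp_seq_le 2 (E.β i * (e.time E + 11) + 5) (wp_copy (by omega) hb₂ ?_) (by omega)
    rw [Function.update_of_ne (show i.cell ≠ t + 2 by omega),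
      Function.update_of_ne (show i.cell ≠ t + 1 by omega), hN]
    have hb₃ := hb₂.update t (v := E.β i) (by omega)
    -- The cell `t` holds the best hit so far, `t + 1` the saved value of `x`, and `t + 2` the
    -- counter. The variable `x` itself is overwritten in every round, so the invariant exempts its
    -- cell, and it is restored at the end.
    refine wp_seq_le (E.β i * (e.time E + 7 + 4) + 3) 2 (wp_rep (N := E.β i)
      (fun l m' => (∀ a, a ≠ jmp → a ≠ x.cell → a < t ∨ B ≤ a → m' a = m a) ∧
        m' (t + 1) = m x.cell ∧
        m' t = searchDown (fun j => e.eval E (σ.set x j)) (E.β i) l)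
      (by unfold jmp; omega) (by omega) hb₃ ?_ ?_ ?_ ?_) le_rfl
    · rw [Function.update_of_ne (by omega), Function.update_self]
    · refine ⟨fun a h₁ h₂ h₃ => ?_, ?_, ?_⟩
      · rw [Function.update_of_ne (by omega), Function.update_of_ne (by omega),
          Function.update_of_ne (by omega)]
      · rw [Function.update_of_ne (by omega), Function.update_of_ne (by omega),
          Function.update_self]
      · rw [Function.update_self, searchDown]
    · rintro l hl m₁ hb₁ hc₁ ⟨ha₁, hs₁, ht₁⟩
      have hbc := hb₁.update (t + 3) (v := 1) (by omega)
      refine wp_seq_le 1 (e.time E + 6) (wp_ins trivial hb₁ (show 1 ≤ W by omega) ?_) (by omega)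
      refine wp_seq_le 1 (e.time E + 5) (wp_ins trivial hbc trivial ?_) (by omega)
      simp only [Instr.eff, Function.update_self, Function.update_of_ne (show t + 2 ≠ t + 3 by omega),
        hc₁]
      rw [show E.β i - l - 1 = E.β i - (l + 1) by omega]
      set j := E.β i - (l + 1) with hj
      have hR₁ : Rep E B (σ.set x j) (Function.update (Function.update m₁ (t + 3) 1) x.cell j) := by
        refine Rep.of_agree (t := t) (hR.set hE.base x j) (fun a h₁ h₂ => ?_) ht hE.base
        by_cases hax : a = x.cell
        · subst hax; simp
        · rw [Function.update_of_ne hax, Function.update_of_ne hax,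
            Function.update_of_ne (by omega), ha₁ a h₁ hax h₂]
      have hb₂ := hbc.update x.cell (v := j) (by omega)
      refine wp_seq_le (e.time E) 5 ((ih _ _ (t + 3) hR₁ hb₂ (hσ.set x (by omega)) (by omega)
        (by omega)).mono le_rfl ?_) le_rfl
      rintro m₂ ⟨hb₃, ha₃, h₃⟩
      have hx₂ : m₂ x.cell = j := by
        rw [ha₃ _ (by unfold jmp; omega) (by omega), Function.update_self]
      have hout : ∀ a, a ≠ jmp → a ≠ x.cell → a < t + 3 ∨ B ≤ a → m₂ a = m₁ a := by
        intro a h₁ h₂ h₃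
        rw [ha₃ a h₁ (by omega), Function.update_of_ne h₂, Function.update_of_ne (by omega)]
      have hbj : j ≤ W := by omega
      refine wp_branch hb₃ (by omega) (fun h => ?_) (fun h => ?_)
      · refine wp_copy (by omega) hb₃ ⟨hb₃.update _ (hb₃ _), ?_, fun a h₁ h₂ h₃ => ?_, ?_, ?_⟩
        · rw [Function.update_of_ne (by omega), hout _ (by unfold jmp; omega) (by omega) (by omega),
            hc₁]
        · rw [Function.update_of_ne (by omega), Function.update_of_ne (by omega),
            Function.update_of_ne (by omega), hout a h₁ h₂ (by omega), ha₁ a h₁ h₂ h₃]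
        · rw [Function.update_of_ne (by omega), Function.update_of_ne (by unfold jmp; omega),
            Function.update_of_ne (by omega), hout _ (by unfold jmp; omega) (by omega) (by omega),
            hs₁]
        · rw [Function.update_of_ne (by omega), Function.update_of_ne (by unfold jmp; omega),
            Function.update_self, hx₂, searchDown, if_pos (by rw [← hj, ← h₃]; exact h)]
      · refine (wp_skip ⟨hb₃, hb₃.update _ (by omega), ?_, fun a h₁ h₂ h₃ => ?_, ?_, ?_⟩).mono
          (Nat.zero_le _) fun _ => id
        · rw [Function.update_of_ne (by unfold jmp; omega),
            hout _ (by unfold jmp; omega) (by omega) (by omega), hc₁]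
        · rw [Function.update_of_ne (by omega), Function.update_of_ne (by omega),
            Function.update_of_ne (by omega), hout a h₁ h₂ (by omega), ha₁ a h₁ h₂ h₃]
        · rw [Function.update_of_ne (by omega), Function.update_of_ne (by unfold jmp; omega),
            Function.update_of_ne (by unfold jmp; omega),
            hout _ (by unfold jmp; omega) (by omega) (by omega), hs₁]
        · rw [Function.update_of_ne (by omega), Function.update_of_ne (by unfold jmp; omega),
            Function.update_of_ne (by unfold jmp; omega),
            hout _ (by unfold jmp; omega) (by omega) (by omega), ht₁, searchDown,
            if_neg (by rw [← hj, ← h₃]; omega)]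
    · rintro m₁ hb₁ - ⟨ha₁, hs₁, ht₁⟩
      have hb₄ := hb₁.update jmp (v := 1) (by omega)
      refine wp_copy (by omega) hb₄ ⟨hb₄.update _ (hb₄ _), fun a h₁ h₂ => ?_, ?_⟩
      · by_cases hax : a = x.cell
        · subst hax
          rw [Function.update_self, Function.update_of_ne (by unfold jmp; omega), hs₁]
        · rw [Function.update_of_ne hax, Function.update_of_ne h₁, ha₁ a h₁ hax h₂]
      · rw [Function.update_of_ne (by omega), Function.update_of_ne (by unfold jmp; omega), ht₁,
          eval]

/-- The last clause protects the cells from 51 to `t`, in which the enclosing loops keep their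
counters. -/
theorem Cmd.wp_compile {E : Env} {B W : ℕ} (hE : E.Ok B W) (c : Cmd) :
    ∀ (σ : St) (m : Mem) (t : ℕ), Rep E B σ m → Bd W m → σ.Le E.V → 51 ≤ t →
      t + c.depth ≤ B → (c.compile t).wp W m (c.time E) fun m' =>
        Bd W m' ∧ Rep E B (c.run E σ) m' ∧ ∀ a, 51 ≤ a → a < t → m' a = m a := by
  have hV := hE.pos
  have hle := hE.le
  induction c with
  | skip => exact fun σ m t hR hb _ _ _ => wp_skip ⟨hb, hR, fun _ _ _ => rfl⟩
  | set x e =>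
    intro σ m t hR hb hσ ht hd
    simp only [depth] at hd
    have hx := x.cell_lt
    refine wp_seq_le _ 2 ((e.wp_compile hE σ m t hR hb hσ ht hd).mono le_rfl ?_) le_rfl
    rintro m₁ ⟨hb₁, ha₁, h₁⟩
    refine wp_copy (by omega) hb₁ ⟨hb₁.update _ (hb₁ _), ?_, fun a h h' => ?_⟩
    · rw [h₁]; exact (hR.of_agree ha₁ ht hE.base).set hE.base x _
    · rw [Function.update_of_ne (by omega), ha₁ a (by unfold jmp; omega) (by omega)]
  | put a e f =>
    intro σ m t hR hb hσ ht hd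
    simp only [depth] at hd
    have hev := e.eval_le hE σ hσ
    refine wp_seq_le (e.time E) (f.time E + 9)
      ((e.wp_compile hE σ m t hR hb hσ ht (by omega)).mono le_rfl ?_) (by simp only [time]; omega)
    rintro m₁ ⟨hb₁, ha₁, h₁⟩
    have hR₁ := hR.of_agree ha₁ ht hE.base
    refine wp_seq_le _ 9
      ((f.wp_compile hE σ m₁ (t + 1) hR₁ hb₁ hσ (by omega) (by omega)).mono le_rfl ?_) le_rfl
    rintro m₂ ⟨hb₂, ha₂, h₂⟩
    have hR₂ := hR₁.of_agree ha₂ (by omega) hE.base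
    have h₂' : m₂ t = e.eval E σ := by rw [ha₂ t (by unfold jmp; omega) (by omega), h₁]
    refine wp_seq_le 8 1 (wp_address ht hb₂ hR₂.base (by omega) ?_) le_rfl
    intro m₃ h₃ hb₃ ht₃
    have hf : m₃ (t + 1) = f.eval E σ := by
      rw [h₃ _ (by omega) (by unfold jmp; omega), h₂]
    refine wp_ins trivial hb₃ trivial ⟨hb₃.update _ (hb₃ _), ?_, fun b h h' => ?_⟩
    · simp only [Instr.eff, ht₃, hf, h₂']
      refine Rep.put (hR₂.of_agree (t := t) (fun c h h' => ?_) ht hE.base) hE.base a _ _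
      exact h₃ c (by omega) h
    · simp only [Instr.eff, ht₃]
      rw [Function.update_of_ne (by omega), h₃ b (by omega) (by unfold jmp; omega),
        ha₂ b (by unfold jmp; omega) (by omega), ha₁ b (by unfold jmp; omega) (by omega)]
  | seq c d hc hd' =>
    intro σ m t hR hb hσ ht hd
    simp only [depth] at hd
    refine wp_seq_le _ (d.time E) ((hc σ m t hR hb hσ ht (by omega)).mono le_rfl ?_) le_rfl
    rintro m₁ ⟨hb₁, hR₁, h₁⟩
    refine (hd' _ m₁ t hR₁ hb₁ (c.run_le hE σ hσ) ht (by omega)).mono le_rfl ?_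
    rintro m₂ ⟨hb₂, hR₂, h₂⟩
    exact ⟨hb₂, hR₂, fun a h h' => by rw [h₂ a h h', h₁ a h h']⟩
  | ite e c d hc hd' =>
    intro σ m t hR hb hσ ht hd
    simp only [depth] at hd
    refine wp_seq_le (e.time E) (c.time E + d.time E + 3)
      ((e.wp_compile hE σ m t hR hb hσ ht (by omega)).mono le_rfl ?_) (by simp only [time]; omega)
    rintro m₁ ⟨hb₁, ha₁, h₁⟩
    have hR₁ := hR.of_agree ha₁ ht hE.base
    have hr₁ : ∀ a, 51 ≤ a → a < t → m₁ a = m a := fun a h h' =>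
      ha₁ a (by unfold jmp; omega) (by omega)
    refine wp_branch hb₁ (by omega) (fun h => ?_) (fun h => ?_)
    · refine (hc σ m₁ t hR₁ hb₁ hσ ht (by omega)).mono (by omega) ?_
      rintro m₂ ⟨hb₂, hR₂, h₂⟩
      refine ⟨hb₂, ?_, fun a h h' => by rw [h₂ a h h', hr₁ a h h']⟩
      rwa [run, if_pos (h₁ ▸ h)]
    · refine (hd' σ m₁ t hR₁ hb₁ hσ ht (by omega)).mono (by omega) ?_
      rintro m₂ ⟨hb₂, hR₂, h₂⟩
      refine ⟨hb₂, hb₂.update _ (by omega), ?_, fun a h h' => ?_⟩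
      · rw [run, if_neg (by omega)]
        exact hR₂.of_agree ((Agree.refl 51 B _).update (Or.inl rfl) _) le_rfl hE.base
      · rw [Function.update_of_ne (by unfold jmp; omega), h₂ a h h', hr₁ a h h']
  | loop x i c hc =>
    intro σ m t hR hb hσ ht hd
    simp only [depth] at hd
    have hx := x.cell_lt
    have hi := i.cell_lt
    have hiV := hE.par i
    refine wp_seq_le 2 (E.β i * (c.time E + 8) + 4) (wp_copy (by omega) hb ?_)
      (by simp only [time]; omega)
    rw [hR.par]
    have hb₁ := hb.update t (v := E.β i) (by omega)
    refine wp_seq_le 1 (E.β i * (c.time E + 4 + 4) + 3) (wp_ins trivial hb₁ (Nat.zero_le _) ?_)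
      (by rw [show c.time E + 4 + 4 = c.time E + 8 by omega]; omega)
    have hb₂ := hb₁.update (t + 1) (v := 0) (by omega)
    -- The cell `t` counts down while `t + 1` counts up. The loop variable is copied afresh from `t
    -- + 1` in each round, so the body is free to change it.
    refine wp_rep (N := E.β i) (fun l m' => m' (t + 1) = l ∧ (∀ a, 51 ≤ a → a < t → m' a = m a) ∧
      Rep E B (iter (fun j σ => c.run E (σ.set x j)) l σ) m' ∧
      (iter (fun j σ => c.run E (σ.set x j)) l σ).Le E.V)
      (by unfold jmp; omega) (by omega) hb₂ ?_ ?_ ?_ ?_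
    · rw [Instr.eff, Function.update_of_ne (by omega), Function.update_self]
    · refine ⟨by simp [Instr.eff], fun a h h' => ?_, ?_, hσ⟩
      · rw [Instr.eff, Function.update_of_ne (by omega), Function.update_of_ne (by omega)]
      · exact hR.of_agree (t := t) (((Agree.refl _ _ _).update (by omega) _).update (by omega) _)
          ht hE.base
    · rintro l hl m₁ hb₁ hc₁ ⟨h₁, ha₁, hR₁, hσ₁⟩
      refine wp_seq_le 2 (c.time E + 2) (wp_copy (by omega) hb₁ ?_) (by omega)
      rw [h₁]
      have hb₃ := hb₁.update x.cell (v := l) (by omega)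
      refine wp_seq_le (c.time E) 2 ((hc _ _ (t + 2) (hR₁.set hE.base x l) hb₃
        (hσ₁.set x (by omega)) (by omega) (by omega)).mono le_rfl ?_) le_rfl
      rintro m₂ ⟨hb₄, hR₂, h₂⟩
      have hl₂ : m₂ (t + 1) = l := by
        rw [h₂ _ (by omega) (by omega), Function.update_of_ne (by omega), h₁]
      have hb₅ := hb₄.update jmp (v := 1) (by omega)
      refine wp_seq_le 1 1 (wp_ins trivial hb₄ (show 1 ≤ W by omega) ?_) le_rfl
      refine wp_ins trivial hb₅ trivial ?_
      simp only [Instr.eff, Function.update_self,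
        Function.update_of_ne (show t + 1 ≠ jmp by unfold jmp; omega), hl₂]
      refine ⟨hb₅.update _ (by omega), ?_, ?_, fun a h h' => ?_, ?_, ?_⟩
      · rw [Function.update_of_ne (by omega), Function.update_of_ne (by unfold jmp; omega),
          h₂ _ (by omega) (by omega), Function.update_of_ne (by omega), hc₁]
      · rw [Function.update_of_ne (by omega), Function.update_of_ne (by unfold jmp; omega),
          Function.update_self]
      · rw [Function.update_of_ne (by omega), Function.update_of_ne (by unfold jmp; omega),
          Function.update_of_ne (by omega), Function.update_of_ne (by unfold jmp; omega),
          h₂ _ (by omega) (by omega), Function.update_of_ne (by omega), ha₁ a h h']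
      · refine hR₂.of_agree (t := t) ?_ ht hE.base
        exact ((((Agree.refl t B m₂).update (Or.inl rfl) _).update (by omega) _).update
          (Or.inl rfl) _).update (by omega) _
      · exact c.run_le hE _ (hσ₁.set x (by omega))
    · rintro m₁ hb₁ - ⟨-, ha₁, hR₁, -⟩
      refine ⟨hb₁.update _ (by omega), ?_, fun a h h' => ?_⟩
      · exact hR₁.of_agree ((Agree.refl 51 B _).update (Or.inl rfl) _) le_rfl hE.base
      · rw [Function.update_of_ne (by unfold jmp; omega), ha₁ a h h']

end RAM

/-! ### Setting up the memory -/

namespace RAM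

open Block

theorem wp_const {W : ℕ} {m : Mem} {Q : Mem → Prop} {d a : ℕ} (hb : Bd W m) (ha : a ≤ W)
    (h : Bd W (Function.update m d a) → Q (Function.update m d a)) :
    (ins (.const d a)).wp W m 1 Q :=
  wp_ins trivial hb ha (h (hb.update _ ha))

theorem wp_add {W : ℕ} {m : Mem} {Q : Mem → Prop} {d a b : ℕ} (hb : Bd W m)
    (hab : m a + m b ≤ W)
    (h : Bd W (Function.update m d (m a + m b)) → Q (Function.update m d (m a + m b))) :
    (ins (.add d a b)).wp W m 1 Q :=
  wp_ins trivial hb trivial (h (hb.update _ hab))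

theorem wp_sub {W : ℕ} {m : Mem} {Q : Mem → Prop} {d a b : ℕ} (hb : Bd W m)
    (h : Bd W (Function.update m d (m a - m b)) → Q (Function.update m d (m a - m b))) :
    (ins (.sub d a b)).wp W m 1 Q :=
  wp_ins trivial hb trivial (h (hb.update _ ((Nat.sub_le _ _).trans (hb a))))

theorem wp_load {W : ℕ} {m : Mem} {Q : Mem → Prop} {d a : ℕ} (hb : Bd W m)
    (h : Bd W (Function.update m d (m (m a))) → Q (Function.update m d (m (m a)))) :
    (ins (.load d a)).wp W m 1 Q :=
  wp_ins trivial hb trivial (h (hb.update _ (hb _)))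

theorem wp_store {W : ℕ} {m : Mem} {Q : Mem → Prop} {d a : ℕ} (hb : Bd W m)
    (h : Bd W (Function.update m (m d) (m a)) → Q (Function.update m (m d) (m a))) :
    (ins (.store d a)).wp W m 1 Q :=
  wp_ins trivial hb trivial (h (hb.update _ (hb _)))

/-! ### Packing the low input cells into one number -/

/-- The content of the `c` cells from cell `3` on, as digits of a binary number. -/
def lowCode (X : Mem) (c : ℕ) : ℕ := ∑ i ∈ Finset.range c, X (3 + i) * 2 ^ i

theorem lowCode_lt {X : Mem} {c : ℕ} (h : ∀ i < c, X (3 + i) ≤ 1) : lowCode X c < 2 ^ c := by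
  induction c with
  | zero => simp [lowCode]
  | succ c ih =>
    rw [lowCode, Finset.sum_range_succ, ← lowCode, pow_succ]
    have := ih fun i hi => h i (by omega)
    have := Nat.mul_le_mul_right (2 ^ c) (h c (by omega))
    omega

/-- Collect the `c` bits from cell `3` on in the cell `2`. -/
def encode : ℕ → Block
  | 0 => Block.skip
  | c + 1 => (ins (.add 2 2 2)).seq <| (ins (.add 2 2 (3 + c))).seq (encode c)

/-- Horner's scheme, unrolled. The first cells of the matrix lie where variables and auxiliary cells
are to be; packing them into one cell needs no free memory. -/
theorem wp_encode {W : ℕ} (c : ℕ) : ∀ m : Mem, Bd W m → (∀ i < c, m (3 + i) ≤ 1) →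
    (m 2 + 1) * 2 ^ c ≤ W → (encode c).wp W m (2 * c) fun m' =>
      Bd W m' ∧ (∀ a, a ≠ 2 → m' a = m a) ∧ m' 2 = m 2 * 2 ^ c + lowCode m c := by
  induction c with
  | zero => exact fun m hb _ _ => wp_skip ⟨hb, fun _ _ => rfl, by simp [lowCode]⟩
  | succ c ih =>
    intro m hb hX hW
    have hc := hX c (by omega)
    have h1 : 2 * m 2 + 2 ≤ W := by
      refine le_trans ?_ hW
      rw [pow_succ]
      have := Nat.mul_le_mul_left (m 2 + 1) (Nat.one_le_two_pow (n := c))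
      nlinarith
    refine wp_seq_le 1 (2 * c + 1) (wp_add hb (by omega) fun hb₁ => ?_) (by omega)
    refine wp_seq_le 1 (2 * c) (wp_add hb₁ ?_ fun hb₂ => ?_) (by omega)
    · rw [Function.update_self, Function.update_of_ne (by omega)]; omega
    rw [Function.update_self, Function.update_of_ne (show 3 + c ≠ 2 by omega),
      Function.update_idem] at hb₂ ⊢
    have hlow : ∀ v, lowCode (Function.update m 2 v) c = lowCode m c := fun v =>
      Finset.sum_congr rfl fun i _ => by rw [Function.update_of_ne (by omega)]
    refine (ih _ hb₂ (fun i hi => ?_) ?_).mono le_rfl ?_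
    · rw [Function.update_of_ne (by omega)]; exact hX i (by omega)
    · rw [Function.update_self]
      refine le_trans ?_ hW
      rw [pow_succ, mul_comm (2 ^ c), ← mul_assoc]
      exact Nat.mul_le_mul_right _ (by omega)
    · rintro m' ⟨hb', ha', h2⟩
      refine ⟨hb', fun a ha => by rw [ha' a ha, Function.update_of_ne ha], ?_⟩
      rw [h2, hlow, Function.update_self, lowCode, lowCode, Finset.sum_range_succ, pow_succ]
      ring

/-- Move the `c` bits collected in the cell `2` to the array that begins at `X baseCell`. -/
def decode : ℕ → Block
  | 0 => Block.skip
  | c + 1 => ((ins (.const 9 (2 ^ c - 1))).seq <| (ins (.sub 10 2 9)).seq <|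
      branch 10 ((ins (.const 9 (2 ^ c))).seq <| (ins (.sub 2 2 9)).seq <|
        (ins (.const 11 (32 * (c + 1)))).seq <| (ins (.add 11 11 baseCell)).seq <|
        (ins (.const 12 1)).seq <| ins (.store 11 12)) Block.skip).seq (decode c)

/-- The top digit is one exactly if the number is at least `2 ^ c`, because the lower digits sum to
less. The cell tested is the number minus `2 ^ c - 1`, which is positive in just this case. -/
theorem wp_decode {W B : ℕ} {X : Mem} (hB : 51 ≤ B) (c : ℕ) : ∀ m : Mem, Bd W m →
    (∀ i < c, X (3 + i) ≤ 1) → m 2 = lowCode X c → m baseCell = B → 2 ^ c ≤ W →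
    B + 32 * (c + 1) ≤ W → (∀ i < c, m (B + 32 * (i + 1)) = 0) →
    (decode c).wp W m (11 * c) fun m' => Bd W m' ∧
      (∀ i < c, m' (B + 32 * (i + 1)) = X (3 + i)) ∧
      ∀ a, a ≠ 2 → a ≠ 9 → a ≠ 10 → a ≠ 11 → a ≠ 12 → a ≠ jmp →
        (∀ i < c, a ≠ B + 32 * (i + 1)) → m' a = m a := by
  induction c with
  | zero => exact fun m hb _ _ _ _ _ _ => wp_skip ⟨hb, by simp, fun _ _ _ _ _ _ _ _ => rfl⟩
  | succ c ih =>
    intro m hb hX h2 h49 hW hW' h0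
    have hlt := lowCode_lt (X := X) (c := c) fun i hi => hX i (by omega)
    have hsum : m 2 = lowCode X c + X (3 + c) * 2 ^ c := by
      rw [h2, lowCode, Finset.sum_range_succ, lowCode]
    have hc := hX c (by omega)
    have hpow : 2 ^ c ≤ W := le_trans (Nat.pow_le_pow_right (by norm_num) (by omega)) hW
    have hpos : 0 < 2 ^ c := Nat.two_pow_pos c
    refine wp_seq_le 11 (11 * c) ?_ (by omega)
    refine wp_seq_le 1 10 (wp_const hb (by omega) fun hb₁ => ?_) le_rfl
    refine wp_seq_le 1 9 (wp_sub hb₁ fun hb₂ => ?_) le_rfl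
    simp only [Function.update_self, Function.update_of_ne (show 2 ≠ 9 by decide)] at hb₂ ⊢
    refine wp_branch (τ := 6) hb₂ (by omega) (fun hpos' => ?_) (fun hz => ?_)
    · rw [Function.update_self] at hpos'
      have hXc : X (3 + c) = 1 := by
        by_contra hne
        have : X (3 + c) = 0 := by omega
        rw [this] at hsum; omega
      rw [hXc, one_mul] at hsum
      refine wp_seq_le 1 5 (wp_const hb₂ hpow fun hb₃ => ?_) le_rfl
      refine wp_seq_le 1 4 (wp_sub hb₃ fun hb₄ => ?_) le_rfl
      refine wp_seq_le 1 3 (wp_const hb₄ (by omega) fun hb₅ => ?_) le_rfl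
      refine wp_seq_le 1 2 (wp_add hb₅ ?_ fun hb₆ => ?_) le_rfl
      · simp [h49]; omega
      refine wp_seq_le 1 1 (wp_const hb₆ (by omega) fun hb₇ => ?_) le_rfl
      refine wp_store hb₇ fun hb₈ => ?_
      generalize hm' : Function.update (β := fun _ : ℕ => ℕ) _ _ _ = m' at hb₈ ⊢
      have h11 : ∀ a, m' a = if a = B + 32 * (c + 1) then 1 else if a = 12 then 1 else
          if a = 11 then B + 32 * (c + 1) else if a = 2 then lowCode X c else
          if a = 9 then 2 ^ c else if a = 10 then m 2 - (2 ^ c - 1) else m a := by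
        intro a
        rw [← hm']
        simp only [Function.update_apply]
        norm_num [h49]
        have e1 : 32 * (c + 1) + B = B + 32 * (c + 1) := by omega
        have e2 : m 2 - 2 ^ c = lowCode X c := by omega
        rw [e1, e2]
        split_ifs <;> rfl
      clear hm'
      refine (ih m' hb₈ (fun i hi => hX i (by omega)) ?_ ?_ hpow (by omega) fun i hi => ?_).mono
        le_rfl ?_
      · rw [h11, if_neg (by omega)]; rfl
      · rw [h11, if_neg (by unfold baseCell; omega)]; exact h49
      · rw [h11, if_neg (by omega), if_neg (by omega), if_neg (by omega), if_neg (by omega),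
          if_neg (by omega), if_neg (by omega)]
        exact h0 i (by omega)
      · rintro m'' ⟨hb', hi', ha'⟩
        refine ⟨hb', fun i hi => ?_, fun a a2 a9 a10 a11 a12 aj ha => ?_⟩
        · rcases Nat.lt_succ_iff_lt_or_eq.1 hi with hi | rfl
          · exact hi' i hi
          · rw [ha' _ (by omega) (by omega) (by omega) (by omega) (by omega)
              (by unfold jmp; omega) (fun j hj => by omega), h11, if_pos rfl, hXc]
        · rw [ha' a a2 a9 a10 a11 a12 aj fun i hi => ha i (by omega), h11,
            if_neg (ha c (by omega)), if_neg a12, if_neg a11, if_neg a2, if_neg a9, if_neg a10]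
    · rw [Function.update_self] at hz
      have hXc : X (3 + c) = 0 := by
        by_contra hne
        have : X (3 + c) = 1 := by omega
        rw [this] at hsum; omega
      rw [hXc, zero_mul, add_zero] at hsum
      refine (wp_skip ⟨hb₂, ?_⟩).mono (Nat.zero_le _) fun _ => id
      have hb₃ := hb₂.update jmp (v := 1) (by omega)
      generalize hm' : Function.update (β := fun _ : ℕ => ℕ) _ _ _ = m' at hb₃ ⊢
      have h11 : ∀ a, a ≠ jmp → a ≠ 10 → a ≠ 9 → m' a = m a := by
        intro a h1 h2 h3
        rw [← hm', Function.update_of_ne h1, Function.update_of_ne h2, Function.update_of_ne h3]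
      clear hm'
      refine (ih m' hb₃ (fun i hi => hX i (by omega)) ?_ ?_ hpow (by omega) fun i hi => ?_).mono
        le_rfl ?_
      · rw [h11 _ (by decide) (by decide) (by decide), hsum]
      · rw [h11 _ (by decide) (by decide) (by decide), h49]
      · rw [h11 _ (by unfold jmp; omega) (by omega) (by omega)]
        exact h0 i (by omega)
      · rintro m'' ⟨hb', hi', ha'⟩
        refine ⟨hb', fun i hi => ?_, fun a a2 a9 a10 a11 a12 aj ha => ?_⟩
        · rcases Nat.lt_succ_iff_lt_or_eq.1 hi with hi | rfl
          · exact hi' i hi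
          · rw [ha' _ (by omega) (by omega) (by omega) (by omega) (by omega)
              (by unfold jmp; omega) (fun j hj => by omega),
              h11 _ (by unfold jmp; omega) (by omega) (by omega), h0 _ (by omega), hXc]
        · rw [ha' a a2 a9 a10 a11 a12 aj fun i hi => ha i (by omega), h11 a aj a10 a9]

/-- Set the cells below `c` to zero. -/
def zeros : ℕ → Block
  | 0 => Block.skip
  | c + 1 => (ins (.const c 0)).seq (zeros c)

theorem wp_zeros {W : ℕ} (c : ℕ) : ∀ m : Mem, Bd W m → (zeros c).wp W m c fun m' =>
    Bd W m' ∧ ∀ a, m' a = if a < c then 0 else m a := by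
  induction c with
  | zero => exact fun m hb => wp_skip ⟨hb, by simp⟩
  | succ c ih =>
    intro m hb
    refine wp_seq_le 1 c (wp_const hb (Nat.zero_le _) fun hb₁ => ?_) (by omega)
    refine (ih _ hb₁).mono le_rfl ?_
    rintro m' ⟨hb', h⟩
    refine ⟨hb', fun a => ?_⟩
    rw [h, Function.update_apply]
    split_ifs <;> first | rfl | omega

/-! ### Constants of the run and transfer of the matrix -/

/-- Store the parameters, the address at which the arrays begin, and the largest number. -/
def setupCells (R : ℕ) : Block :=
  (copy 40 0).seq <| (ins (.const 3 1)).seq <| (ins (.add 4 0 0)).seq <|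
  (ins (.add 4 4 3)).seq <| (ins (.sub 5 1 4)).seq <| (ins (.sub 41 1 5)).seq <|
  (ins (.const baseCell R)).seq <| (copy 4 40).seq <|
  (rep 4 (ins (.add baseCell baseCell 40))).seq <|
  (ins (.const capCell 1)).seq <| (copy 4 baseCell).seq <| (ins (.add 4 4 4)).seq <|
  (ins (.add 4 4 4)).seq <| (ins (.add 4 4 4)).seq <| rep 4 (ins (.add capCell capCell capCell))

/-- The product `n * n` comes from repeated addition, the cap from repeated doubling, and the
minimum from `k - (k - (2 * n + 1))`. Clipping `k` keeps the loops short when `k` is huge; no graph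
on `n` vertices has a colouring with more than `2 * n` colours anyway. -/
theorem wp_setupCells {W n k R B : ℕ} {m : Mem} (hb : Bd W m) (h0 : m 0 = n) (h1 : m 1 = k)
    (hB : B = R + n * n) (hR : 51 ≤ R) (hW : 2 ^ (8 * B) + 8 * B ≤ W) :
    (setupCells R).wp W m (5 * (n + 8 * B) + 30) fun m' => Bd W m' ∧ m' 40 = n ∧
      m' 41 = min k (2 * n + 1) ∧ m' baseCell = B ∧ m' capCell = 2 ^ (8 * B) ∧
      ∀ a, a = 2 ∨ 51 ≤ a → m' a = m a := by
  have hnW : 2 * n + 1 ≤ W := by nlinarith [Nat.zero_le (2 ^ (8 * B))]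
  have hBW : 8 * B ≤ W := le_trans (Nat.le_add_left _ _) hW
  refine wp_seq_le 2 (5 * (n + 8 * B) + 28) (wp_copy (by decide) hb ?_) (by omega)
  refine wp_seq_le 1 (5 * (n + 8 * B) + 27) (wp_const (hb.update _ (hb _)) (by omega)
    fun hb₁ => ?_) (by omega)
  refine wp_seq_le 1 (5 * (n + 8 * B) + 26) (wp_add hb₁ ?_ fun hb₂ => ?_) (by omega)
  · simp [h0]; omega
  refine wp_seq_le 1 (5 * (n + 8 * B) + 25) (wp_add hb₂ ?_ fun hb₃ => ?_) (by omega)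
  · simp [h0]; omega
  refine wp_seq_le 1 (5 * (n + 8 * B) + 24) (wp_sub hb₃ fun hb₄ => ?_) (by omega)
  refine wp_seq_le 1 (5 * (n + 8 * B) + 23) (wp_sub hb₄ fun hb₅ => ?_) (by omega)
  generalize hm₁ : Function.update (β := fun _ : ℕ => ℕ) _ _ _ = m₁ at hb₅ ⊢
  have f40 : m₁ 40 = n := by rw [← hm₁]; simp [h0]
  have f41 : m₁ 41 = min k (2 * n + 1) := by
    rw [← hm₁]; simp [h0, h1]; omega
  have fo : ∀ a, a = 2 ∨ 51 ≤ a → m₁ a = m a := fun a ha => by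
    rw [← hm₁, Function.update_of_ne (by omega), Function.update_of_ne (by omega),
      Function.update_of_ne (by omega), Function.update_of_ne (by omega),
      Function.update_of_ne (by omega), Function.update_of_ne (by omega)]
  clear hm₁ hb₁ hb₂ hb₃ hb₄
  refine wp_seq_le 1 (5 * (n + 8 * B) + 22) (wp_const hb₅ (by omega) fun hb₆ => ?_) (by omega)
  refine wp_seq_le 2 (5 * (n + 8 * B) + 20) (wp_copy (by decide) hb₆ ?_) (by omega)
  refine wp_seq_le (n * (1 + 4) + 3) (5 * (8 * B) + 17) (wp_rep (N := n)
    (fun l m' => m' 40 = n ∧ m' 41 = min k (2 * n + 1) ∧ m' baseCell = R + n * l ∧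
      ∀ a, a = 2 ∨ 51 ≤ a → m' a = m a)
    (by decide) (by omega) (hb₆.update _ (hb₆ _)) ?_ ?_ ?_ ?_) (by omega)
  · simp [f40]
  · refine ⟨by simp [f40], by simp [f41],
      by simp, fun a ha => ?_⟩
    rw [Function.update_of_ne (by omega), Function.update_of_ne (by unfold baseCell; omega),
      fo a ha]
  · rintro l hl m₂ hb₂ hc₂ ⟨g40, g41, g49, go⟩
    have : R + n * l + n ≤ W := by nlinarith [Nat.zero_le (2 ^ (8 * B))]
    refine wp_add hb₂ (by rw [g49, g40]; exact this) fun hb₃ => ⟨hb₃, by simpa using hc₂,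
      by simp [g40], by simp [g41], ?_,
      fun a ha => ?_⟩
    · simp [g40, g49]; ring
    · rw [Function.update_of_ne (by omega), Function.update_of_ne (by unfold jmp; omega),
        Function.update_of_ne (by unfold baseCell; omega), go a ha]
  · rintro m₂ hb₂ - ⟨g40, g41, g49, go⟩
    rw [← hB] at g49
    have hb₃ := hb₂.update jmp (v := 1) (by omega)
    refine wp_seq_le 1 (5 * (8 * B) + 16) (wp_const hb₃ (by omega) fun hb₄ => ?_) (by omega)
    refine wp_seq_le 2 (5 * (8 * B) + 14) (wp_copy (by decide) hb₄ ?_) (by omega)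
    have hb₅ := hb₄.update 4 (hb₄ baseCell)
    refine wp_seq_le 1 (5 * (8 * B) + 13) (wp_add hb₅ ?_ fun hb₆ => ?_) (by omega)
    · simp [g49]; omega
    refine wp_seq_le 1 (5 * (8 * B) + 12) (wp_add hb₆ ?_ fun hb₇ => ?_) (by omega)
    · simp [g49]; omega
    refine wp_seq_le 1 (5 * (8 * B) + 11) (wp_add hb₇ ?_ fun hb₈ => ?_) (by omega)
    · simp [g49]; omega
    refine (wp_rep (N := 8 * B) (τ := 1)
      (fun l m' => m' 40 = n ∧ m' 41 = min k (2 * n + 1) ∧ m' baseCell = B ∧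
        m' capCell = 2 ^ l ∧ ∀ a, a = 2 ∨ 51 ≤ a → m' a = m a)
      (by decide) (by omega) hb₈ ?_ ?_ ?_ ?_).mono (show _ ≤ 5 * (8 * B) + 11 by omega)
      fun _ => id
    · simp [g49]; omega
    · refine ⟨by simp [g40], by simp [g41],
        by simp [g49], by simp, fun a ha => ?_⟩
      rw [Function.update_of_ne (by omega), Function.update_of_ne (by omega),
        Function.update_of_ne (by omega), Function.update_of_ne (by omega),
        Function.update_of_ne (by unfold capCell; omega),
        Function.update_of_ne (by unfold jmp; omega), go a ha]
    · rintro l hl m₃ hb₃ hc₃ ⟨k40, k41, k49, k48, ko⟩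
      have : 2 ^ l + 2 ^ l ≤ W := by
        have : 2 ^ (l + 1) ≤ 2 ^ (8 * B) := Nat.pow_le_pow_right (by norm_num) hl
        rw [pow_succ] at this; omega
      refine wp_add hb₃ (by rw [k48]; exact this) fun hb₄ => ⟨hb₄, by simpa using hc₃,
        by simp [k40], by simp [k41],
        by simp [k49], ?_, fun a ha => ?_⟩
      · simp [k48]; ring
      · rw [Function.update_of_ne (by omega), Function.update_of_ne (by unfold jmp; omega),
          Function.update_of_ne (by unfold capCell; omega), ko a ha]
    · rintro m₃ hb₃ - ⟨k40, k41, k49, k48, ko⟩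
      refine ⟨hb₃.update _ (by omega), by simp [k40],
        by simp [k41], by simp [k49],
        by simp [k48], fun a ha => ?_⟩
      rw [Function.update_of_ne (by unfold jmp; omega), ko a ha]

/-- Copy the part of the matrix that begins in cell `R`. -/
def copyHigh (R : ℕ) : Block :=
  (ins (.const 5 R)).seq <| (ins (.const 6 (32 * (R - 2)))).seq <| (ins (.add 6 6 baseCell)).seq <|
  (ins (.const 7 1)).seq <| (ins (.const 8 32)).seq <| (ins (.const 9 R)).seq <|
  (ins (.sub 4 baseCell 9)).seq <| rep 4 <| (ins (.load 9 5)).seq <| (ins (.store 6 9)).seq <|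
  (ins (.add 5 5 7)).seq <| ins (.add 6 6 8)

/-- All sources lie below `B` and all targets from `B` on, so every cell is read in its original
state. Copying `N = n * n` cells goes beyond the end of the matrix and transfers zeros there. -/
theorem wp_copyHigh {W N R B : ℕ} {m : Mem} (hb : Bd W m) (hB : B = R + N)
    (hm : m baseCell = B) (hR : 51 ≤ R) (hW : 64 * B + 64 ≤ W) :
    (copyHigh R).wp W m (8 * N + 10) fun m' => Bd W m' ∧
      (∀ i < N, m' (B + 32 * (R - 2 + i)) = m (R + i)) ∧
      (∀ a, 12 < a → a ≠ jmp → (∀ i < N, a ≠ B + 32 * (R - 2 + i)) → m' a = m a) ∧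
      m' 2 = m 2 := by
  refine wp_seq_le 1 (8 * N + 9) (wp_const hb (by omega) fun hb₁ => ?_) (by omega)
  refine wp_seq_le 1 (8 * N + 8) (wp_const hb₁ (by omega) fun hb₂ => ?_) (by omega)
  refine wp_seq_le 1 (8 * N + 7) (wp_add hb₂ ?_ fun hb₃ => ?_) (by omega)
  · simp [hm]; omega
  refine wp_seq_le 1 (8 * N + 6) (wp_const hb₃ (by omega) fun hb₄ => ?_) (by omega)
  refine wp_seq_le 1 (8 * N + 5) (wp_const hb₄ (by omega) fun hb₅ => ?_) (by omega)
  refine wp_seq_le 1 (8 * N + 4) (wp_const hb₅ (by omega) fun hb₆ => ?_) (by omega)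
  refine wp_seq_le 1 (8 * N + 3) (wp_sub hb₆ fun hb₇ => ?_) (by omega)
  generalize hm₁ : Function.update (β := fun _ : ℕ => ℕ) _ _ _ = m₁ at hb₇ ⊢
  have f4 : m₁ 4 = N := by rw [← hm₁]; simp [hm]; omega
  have f5 : m₁ 5 = R := by rw [← hm₁]; simp
  have f6 : m₁ 6 = B + 32 * (R - 2) := by rw [← hm₁]; simp [hm]; omega
  have f7 : m₁ 7 = 1 := by rw [← hm₁]; simp
  have f8 : m₁ 8 = 32 := by rw [← hm₁]; simp
  have fo : ∀ a, a = 2 ∨ 12 < a → m₁ a = m a := fun a ha => by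
    rw [← hm₁, Function.update_of_ne (by omega), Function.update_of_ne (by omega),
      Function.update_of_ne (by omega), Function.update_of_ne (by omega),
      Function.update_of_ne (by omega), Function.update_of_ne (by omega),
      Function.update_of_ne (by omega)]
  clear hm₁ hb₁ hb₂ hb₃ hb₄ hb₅ hb₆
  refine (wp_rep (N := N) (τ := 4)
    (fun l m' => m' 5 = R + l ∧ m' 6 = B + 32 * (R - 2 + l) ∧ m' 7 = 1 ∧ m' 8 = 32 ∧
      (∀ i < l, m' (B + 32 * (R - 2 + i)) = m (R + i)) ∧
      (∀ a, 12 < a → a ≠ jmp → (∀ i < l, a ≠ B + 32 * (R - 2 + i)) → m' a = m a) ∧ m' 2 = m 2)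
    (by decide) (by omega) hb₇ f4 ⟨f5, f6, f7, f8, by simp, fun a ha _ _ => fo a (Or.inr ha),
      fo 2 (Or.inl rfl)⟩ ?_ ?_).mono (by omega) fun _ => id
  · rintro l hl m₂ hb₂ hc₂ ⟨g5, g6, g7, g8, gi, go, g2⟩
    refine wp_seq_le 1 3 (wp_load hb₂ fun hb₃ => ?_) (by omega)
    rw [g5, go (R + l) (by omega) (by unfold jmp; omega) (fun i hi => by omega)] at hb₃ ⊢
    refine wp_seq_le 1 2 (wp_store hb₃ fun hb₄ => ?_) (by omega)
    rw [Function.update_self, Function.update_of_ne (by decide), g6] at hb₄ ⊢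
    have f : ∀ c < 51, c ≠ 9 → Function.update (Function.update m₂ 9 (m (R + l)))
        (B + 32 * (R - 2 + l)) (m (R + l)) c = m₂ c := fun c hc hc' => by
      rw [Function.update_of_ne (by omega), Function.update_of_ne hc']
    refine wp_seq_le 1 1 (wp_add hb₄ ?_ fun hb₅ => ?_) le_rfl
    · rw [f 5 (by omega) (by omega), f 7 (by omega) (by omega), g5, g7]; omega
    rw [f 5 (by omega) (by omega), f 7 (by omega) (by omega), g5, g7] at hb₅ ⊢
    refine wp_add hb₅ ?_ fun hb₆ => ?_
    · rw [Function.update_of_ne (show 6 ≠ 5 by decide), Function.update_of_ne (show 8 ≠ 5 by decide),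
        f 6 (by omega) (by omega), f 8 (by omega) (by omega), g6, g8]; omega
    rw [Function.update_of_ne (show 6 ≠ 5 by decide), Function.update_of_ne (show 8 ≠ 5 by decide),
        f 6 (by omega) (by omega), f 8 (by omega) (by omega), g6, g8] at hb₆ ⊢
    generalize hm₃ : Function.update (Function.update (Function.update _ (B + _) _) 5 _) 6 _ = m₃
      at hb₆ ⊢
    have h3 : ∀ a, a ≠ 5 → a ≠ 6 → a ≠ 9 → a ≠ B + 32 * (R - 2 + l) → m₃ a = m₂ a := by
      intro a a5 a6 a9 aB
      rw [← hm₃, Function.update_of_ne a6, Function.update_of_ne a5, Function.update_of_ne aB,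
        Function.update_of_ne a9]
    have h35 : m₃ 5 = R + l + 1 := by rw [← hm₃]; simp
    have h36 : m₃ 6 = B + 32 * (R - 2 + l) + 32 := by rw [← hm₃]; simp
    have h3B : m₃ (B + 32 * (R - 2 + l)) = m (R + l) := by
      rw [← hm₃, Function.update_of_ne (by omega), Function.update_of_ne (by omega),
        Function.update_self]
    clear hm₃
    refine ⟨hb₆, by rw [h3 _ (by decide) (by decide) (by decide) (by omega), hc₂], ?_, ?_, ?_, ?_,
      fun i hi => ?_, fun a ha haj hai => ?_, ?_⟩
    · rw [Function.update_of_ne (by decide), Function.update_of_ne (by decide), h35]; omega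
    · rw [Function.update_of_ne (by decide), Function.update_of_ne (by decide), h36]; omega
    · rw [Function.update_of_ne (by decide), Function.update_of_ne (by decide),
        h3 _ (by decide) (by decide) (by decide) (by omega), g7]
    · rw [Function.update_of_ne (by decide), Function.update_of_ne (by decide),
        h3 _ (by decide) (by decide) (by decide) (by omega), g8]
    · rw [Function.update_of_ne (by omega), Function.update_of_ne (by unfold jmp; omega)]
      rcases Nat.lt_succ_iff_lt_or_eq.1 hi with hi | rfl
      · rw [h3 _ (by omega) (by omega) (by omega) (by omega), gi i hi]
      · exact h3B
    · rw [Function.update_of_ne (by omega), Function.update_of_ne haj,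
        h3 _ (by omega) (by omega) (by omega) (hai l (by omega)),
        go a ha haj fun i hi => hai i (by omega)]
    · rw [Function.update_of_ne (by decide), Function.update_of_ne (by decide),
        h3 _ (by decide) (by decide) (by decide) (by omega), g2]
  · rintro m₂ hb₂ - ⟨-, -, -, -, gi, go, g2⟩
    refine ⟨hb₂.update _ (by omega), fun i hi => ?_, fun a ha haj hai => ?_, ?_⟩
    · rw [Function.update_of_ne (by unfold jmp; omega), gi i hi]
    · rw [Function.update_of_ne haj, go a ha haj hai]
    · rw [Function.update_of_ne (by decide), g2]

/-- Bring the input into the form that compiled programs expect; the arrays begin behind the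
first `R` cells. -/
def setup (R : ℕ) : Block :=
  (encode (R - 3)).seq <| (setupCells R).seq <| (copyHigh R).seq <| (decode (R - 3)).seq <|
  (zeros 40).seq <| (ins (.const 42 0)).seq <| (ins (.const 43 0)).seq <| ins (.const 44 0)

/-- The parameters after the set-up. -/
def setupEnv (R n k : ℕ) : Env where
  β := fun i => match i with
    | .n => n
    | .k => min k (2 * n + 1)
    | _ => 0
  V := 2 ^ (8 * (R + n * n))

/-- The state after the set-up. -/
def setupSt (X : Mem) : St where
  r := fun _ => 0
  a := fun b i => match b with
    | .adj => X (i + 2)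
    | _ => 0

theorem wp_setup {W n k R B : ℕ} {X : Mem} (h0 : X 0 = n) (h1 : X 1 = k) (h2 : X 2 = 0)
    (hX : ∀ a, 2 ≤ a → X a ≤ 1) (hX' : ∀ a, n * n + 2 ≤ a → X a = 0) (hR : 51 ≤ R)
    (hB : B = R + n * n) (hW : 2 ^ (8 * B) + 64 * B + 64 + k ≤ W) :
    (setup R).wp W X (100 * B + 100) fun m => Bd W m ∧
      Rep (setupEnv R n k) B (setupSt X) m := by
  have hRB : 51 ≤ B := by omega
  have hRpow : 2 ^ (R - 3) ≤ W := by
    have : 2 ^ (R - 3) ≤ 2 ^ (8 * B) := Nat.pow_le_pow_right (by norm_num) (by omega)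
    omega
  have hn : n ≤ B := by nlinarith
  have hb : Bd W X := by
    intro a
    rcases Nat.lt_or_ge a 2 with ha | ha
    · have := Nat.zero_le (2 ^ (8 * B))
      generalize 2 ^ (8 * B) = q at *
      interval_cases a
      · rw [h0]; omega
      · rw [h1]; omega
    · have := hX a ha
      have := Nat.zero_le (2 ^ (8 * B))
      omega
  -- The cell 2 can serve as the accumulator because it is zero: for a graph it is a diagonal entry,
  -- or lies beyond an empty matrix.
  refine wp_seq_le (2 * (R - 3)) (98 * B + 100) ((wp_encode (R - 3) X hb
    (fun i _ => hX _ (by omega)) (by rw [h2]; simpa using hRpow)).mono le_rfl ?_) (by omega)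
  rintro m₁ ⟨hb₁, ho₁, h2₁⟩
  rw [h2, zero_mul, zero_add] at h2₁
  refine wp_seq_le (5 * (n + 8 * B) + 30) (53 * B + 70) ((wp_setupCells hb₁
    ((ho₁ 0 (by decide)).trans h0) ((ho₁ 1 (by decide)).trans h1) hB hR (by omega)).mono le_rfl ?_)
    (by omega)
  rintro m₂ ⟨hb₂, h40, h41, h49, h48, ho₂⟩
  have ho₂' : ∀ a, 51 ≤ a → m₂ a = X a := fun a ha => by
    rw [ho₂ a (Or.inr ha), ho₁ a (by omega)]
  have h2₂ : m₂ 2 = lowCode X (R - 3) := by rw [ho₂ 2 (Or.inl rfl), h2₁]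
  refine wp_seq_le (8 * (n * n) + 10) (11 * B + 60) ((wp_copyHigh hb₂ hB h49 hR
    (by omega)).mono le_rfl ?_) (by omega)
  rintro m₃ ⟨hb₃, hi₃, ho₃, h2₃⟩
  refine wp_seq_le (11 * (R - 3)) 43 ((wp_decode (X := X) hRB (R - 3) m₃ hb₃
    (fun i _ => hX _ (by omega)) (h2₃.trans h2₂) ?_ hRpow (by omega) fun i hi => ?_).mono
    le_rfl ?_) (by omega)
  · rw [ho₃ _ (by decide) (by decide) (fun i _ => by unfold baseCell; omega), h49]
  · rw [ho₃ _ (by omega) (by unfold jmp; omega) (fun j _ => by omega), ho₂' _ (by omega),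
      hX' _ (by omega)]
  rintro m₄ ⟨hb₄, hi₄, ho₄⟩
  have low : ∀ a, 13 ≤ a → a < 50 → m₄ a = m₂ a := fun a ha ha' => by
    rw [ho₄ a (by omega) (by omega) (by omega) (by omega) (by omega) (by unfold jmp; omega)
      (fun i _ => by omega), ho₃ a (by omega) (by unfold jmp; omega) (fun i _ => by omega)]
  refine wp_seq_le 40 3 ((wp_zeros 40 m₄ hb₄).mono le_rfl ?_) le_rfl
  rintro m₅ ⟨hb₅, h₅⟩
  refine wp_seq_le 1 2 (wp_const hb₅ (Nat.zero_le _) fun hb₆ => ?_) le_rfl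
  refine wp_seq_le 1 1 (wp_const hb₆ (Nat.zero_le _) fun hb₇ => ?_) le_rfl
  refine wp_const hb₇ (Nat.zero_le _) fun hb₈ => ?_
  have hf : ∀ a, 45 ≤ a → Function.update (Function.update (Function.update m₅ 42 0) 43 0) 44 0 a =
      m₄ a := fun a ha => by
    rw [Function.update_of_ne (by omega), Function.update_of_ne (by omega),
      Function.update_of_ne (by omega), h₅, if_neg (by omega)]
  refine ⟨hb₈, ⟨fun x => ?_, fun i => ?_, ?_, ?_, fun a i => ?_⟩⟩
  · have := x.cell_lt
    rw [Function.update_of_ne (by omega), Function.update_of_ne (by omega),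
      Function.update_of_ne (by omega), h₅, if_pos (by omega)]
    rfl
  · cases i
    · simp [Par.cell, Par.ctorIdx, h₅, low, h40, setupEnv]
    · simp [Par.cell, Par.ctorIdx, h₅, low, h41, setupEnv]
    · simp [Par.cell, Par.ctorIdx, setupEnv]
    · simp [Par.cell, Par.ctorIdx, setupEnv]
    · simp [Par.cell, Par.ctorIdx, setupEnv]
  · rw [hf _ (by decide), low _ (by decide) (by decide), h48, hB]; rfl
  · rw [hf _ (by decide), low _ (by decide) (by decide), h49]
  · rw [hf _ (by omega)]
    have ha := a.ctorIdx_lt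
    have hpos : a ≠ .adj → 0 < a.ctorIdx := fun h => by
      rcases Nat.eq_zero_or_pos a.ctorIdx with h0 | h0
      · exact absurd (Arr.ctorIdx_injective (h0.trans (by rfl : (0 : ℕ) = Arr.adj.ctorIdx))) h
      · exact h0
    by_cases hadj : a = .adj
    · subst hadj
      have e : Arr.adj.ctorIdx = 0 := rfl
      rw [e, add_zero]
      change _ = X (i + 2)
      by_cases hiR : i + 2 < R
      -- The entry with index 0 is zero and is never transferred; the indices below `R - 2` come
      -- from `decode`, the others from `copyHigh`.
      · by_cases hi0 : i = 0
        · subst hi0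
          rw [ho₄ _ (by omega) (by omega) (by omega) (by omega) (by omega) (by unfold jmp; omega)
            (fun j _ => by omega), ho₃ _ (by omega) (by unfold jmp; omega) (fun j _ => by omega),
            ho₂' _ (by omega), hX' _ (by omega), h2]
        · obtain ⟨j, rfl⟩ : ∃ j, i = j + 1 := ⟨i - 1, by omega⟩
          rw [hi₄ j (by omega), show 3 + j = j + 1 + 2 by omega]
      · rw [ho₄ _ (by omega) (by omega) (by omega) (by omega) (by omega) (by unfold jmp; omega)
          (fun j _ => by omega)]
        by_cases hin : i + 2 < B
        · obtain ⟨j, rfl⟩ : ∃ j, i = R - 2 + j := ⟨i - (R - 2), by omega⟩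
          rw [hi₃ j (by omega), ho₂' _ (by omega), show R + j = R - 2 + j + 2 by omega]
        · rw [ho₃ _ (by omega) (by unfold jmp; omega) (fun j _ => by omega), ho₂' _ (by omega),
            hX' _ (by omega), hX' _ (by omega)]
    · have := hpos hadj
      rw [ho₄ _ (by omega) (by omega) (by omega) (by omega) (by omega) (by unfold jmp; omega)
        (fun j _ => by omega), ho₃ _ (by omega) (by unfold jmp; omega) (fun j _ => by omega),
        ho₂' _ (by omega), hX' _ (by omega)]
      cases a <;> first | exact absurd rfl hadj | rfl

end RAM

/-! ### Colourings of graphs on natural numbers -/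

/-- `A` is the adjacency relation of a graph on the numbers below `n`. -/
structure IsGraphOn (n : ℕ) (A : ℕ → ℕ → Prop) : Prop where
  symm : ∀ {u v}, A u v → A v u
  irrefl : ∀ {u}, ¬ A u u
  lt : ∀ {u v}, A u v → u < n

theorem IsGraphOn.lt_right {n : ℕ} {A : ℕ → ℕ → Prop} (h : IsGraphOn n A) {u v : ℕ} (hA : A u v) :
    v < n := h.lt (h.symm hA)

theorem IsGraphOn.ne {n : ℕ} {A : ℕ → ℕ → Prop} (h : IsGraphOn n A) {u v : ℕ} (hA : A u v) :
    u ≠ v := by rintro rfl; exact h.irrefl hA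

/-- A colouring of the edges in which every vertex sees at most two colours. -/
structure TwoValid {C : Type*} (A : ℕ → ℕ → Prop) (c : ℕ → ℕ → C) : Prop where
  symm : ∀ {u v}, A u v → c u v = c v u
  two : ∀ u, ∃ p q, ∀ v, A u v → c u v = p ∨ c u v = q

/-- There is a colouring of the edges with exactly the colours below `k` in which every vertex
sees at most two colours. -/
def Colorable (A : ℕ → ℕ → Prop) (k : ℕ) : Prop :=
  ∃ c : ℕ → ℕ → ℕ, TwoValid A c ∧ (∀ u v, A u v → c u v < k) ∧ ∀ a < k, ∃ u v, A u v ∧ c u v = a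

theorem exists_pair_of_encard_le_two {C : Type*} {S : Set C} (c₀ : C) (h : S.encard ≤ 2) :
    ∃ p q, ∀ x ∈ S, x = p ∨ x = q := by
  by_cases h0 : ∃ p, p ∈ S
  · obtain ⟨p, hp⟩ := h0
    by_cases h1 : ∃ q ∈ S, q ≠ p
    · obtain ⟨q, hq, hqp⟩ := h1
      refine ⟨p, q, fun x hx => ?_⟩
      by_contra hne
      push Not at hne
      have hsub : ({x, q, p} : Set C) ⊆ S := by
        rintro y (rfl | rfl | rfl) <;> assumption
      have h3 : ({x, q, p} : Set C).encard = 3 := by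
        rw [Set.encard_insert_of_notMem (by simp [hne.1, hne.2]), Set.encard_pair hqp]
        norm_num
      have := (Set.encard_le_encard hsub).trans h
      rw [h3] at this
      exact absurd this (by decide)
    · push Not at h1
      exact ⟨p, p, fun x hx => Or.inl (h1 x hx)⟩
  · push Not at h0
    exact ⟨c₀, c₀, fun x hx => absurd hx (h0 x)⟩

/-- The adjacency relation of a graph on `Fin n`, on natural numbers. -/
def natAdj {n : ℕ} (G : SimpleGraph (Fin n)) (u v : ℕ) : Prop :=
  ∃ (hu : u < n) (hv : v < n), G.Adj ⟨u, hu⟩ ⟨v, hv⟩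

theorem isGraphOn_natAdj {n : ℕ} (G : SimpleGraph (Fin n)) : IsGraphOn n (natAdj G) where
  symm := fun ⟨hu, hv, h⟩ => ⟨hv, hu, h.symm⟩
  irrefl := fun ⟨_, _, h⟩ => G.irrefl h
  lt := fun ⟨hu, _, _⟩ => hu

theorem natAdj_coe {n : ℕ} (G : SimpleGraph (Fin n)) (u v : Fin n) :
    natAdj G u v ↔ G.Adj u v := ⟨fun ⟨_, _, h⟩ => h, fun h => ⟨u.2, v.2, h⟩⟩

/-- Passes between functions on unordered edges and symmetric functions on ordered pairs. The
program works with numbers, so vertices beyond `n` have to be admitted as isolated ones. -/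
theorem colorable_natAdj {n : ℕ} (G : SimpleGraph (Fin n)) (k : ℕ) :
    Colorable (natAdj G) k ↔ ExactEdgeTwoColorable G k := by
  classical
  constructor
  · rintro ⟨c, hc, hlt, hsurj⟩
    have hex : ∀ e : G.edgeSet, ∃ u v : Fin n, G.Adj u v ∧ (e : Sym2 (Fin n)) = s(u, v) := by
      rintro ⟨e, he⟩
      induction e with
      | _ u v => exact ⟨u, v, he, rfl⟩
    choose U V hAdj hUV using hex
    have key : ∀ (e : G.edgeSet) (u v : Fin n), (e : Sym2 (Fin n)) = s(u, v) →
        c (U e) (V e) = c u v := by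
      intro e u v h
      rw [hUV e, Sym2.eq_iff] at h
      rcases h with ⟨h1, h2⟩ | ⟨h1, h2⟩
      · rw [h1, h2]
      · rw [h1, h2, hc.symm ((natAdj_coe G v u).2 (h1 ▸ h2 ▸ hAdj e))]
    refine ⟨fun e => ⟨c (U e) (V e), hlt _ _ ((natAdj_coe G _ _).2 (hAdj e))⟩, fun a => ?_,
      fun v => ?_⟩
    · obtain ⟨u, v, ⟨hu, hv, h⟩, ha⟩ := hsurj a a.2
      exact ⟨⟨s(⟨u, hu⟩, ⟨v, hv⟩), h⟩, Fin.ext ((key _ _ _ rfl).trans ha)⟩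
    · obtain ⟨p, q, hpq⟩ := hc.two v
      have hsub : Fin.val '' ((fun e : G.edgeSet => (⟨c (U e) (V e),
          hlt _ _ ((natAdj_coe G _ _).2 (hAdj e))⟩ : Fin k)) '' {e | v ∈ (e : Sym2 (Fin n))}) ⊆
          {p, q} := by
        rintro _ ⟨_, ⟨e, he, rfl⟩, rfl⟩
        obtain ⟨w, hw⟩ := Sym2.mem_iff_exists.1 he
        have hvw : G.Adj v w := by
          have := e.2; rw [hw] at this; exact this
        change c (U e) (V e) ∈ _
        rw [key e v w hw]
        exact hpq w ((natAdj_coe G v w).2 hvw)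
      rw [← Fin.val_injective.encard_image]
      refine (Set.encard_le_encard hsub).trans ((Set.encard_insert_le _ _).trans ?_)
      rw [Set.encard_singleton]
      norm_num
  · rintro ⟨c, hsurj, hval⟩
    let c' : ℕ → ℕ → ℕ := fun u v => if h : natAdj G u v then
      c ⟨s(⟨u, h.1⟩, ⟨v, h.2.1⟩), h.2.2⟩ else 0
    have hc' : ∀ {u v} (h : natAdj G u v), c' u v = c ⟨s(⟨u, h.1⟩, ⟨v, h.2.1⟩), h.2.2⟩ :=
      fun h => dif_pos h
    refine ⟨c', ⟨fun {u v} h => ?_, fun u => ?_⟩, fun u v h => ?_, fun a ha => ?_⟩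
    · rw [hc' h, hc' ((isGraphOn_natAdj G).symm h)]
      congr 3
      exact Sym2.eq_swap
    · by_cases hu : u < n
      · have h2 : (Fin.val '' (c '' {e : G.edgeSet | (⟨u, hu⟩ : Fin n) ∈
            (e : Sym2 (Fin n))})).encard ≤ 2 := by
          rw [Fin.val_injective.encard_image]; exact hval ⟨u, hu⟩
        obtain ⟨p, q, hpq⟩ := exists_pair_of_encard_le_two 0 h2
        refine ⟨p, q, fun v h => hpq _ ?_⟩
        rw [hc' h]
        exact ⟨_, ⟨_, Sym2.mem_mk_left _ _, rfl⟩, rfl⟩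
      · exact ⟨0, 0, fun v h => absurd h.1 hu⟩
    · rw [hc' h]; exact Fin.is_lt _
    · obtain ⟨⟨e, he⟩, hce⟩ := hsurj ⟨a, ha⟩
      induction e with
      | _ u v =>
        refine ⟨u, v, (natAdj_coe G u v).2 he, ?_⟩
        rw [hc' ((natAdj_coe G u v).2 he)]
        exact congrArg Fin.val hce

theorem colorable_zero {A : ℕ → ℕ → Prop} : Colorable A 0 ↔ ∀ u v, ¬ A u v :=
  ⟨fun ⟨_, _, h, _⟩ u v hA => absurd (h u v hA) (Nat.not_lt_zero _), fun h =>
    ⟨fun _ _ => 0, ⟨fun _ => rfl, fun _ => ⟨0, 0, fun _ _ => Or.inl rfl⟩⟩,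
      fun u v hA => absurd hA (h u v), fun _ ha => absurd ha (Nat.not_lt_zero _)⟩⟩

/-- A colouring that uses at least `k` colours yields one that uses exactly `k`. -/
theorem colorable_of_card_le {C : Type*} {A : ℕ → ℕ → Prop} {c : ℕ → ℕ → C} (hc : TwoValid A c)
    {k : ℕ} (hk : 0 < k) {S : Finset C} (hS : k ≤ S.card) (hA : ∀ a ∈ S, ∃ u v, A u v ∧ c u v = a) :
    Colorable A k := by
  classical
  obtain ⟨T, hTS, hT⟩ := Finset.exists_subset_card_eq hS
  let e := T.equivFinOfCardEq hT
  -- All colours outside `T` are merged into the colour 0, which is one of the chosen ones since `0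
  -- < k`. Merging cannot increase the number of colours at a vertex.
  let f : C → ℕ := fun x => if h : x ∈ T then e ⟨x, h⟩ else 0
  have hf : ∀ x, f x < k := fun x => by
    by_cases h : x ∈ T
    · simp [f, h]
    · simpa [f, h] using hk
  refine ⟨fun u v => f (c u v), ⟨fun h => by rw [hc.symm h], fun u => ?_⟩, fun u v _ => hf _,
    fun a ha => ?_⟩
  · obtain ⟨p, q, h⟩ := hc.two u
    refine ⟨f p, f q, fun v hv => ?_⟩
    rcases h v hv with h | h <;> simp [h]
  · obtain ⟨u, v, huv, h⟩ := hA (e.symm ⟨a, ha⟩) (hTS (e.symm ⟨a, ha⟩).2)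
    refine ⟨u, v, huv, ?_⟩
    simp [h, f]

/-- At most two colours per vertex occur. -/
theorem Colorable.le {n k : ℕ} {A : ℕ → ℕ → Prop} (hA : IsGraphOn n A) (h : Colorable A k) :
    k ≤ 2 * n := by
  classical
  obtain ⟨c, hc, -, hsurj⟩ := h
  choose p q hpq using hc.two
  have hsub : Finset.range k ⊆ (Finset.range n).image p ∪ (Finset.range n).image q := by
    intro a ha
    obtain ⟨u, v, huv, rfl⟩ := hsurj a (Finset.mem_range.1 ha)
    have hu := Finset.mem_range.2 (hA.lt huv)
    rcases hpq u v huv with h | h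
    · exact Finset.mem_union_left _ (h ▸ Finset.mem_image_of_mem p hu)
    · exact Finset.mem_union_right _ (h ▸ Finset.mem_image_of_mem q hu)
  have h1 := Finset.card_le_card hsub
  have h2 := Finset.card_union_le ((Finset.range n).image p) ((Finset.range n).image q)
  have h3 := Finset.card_image_le (s := Finset.range n) (f := p)
  have h4 := Finset.card_image_le (s := Finset.range n) (f := q)
  simp only [Finset.card_range] at h1 h3 h4
  omega

/-! ### Depth-first search -/

/-- The state of a depth-first search after `i` visits: `ord` lists the visited vertices, the
vertices `u` with `int u > 0` have a child, and `dep` is the parity of the depth. -/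
structure SearchState (n : ℕ) (A : ℕ → ℕ → Prop) (i : ℕ) (vis ord int par dep root : ℕ → ℕ) :
    Prop where
  vis_iff : ∀ w, 0 < vis w ↔ ∃ p < i, ord p = w
  inj : ∀ p < i, ∀ q < i, ord p = ord q → p = q
  lt : ∀ p < i, ord p < n
  fresh : ∀ w, (∀ p < i, ord p ≠ w) → root w = 0
  step : ∀ p < i,
    0 < root (ord p) ∧ dep (ord p) = 0 ∧ (∀ q < p, ∀ y, A (ord q) y → ∃ q' < p, ord q' = y) ∨
    root (ord p) = 0 ∧ ∃ q < p, par (ord p) = ord q ∧ A (ord q) (ord p) ∧ 0 < int (ord q) ∧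
      dep (ord p) = 1 - dep (ord q)
  child : ∀ u, 0 < int u → ∃ p < i, root (ord p) = 0 ∧ par (ord p) = u
  closed : ∀ p, p + 1 < i → ∀ y, A (ord p) y → (∃ q ≤ p, ord q = y) ∨ 0 < int (ord p)

theorem SearchState.start {n : ℕ} {A : ℕ → ℕ → Prop} {ord par dep : ℕ → ℕ} :
    SearchState n A 0 (fun _ => 0) ord (fun _ => 0) par dep (fun _ => 0) where
  vis_iff := by simp
  inj := by simp
  lt := by simp
  fresh := by simp
  step := by simp
  child := by simp
  closed := by simp

/-- The parent is the latest visited vertex that still has an unvisited neighbour (`hmax`); this is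
the depth-first rule without a stack, and it preserves `closed`. -/
theorem SearchState.visit_child {n i : ℕ} {A : ℕ → ℕ → Prop} {vis ord int par dep root : ℕ → ℕ}
    (h : SearchState n A i vis ord int par dep root) {p w : ℕ} (hp : p < i) (hw : w < n)
    (hA : A (ord p) w) (hvis : vis w = 0)
    (hmax : ∀ q, p < q → q < i → ∀ y, A (ord q) y → 0 < vis y) :
    SearchState n A (i + 1) (Function.update vis w 1) (Function.update ord i w)
      (Function.update int (ord p) 1) (Function.update par w (ord p))
      (Function.update dep w (1 - dep (ord p))) root := by
  have hnew : ∀ q < i, ord q ≠ w := fun q hq e => by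
    have := (h.vis_iff w).2 ⟨q, hq, e⟩; omega
  have hi : Function.update ord i w i = w := Function.update_self ..
  have ho : ∀ q < i, Function.update ord i w q = ord q := fun q hq =>
    Function.update_of_ne (by omega) ..
  have hmono : ∀ x, 0 < int x → 0 < Function.update int (ord p) 1 x := fun x hx => by
    rw [Function.update_apply]; split_ifs <;> omega
  refine ⟨fun x => ?_, fun q hq q' hq' e => ?_, fun q hq => ?_, fun x hx => ?_, fun q hq => ?_,
    fun x hx => ?_, fun q hq y hy => ?_⟩
  · rw [Function.update_apply]
    split_ifs with hx
    · exact ⟨fun _ => ⟨i, by omega, by rw [hi, hx]⟩, fun _ => by omega⟩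
    · rw [h.vis_iff]
      constructor
      · rintro ⟨q, hq, rfl⟩; exact ⟨q, by omega, ho q hq⟩
      · rintro ⟨q, hq, rfl⟩
        have : q < i := by
          by_contra hc
          obtain rfl : q = i := by omega
          exact hx hi
        exact ⟨q, this, (ho q this).symm⟩
  · rcases Nat.lt_succ_iff_lt_or_eq.1 hq with hq | rfl <;>
      rcases Nat.lt_succ_iff_lt_or_eq.1 hq' with hq' | rfl
    · rw [ho q hq, ho q' hq'] at e; exact h.inj q hq q' hq' e
    · rw [ho q hq, hi] at e; exact absurd e (hnew q hq)
    · rw [ho q' hq', hi] at e; exact absurd e.symm (hnew q' hq')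
    · rfl
  · rcases Nat.lt_succ_iff_lt_or_eq.1 hq with hq | rfl
    · rw [ho q hq]; exact h.lt q hq
    · rwa [hi]
  · exact h.fresh x fun q hq => by rw [← ho q hq]; exact hx q (by omega)
  · rcases Nat.lt_succ_iff_lt_or_eq.1 hq with hq | rfl
    · rw [ho q hq]
      rcases h.step q hq with ⟨h1, h2, h3⟩ | ⟨h1, q', hq', h2, h3, h4, h5⟩
      · refine Or.inl ⟨h1, by rw [Function.update_of_ne (hnew q hq), h2], fun q' hq' y hy => ?_⟩
        rw [ho q' (by omega)] at hy
        obtain ⟨t, ht, e⟩ := h3 q' hq' y hy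
        exact ⟨t, ht, by rw [ho t (by omega), e]⟩
      · refine Or.inr ⟨h1, q', hq', ?_⟩
        rw [ho q' (by omega), Function.update_of_ne (hnew q hq), Function.update_of_ne (hnew q hq),
          Function.update_of_ne (hnew q' (by omega))]
        exact ⟨h2, h3, hmono _ h4, h5⟩
    · rw [hi]
      refine Or.inr ⟨h.fresh w hnew, p, hp, ?_⟩
      rw [ho p hp, Function.update_self, Function.update_self, Function.update_self,
        Function.update_of_ne (hnew p hp)]
      exact ⟨rfl, hA, by omega, rfl⟩
  · rw [Function.update_apply] at hx
    split_ifs at hx with hxp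
    · exact ⟨i, by omega, by rw [hi]; exact h.fresh w hnew, by rw [hi, Function.update_self, hxp]⟩
    · obtain ⟨q, hq, h1, h2⟩ := h.child x hx
      exact ⟨q, by omega, by rw [ho q hq, h1],
        by rw [ho q hq, Function.update_of_ne (hnew q hq), h2]⟩
  · have hqi : q < i := by omega
    rw [ho q hqi] at hy ⊢
    rcases Nat.lt_or_ge (q + 1) i with hq1 | hq1
    · rcases h.closed q hq1 y hy with ⟨t, ht, e⟩ | h'
      · exact Or.inl ⟨t, ht, by rw [ho t (by omega), e]⟩
      · exact Or.inr (hmono _ h')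
    -- Only the vertex visited last is new to `closed`. Either it is the parent of `w` and becomes
    -- interior, or by the choice of `p` all its neighbours have been visited.
    · by_cases hqp : q = p
      · exact Or.inr (by rw [hqp, Function.update_self]; omega)
      · obtain ⟨t, ht, e⟩ := (h.vis_iff y).1 (hmax q (by omega) hqi y hy)
        exact Or.inl ⟨t, by omega, by rw [ho t (by omega), e]⟩

/-- A new root is taken only when the visited set is closed under adjacency. The first alternative
of `step` records this, and it later places different roots in different components. -/
theorem SearchState.visit_root {n i : ℕ} {A : ℕ → ℕ → Prop} {vis ord int par dep root : ℕ → ℕ}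
    (h : SearchState n A i vis ord int par dep root) {w : ℕ} (hw : w < n) (hvis : vis w = 0)
    (hmax : ∀ q < i, ∀ y, A (ord q) y → 0 < vis y) :
    SearchState n A (i + 1) (Function.update vis w 1) (Function.update ord i w) int par
      (Function.update dep w 0) (Function.update root w 1) := by
  have hnew : ∀ q < i, ord q ≠ w := fun q hq e => by
    have := (h.vis_iff w).2 ⟨q, hq, e⟩; omega
  have hi : Function.update ord i w i = w := Function.update_self ..
  have ho : ∀ q < i, Function.update ord i w q = ord q := fun q hq =>
    Function.update_of_ne (by omega) ..
  refine ⟨fun x => ?_, fun q hq q' hq' e => ?_, fun q hq => ?_, fun x hx => ?_, fun q hq => ?_,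
    fun x hx => ?_, fun q hq y hy => ?_⟩
  · rw [Function.update_apply]
    split_ifs with hx
    · exact ⟨fun _ => ⟨i, by omega, by rw [hi, hx]⟩, fun _ => by omega⟩
    · rw [h.vis_iff]
      constructor
      · rintro ⟨q, hq, rfl⟩; exact ⟨q, by omega, ho q hq⟩
      · rintro ⟨q, hq, rfl⟩
        have : q < i := by
          by_contra hc
          obtain rfl : q = i := by omega
          exact hx hi
        exact ⟨q, this, (ho q this).symm⟩
  · rcases Nat.lt_succ_iff_lt_or_eq.1 hq with hq | rfl <;>
      rcases Nat.lt_succ_iff_lt_or_eq.1 hq' with hq' | rfl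
    · rw [ho q hq, ho q' hq'] at e; exact h.inj q hq q' hq' e
    · rw [ho q hq, hi] at e; exact absurd e (hnew q hq)
    · rw [ho q' hq', hi] at e; exact absurd e.symm (hnew q' hq')
    · rfl
  · rcases Nat.lt_succ_iff_lt_or_eq.1 hq with hq | rfl
    · rw [ho q hq]; exact h.lt q hq
    · rwa [hi]
  · have hxw : x ≠ w := fun e => hx i (by omega) (by rw [hi, e])
    rw [Function.update_of_ne hxw]
    exact h.fresh x fun q hq => by rw [← ho q hq]; exact hx q (by omega)
  · rcases Nat.lt_succ_iff_lt_or_eq.1 hq with hq | rfl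
    · rw [ho q hq]
      rcases h.step q hq with ⟨h1, h2, h3⟩ | ⟨h1, q', hq', h2, h3, h4, h5⟩
      · refine Or.inl ⟨by rwa [Function.update_of_ne (hnew q hq)],
          by rw [Function.update_of_ne (hnew q hq), h2], fun q' hq' y hy => ?_⟩
        rw [ho q' (by omega)] at hy
        obtain ⟨t, ht, e⟩ := h3 q' hq' y hy
        exact ⟨t, ht, by rw [ho t (by omega), e]⟩
      · refine Or.inr ⟨by rwa [Function.update_of_ne (hnew q hq)], q', hq', ?_⟩
        rw [ho q' (by omega), Function.update_of_ne (hnew q hq),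
          Function.update_of_ne (hnew q' (by omega))]
        exact ⟨h2, h3, h4, h5⟩
    · rw [hi]
      refine Or.inl ⟨by rw [Function.update_self]; omega, Function.update_self .., ?_⟩
      intro q' hq' y hy
      rw [ho q' hq'] at hy
      obtain ⟨t, ht, e⟩ := (h.vis_iff y).1 (hmax q' hq' y hy)
      exact ⟨t, ht, by rw [ho t ht, e]⟩
  · obtain ⟨q, hq, h1, h2⟩ := h.child x hx
    exact ⟨q, by omega, by rw [ho q hq, Function.update_of_ne (hnew q hq), h1],
      by rw [ho q hq, h2]⟩
  · have hqi : q < i := by omega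
    rw [ho q hqi] at hy ⊢
    rcases Nat.lt_or_ge (q + 1) i with hq1 | hq1
    · rcases h.closed q hq1 y hy with ⟨t, ht, e⟩ | h'
      · exact Or.inl ⟨t, ht, by rw [ho t (by omega), e]⟩
      · exact Or.inr h'
    · obtain ⟨t, ht, e⟩ := (h.vis_iff y).1 (hmax q hqi y hy)
      exact Or.inl ⟨t, by omega, by rw [ho t (by omega), e]⟩

theorem SearchState.exists_unvisited {n i : ℕ} {A : ℕ → ℕ → Prop}
    {vis ord int par dep root : ℕ → ℕ} (h : SearchState n A i vis ord int par dep root)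
    (hi : i < n) : ∃ w < n, vis w = 0 := by
  by_contra hc
  push Not at hc
  have hsub : Finset.range n ⊆ (Finset.range i).image ord := fun w hw => by
    obtain ⟨p, hp, e⟩ := (h.vis_iff w).1 (Nat.pos_of_ne_zero (hc w (Finset.mem_range.1 hw)))
    exact Finset.mem_image.2 ⟨p, Finset.mem_range.2 hp, e⟩
  have := (Finset.card_le_card hsub).trans Finset.card_image_le
  simp only [Finset.card_range] at this
  omega

/-- What a completed depth-first search provides. -/
structure SearchForest (n : ℕ) (A : ℕ → ℕ → Prop) (ord int par dep root : ℕ → ℕ) : Prop where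
  inj : ∀ p < n, ∀ q < n, ord p = ord q → p = q
  lt : ∀ p < n, ord p < n
  surj : ∀ u < n, ∃ p < n, ord p = u
  root_dep : ∀ u < n, 0 < root u → dep u = 0
  parent : ∀ p < n, root (ord p) = 0 → ∃ q < p, par (ord p) = ord q ∧ A (ord q) (ord p) ∧
    0 < int (ord q) ∧ dep (ord p) = 1 - dep (ord q)
  child : ∀ u, 0 < int u → ∃ w < n, root w = 0 ∧ par w = u
  cover : ∀ u v, A u v → 0 < int u ∨ 0 < int v
  sep : ∀ u < n, ∀ v < n, 0 < root u → 0 < root v → Relation.ReflTransGen A u v → u = v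

/-- All neighbours of a vertex without children precede it in the order, hence two such vertices are
never adjacent. For the vertex visited last this holds trivially, which supplies the case that
`closed` omits. -/
theorem SearchState.forest {n : ℕ} {A : ℕ → ℕ → Prop} {vis ord int par dep root : ℕ → ℕ}
    (hG : IsGraphOn n A) (h : SearchState n A n vis ord int par dep root) :
    SearchForest n A ord int par dep root := by
  have hsurj : ∀ u < n, ∃ p < n, ord p = u := by
    have himg : (Finset.range n).image ord = Finset.range n := by
      refine Finset.eq_of_subset_of_card_le (fun x hx => ?_) ?_
      · obtain ⟨p, hp, rfl⟩ := Finset.mem_image.1 hx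
        exact Finset.mem_range.2 (h.lt p (Finset.mem_range.1 hp))
      · rw [Finset.card_image_of_injOn fun p hp q hq e => h.inj p (by simpa using hp) q
          (by simpa using hq) e]
    intro u hu
    rw [← Finset.mem_range, ← himg] at hu
    obtain ⟨p, hp, e⟩ := Finset.mem_image.1 hu
    exact ⟨p, Finset.mem_range.1 hp, e⟩
  -- The vertices before a root are closed under adjacency, so none of them reaches it.
  have hsep : ∀ p < n, ∀ q < n, 0 < root (ord p) → q < p →
      ¬ Relation.ReflTransGen A (ord q) (ord p) := by
    intro p hp q hq hr hqp hreach
    rcases h.step p hp with ⟨-, -, hcl⟩ | ⟨h0, -⟩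
    · have : ∀ y, Relation.ReflTransGen A (ord q) y → ∃ q' < p, ord q' = y := by
        intro y hy
        induction hy with
        | refl => exact ⟨q, hqp, rfl⟩
        | tail _ hA ih =>
          obtain ⟨t, ht, e⟩ := ih
          exact hcl t ht _ (e ▸ hA)
      obtain ⟨t, ht, e⟩ := this _ hreach
      have := h.inj t (by omega) p hp e
      omega
    · omega
  have hclosed : ∀ p < n, ∀ y, A (ord p) y → (∃ q < p, ord q = y) ∨ 0 < int (ord p) := by
    intro p hp y hy
    have hne := hG.ne hy
    rcases Nat.lt_or_ge (p + 1) n with hp1 | hp1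
    · rcases h.closed p hp1 y hy with ⟨q, hq, e⟩ | h'
      · refine Or.inl ⟨q, lt_of_le_of_ne hq ?_, e⟩
        rintro rfl
        exact hne e
      · exact Or.inr h'
    · obtain ⟨q, hq, e⟩ := hsurj y (hG.lt_right hy)
      refine Or.inl ⟨q, lt_of_le_of_ne (by omega) ?_, e⟩
      rintro rfl
      exact hne e
  refine ⟨h.inj, h.lt, hsurj, fun u hu hr => ?_, fun p hp hr => ?_, fun u hu => ?_,
    fun u v hA => ?_, fun u hu v hv hru hrv hreach => ?_⟩
  · obtain ⟨p, hp, rfl⟩ := hsurj u hu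
    rcases h.step p hp with ⟨-, h2, -⟩ | ⟨h0, -⟩
    · exact h2
    · omega
  · rcases h.step p hp with ⟨h0, -⟩ | ⟨-, h'⟩
    · omega
    · exact h'
  · obtain ⟨p, hp, h1, h2⟩ := h.child u hu
    exact ⟨ord p, h.lt p hp, h1, h2⟩
  · obtain ⟨p, hp, rfl⟩ := hsurj u (hG.lt hA)
    obtain ⟨q, hq, rfl⟩ := hsurj v (hG.lt_right hA)
    rcases hclosed p hp _ hA with ⟨q', hq', e⟩ | h'
    · rcases hclosed q hq _ (hG.symm hA) with ⟨p', hp', e'⟩ | h'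
      · have := h.inj q' (by omega) q hq e
        have := h.inj p' (by omega) p hp e'
        omega
      · exact Or.inr h'
    · exact Or.inl h'
  · obtain ⟨p, hp, rfl⟩ := hsurj u hu
    obtain ⟨q, hq, rfl⟩ := hsurj v hv
    rcases lt_trichotomy p q with hpq | rfl | hpq
    · exact absurd hreach (hsep q hq p hp hrv hpq)
    · rfl
    · have : Std.Symm A := ⟨fun _ _ => hG.symm⟩
      exact absurd ((Relation.ReflTransGen.stdSymm (r := A)).symm _ _ hreach)
        (hsep p hp q hq hru hpq)

theorem SearchForest.exists_child {n : ℕ} {A : ℕ → ℕ → Prop} {ord int par dep root : ℕ → ℕ}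
    (h : SearchForest n A ord int par dep root) {u : ℕ} (hu : 0 < int u) :
    ∃ w, A u w ∧ root w = 0 ∧ par w = u ∧ dep w = 1 - dep u := by
  obtain ⟨w, hw, hr, hp⟩ := h.child u hu
  obtain ⟨p, hpn, rfl⟩ := h.surj w hw
  obtain ⟨q, -, h1, h2, -, h3⟩ := h.parent p hpn hr
  obtain rfl : ord q = u := h1.symm.trans hp
  exact ⟨ord p, h2, hr, hp, h3⟩

/-! ### Colourings from a matching of parents with children -/

open Classical in
/-- Colour the edges between the vertices `u` in `D` and `ch u` by `u`, and the others by their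
connected component. -/
noncomputable def matchingColor (A : ℕ → ℕ → Prop) (D : ℕ → Prop) (ch : ℕ → ℕ) (u v : ℕ) :
    ℕ ⊕ Set ℕ :=
  if D u ∧ ch u = v then .inl u else if D v ∧ ch v = u then .inl v
  else .inr {x | Relation.ReflTransGen A u x}

/-- By `hpar` the map `ch` is injective on `D`, and by `hD` it leaves `D`; so the special edges form
a matching. A vertex sees at most one of them, and all its other edges have the colour of its
component. -/
theorem twoValid_matchingColor {n : ℕ} {A : ℕ → ℕ → Prop} (hG : IsGraphOn n A) {D : ℕ → Prop}
    {ch par : ℕ → ℕ} (hpar : ∀ u, D u → par (ch u) = u) (hD : ∀ u, D u → ¬ D (ch u)) :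
    TwoValid A (matchingColor A D ch) where
  symm := by
    intro u v huv
    unfold matchingColor
    by_cases h1 : D u ∧ ch u = v
    · rw [if_pos h1, if_neg, if_pos h1]
      exact fun h2 => hD u h1.1 (h1.2 ▸ h2.1)
    · by_cases h2 : D v ∧ ch v = u
      · rw [if_neg h1, if_pos h2, if_pos h2]
      · rw [if_neg h1, if_neg h2, if_neg h2, if_neg h1]
        congr 1
        ext x
        exact ⟨fun h => h.head (hG.symm huv), fun h => h.head huv⟩
  two := by
    intro u
    by_cases hu : D u
    · refine ⟨.inl u, .inr {x | Relation.ReflTransGen A u x}, fun v _ => ?_⟩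
      unfold matchingColor
      by_cases h1 : D u ∧ ch u = v
      · exact Or.inl (if_pos h1)
      · rw [if_neg h1, if_neg]
        · exact Or.inr rfl
        · exact fun h2 => hD v h2.1 (h2.2 ▸ hu)
    · refine ⟨.inl (par u), .inr {x | Relation.ReflTransGen A u x}, fun v _ => ?_⟩
      unfold matchingColor
      rw [if_neg fun h => hu h.1]
      by_cases h2 : D v ∧ ch v = u
      · rw [if_pos h2, ← h2.2, hpar v h2.1]; exact Or.inl rfl
      · rw [if_neg h2]; exact Or.inr rfl

/-- A child has the opposite parity, so the even interior vertices can be matched with children of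
theirs; the matching colours alone are enough here. -/
theorem SearchForest.colorable_of_le_even {n k : ℕ} {A : ℕ → ℕ → Prop}
    {ord int par dep root : ℕ → ℕ} (hG : IsGraphOn n A)
    (h : SearchForest n A ord int par dep root) (hk : 0 < k)
    (hle : k ≤ ((Finset.range n).filter fun u => 0 < int u ∧ dep u = 0).card) :
    Colorable A k := by
  have hch : ∀ u, ∃ w, 0 < int u → A u w ∧ root w = 0 ∧ par w = u ∧ dep w = 1 - dep u := fun u => by
    by_cases hu : 0 < int u
    · obtain ⟨w, hw⟩ := h.exists_child hu; exact ⟨w, fun _ => hw⟩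
    · exact ⟨0, fun h => absurd h hu⟩
  choose ch hch using hch
  have hval := twoValid_matchingColor hG (D := fun u => 0 < int u ∧ dep u = 0) (ch := ch)
    (par := par) (fun u hu => (hch u hu.1).2.2.1) (fun u hu hu' => by
      have h1 := (hch u hu.1).2.2.2
      have h2 := hu.2
      have h3 := hu'.2
      omega)
  refine colorable_of_card_le hval hk (S := ((Finset.range n).filter fun u =>
    0 < int u ∧ dep u = 0).map ⟨Sum.inl, Sum.inl_injective⟩) (by rwa [Finset.card_map]) ?_
  intro a ha
  obtain ⟨u, hu, rfl⟩ := Finset.mem_map.1 ha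
  have hu' := (Finset.mem_filter.1 hu).2
  exact ⟨u, ch u, (hch u hu'.1).1, if_pos ⟨hu', rfl⟩⟩

/-- Here the component colours count as well. A root has even depth and is nobody's child, so the
edge to a child of an interior root is not in the matching and shows the colour of the component. -/
theorem SearchForest.colorable_of_le_odd {n k : ℕ} {A : ℕ → ℕ → Prop}
    {ord int par dep root : ℕ → ℕ} (hG : IsGraphOn n A)
    (h : SearchForest n A ord int par dep root) (hk : 0 < k)
    (hle : k ≤ ((Finset.range n).filter fun u => 0 < int u ∧ 0 < dep u).card +
      ((Finset.range n).filter fun u => 0 < int u ∧ 0 < root u).card) :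
    Colorable A k := by
  classical
  have hch : ∀ u, ∃ w, 0 < int u → A u w ∧ root w = 0 ∧ par w = u ∧ dep w = 1 - dep u := fun u => by
    by_cases hu : 0 < int u
    · obtain ⟨w, hw⟩ := h.exists_child hu; exact ⟨w, fun _ => hw⟩
    · exact ⟨0, fun h => absurd h hu⟩
  choose ch hch using hch
  have hval := twoValid_matchingColor hG (D := fun u => 0 < int u ∧ 0 < dep u) (ch := ch)
    (par := par) (fun u hu => (hch u hu.1).2.2.1) (fun u hu hu' => by
      have h1 := (hch u hu.1).2.2.2
      have h2 := hu.2
      have h3 := hu'.2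
      omega)
  let O := (Finset.range n).filter fun u => 0 < int u ∧ 0 < dep u
  let R := (Finset.range n).filter fun u => 0 < int u ∧ 0 < root u
  let f : ℕ → Set ℕ := fun u => {x | Relation.ReflTransGen A u x}
  -- Different roots lie in different components, so their component colours are distinct.
  have hR : (R.image f).card = R.card := by
    refine Finset.card_image_of_injOn fun u hu v hv e => ?_
    simp only [R, Finset.coe_filter, Finset.mem_range, Set.mem_ofPred_eq] at hu hv
    refine h.sep u hu.1 v hv.1 hu.2.2 hv.2.2 ?_
    have : v ∈ f v := Relation.ReflTransGen.refl
    rw [← e] at this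
    exact this
  refine colorable_of_card_le hval hk (S := O.disjSum (R.image f))
    (by rwa [Finset.card_disjSum, hR]) ?_
  intro a ha
  rcases Finset.mem_disjSum.1 ha with ⟨u, hu, rfl⟩ | ⟨s, hs, rfl⟩
  · have hu' := (Finset.mem_filter.1 hu).2
    exact ⟨u, ch u, (hch u hu'.1).1, if_pos ⟨hu', rfl⟩⟩
  · obtain ⟨u, hu, rfl⟩ := Finset.mem_image.1 hs
    obtain ⟨hun, hu1, hu2⟩ := Finset.mem_filter.1 hu
    have hd := h.root_dep u (Finset.mem_range.1 hun) hu2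
    refine ⟨u, ch u, (hch u hu1).1, ?_⟩
    unfold matchingColor
    rw [if_neg, if_neg]
    · rintro ⟨h1, h2⟩
      have := (hch _ h1.1).2.1
      rw [h2] at this
      omega
    · rintro ⟨h1, -⟩
      omega

/-! ### Choosing the colours of the edges for given palettes -/

/-- The colour `a` is in the palette of `x`. -/
def InPalette (pa pb : ℕ → ℕ) (x a : ℕ) : Prop := a = pa x ∨ a = pb x

/-- The pairs that stand for choices to be made: edges between interior vertices, and vertices
`u = v` that are not isolated and not interior. -/
def Active (A : ℕ → ℕ → Prop) (int : ℕ → ℕ) (u v : ℕ) : Prop :=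
  u < v ∧ 0 < int u ∧ 0 < int v ∧ A u v ∨ u = v ∧ int u = 0 ∧ ∃ x, A u x

/-- The colours `a` and `b` may be used for an edge, or at a vertex that is not interior. -/
def Admissible (A : ℕ → ℕ → Prop) (pa pb : ℕ → ℕ) (k u v a b : ℕ) : Prop :=
  a < k ∧ b < k ∧ (u < v ∧ a = b ∧ InPalette pa pb u a ∧ InPalette pa pb v a ∨
    u = v ∧ (∀ x, A u x → InPalette pa pb x a ∨ InPalette pa pb x b) ∧
      ∃ x y, A u x ∧ A u y ∧ InPalette pa pb x a ∧ InPalette pa pb y b ∧ (x = y → a = b))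

/-- There are admissible choices for the active pairs in `D` that use all the colours in `s`. -/
def Covers (A : ℕ → ℕ → Prop) (int pa pb : ℕ → ℕ) (k : ℕ) (D : ℕ → ℕ → Prop) (s : Finset ℕ) :
    Prop :=
  ∃ f g : ℕ → ℕ → ℕ, (∀ u v, D u v → Active A int u v →
    Admissible A pa pb k u v (f u v) (g u v)) ∧
    ∀ a ∈ s, ∃ u v, D u v ∧ Active A int u v ∧ (a = f u v ∨ a = g u v)

theorem covers_false {A : ℕ → ℕ → Prop} {int pa pb : ℕ → ℕ} {k : ℕ} {D : ℕ → ℕ → Prop}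
    (hD : ∀ u v, ¬ D u v) (s : Finset ℕ) : Covers A int pa pb k D s ↔ s = ∅ := by
  constructor
  · rintro ⟨f, g, -, h⟩
    refine Finset.eq_empty_of_forall_notMem fun a ha => ?_
    obtain ⟨u, v, h, -⟩ := h a ha
    exact hD u v h
  · rintro rfl
    exact ⟨fun _ _ => 0, fun _ _ => 0, fun u v h => absurd h (hD u v), by simp⟩

theorem covers_congr {A : ℕ → ℕ → Prop} {int pa pb : ℕ → ℕ} {k : ℕ} {D D' : ℕ → ℕ → Prop}
    {s : Finset ℕ} (h : ∀ u v, Active A int u v → (D u v ↔ D' u v)) :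
    Covers A int pa pb k D s ↔ Covers A int pa pb k D' s := by
  unfold Covers
  refine exists_congr fun f => exists_congr fun g => and_congr ?_ ?_
  · exact forall₂_congr fun u v =>
      ⟨fun H hD ha => H ((h u v ha).2 hD) ha, fun H hD ha => H ((h u v ha).1 hD) ha⟩
  · refine forall₂_congr fun a _ => exists_congr fun u => exists_congr fun v =>
      ⟨fun ⟨h1, h2, h3⟩ => ⟨(h u v h2).1 h1, h2, h3⟩, fun ⟨h1, h2, h3⟩ => ⟨(h u v h2).2 h1, h2, h3⟩⟩

/-- The recurrence of the dynamic program. The choice at the new pair takes care of the colours `a`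
and `b`; the pairs before it must cover the rest. -/
theorem covers_step {A : ℕ → ℕ → Prop} {int pa pb : ℕ → ℕ} {k u₀ v₀ : ℕ} {D D' : ℕ → ℕ → Prop}
    {s : Finset ℕ} (hD : ¬ D u₀ v₀) (hD' : ∀ u v, D' u v ↔ D u v ∨ u = u₀ ∧ v = v₀)
    (hact : Active A int u₀ v₀) :
    Covers A int pa pb k D' s ↔
      ∃ a b, Admissible A pa pb k u₀ v₀ a b ∧ Covers A int pa pb k D ((s.erase a).erase b) := by
  constructor
  · rintro ⟨f, g, h1, h2⟩
    refine ⟨f u₀ v₀, g u₀ v₀, h1 _ _ ((hD' _ _).2 (Or.inr ⟨rfl, rfl⟩)) hact, f, g,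
      fun u v h => h1 u v ((hD' _ _).2 (Or.inl h)), fun a ha => ?_⟩
    simp only [Finset.mem_erase] at ha
    obtain ⟨u, v, h3, h4, h5⟩ := h2 a ha.2.2
    rcases (hD' _ _).1 h3 with h3 | ⟨rfl, rfl⟩
    · exact ⟨u, v, h3, h4, h5⟩
    · rcases h5 with h5 | h5
      exacts [absurd h5 ha.2.1, absurd h5 ha.1]
  · rintro ⟨a, b, hab, f, g, h1, h2⟩
    have hne : ∀ u v, D u v → ¬ (u = u₀ ∧ v = v₀) := by
      rintro u v h ⟨rfl, rfl⟩
      exact hD h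
    refine ⟨fun u v => if u = u₀ ∧ v = v₀ then a else f u v,
      fun u v => if u = u₀ ∧ v = v₀ then b else g u v, fun u v h ha => ?_, fun x hx => ?_⟩
    · rcases (hD' _ _).1 h with h | ⟨rfl, rfl⟩
      · simpa only [if_neg (hne u v h)] using h1 u v h ha
      · simpa using hab
    · by_cases hx' : x = a ∨ x = b
      · exact ⟨u₀, v₀, (hD' _ _).2 (Or.inr ⟨rfl, rfl⟩), hact, by simpa using hx'⟩
      · push Not at hx'
        obtain ⟨u, v, h3, h4, h5⟩ := h2 x (by simp [hx, hx'.1, hx'.2])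
        exact ⟨u, v, (hD' _ _).2 (Or.inl h3), h4, by simpa only [if_neg (hne u v h3)] using h5⟩

/-- The choices are read off the colouring: an edge between interior vertices contributes its
colour, a non-interior vertex the one or two colours it sees. Its neighbours are all interior by
`hcov`, so these colours lie in their palettes. -/
theorem covers_of_color {n k : ℕ} {A : ℕ → ℕ → Prop} {int pa pb : ℕ → ℕ} {c : ℕ → ℕ → ℕ}
    (hG : IsGraphOn n A) (hcov : ∀ u v, A u v → 0 < int u ∨ 0 < int v) (hc : TwoValid A c)
    (hlt : ∀ u v, A u v → c u v < k) (hsurj : ∀ a < k, ∃ u v, A u v ∧ c u v = a)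
    (hpal : ∀ u v, 0 < int u → A u v → InPalette pa pb u (c u v)) :
    Covers A int pa pb k (fun u v => u < n ∧ v < n) (Finset.range k) := by
  have hleaf : ∀ u, ∃ a b, int u = 0 → (∃ x, A u x) → Admissible A pa pb k u u a b ∧
      ∀ x, A u x → c u x = a ∨ c u x = b := by
    intro u
    by_cases hu : int u = 0 ∧ ∃ x, A u x
    · obtain ⟨hu, x, hx⟩ := hu
      have hnb : ∀ y, A u y → InPalette pa pb y (c u y) := fun y hy => by
        rw [hc.symm hy]
        refine hpal y u ?_ (hG.symm hy)
        rcases hcov u y hy with h | h <;> omega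
      by_cases hy : ∃ y, A u y ∧ c u y ≠ c u x
      · obtain ⟨y, hy, hne⟩ := hy
        have hall : ∀ z, A u z → c u z = c u x ∨ c u z = c u y := by
          intro z hz
          obtain ⟨p, q, hpq⟩ := hc.two u
          have := hpq x hx
          have := hpq y hy
          have := hpq z hz
          omega
        refine ⟨c u x, c u y, fun _ _ => ⟨⟨hlt _ _ hx, hlt _ _ hy, Or.inr ⟨rfl, fun z hz => ?_,
          x, y, hx, hy, hnb x hx, hnb y hy, ?_⟩⟩, hall⟩⟩
        · rcases hall z hz with h | h
          · exact Or.inl (h ▸ hnb z hz)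
          · exact Or.inr (h ▸ hnb z hz)
        · rintro rfl; rfl
      · push Not at hy
        refine ⟨c u x, c u x, fun _ _ => ⟨⟨hlt _ _ hx, hlt _ _ hx, Or.inr ⟨rfl, fun z hz => ?_,
          x, x, hx, hx, hnb x hx, hnb x hx, fun _ => rfl⟩⟩, fun z hz => Or.inl (hy z hz)⟩⟩
        exact Or.inl (hy z hz ▸ hnb z hz)
    · exact ⟨0, 0, fun h1 h2 => absurd ⟨h1, h2⟩ hu⟩
  choose α β hαβ using hleaf
  refine ⟨fun u v => if u = v then α u else c u v, fun u v => if u = v then β u else c u v,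
    fun u v _ hact => ?_, fun a ha => ?_⟩
  · rcases hact with ⟨h1, h2, h3, h4⟩ | ⟨rfl, h1, h2⟩
    · simp only [if_neg h1.ne]
      refine ⟨hlt _ _ h4, hlt _ _ h4, Or.inl ⟨h1, rfl, hpal u v h2 h4, ?_⟩⟩
      rw [hc.symm h4]
      exact hpal v u h3 (hG.symm h4)
    · simp only [if_true]
      exact (hαβ u h1 h2).1
  · obtain ⟨u, v, hA, rfl⟩ := hsurj a (Finset.mem_range.1 ha)
    have hu := hG.lt hA
    have hv := hG.lt_right hA
    by_cases h1 : int u = 0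
    · refine ⟨u, u, ⟨hu, hu⟩, Or.inr ⟨rfl, h1, v, hA⟩, ?_⟩
      simp only [if_true]
      exact (hαβ u h1 ⟨v, hA⟩).2 v hA
    by_cases h2 : int v = 0
    · refine ⟨v, v, ⟨hv, hv⟩, Or.inr ⟨rfl, h2, u, hG.symm hA⟩, ?_⟩
      simp only [if_true]
      rw [hc.symm hA]
      exact (hαβ v h2 ⟨u, hG.symm hA⟩).2 u (hG.symm hA)
    rcases lt_or_gt_of_ne (hG.ne hA) with h | h
    · exact ⟨u, v, ⟨hu, hv⟩, Or.inl ⟨h, by omega, by omega, hA⟩, by simp only [if_neg h.ne, true_or]⟩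
    · refine ⟨v, u, ⟨hv, hu⟩, Or.inl ⟨h, by omega, by omega, hG.symm hA⟩, ?_⟩
      simp only [if_neg h.ne, hc.symm hA, true_or]

/-- At a non-interior vertex the two witnesses `X u` and `Y u` receive the two chosen colours, and
every other neighbour whichever of them is in its palette. No edge joins two non-interior vertices,
so these assignments never conflict, and at an interior vertex the palette bounds the colours. -/
theorem Covers.colorable {n k : ℕ} {A : ℕ → ℕ → Prop} {int pa pb : ℕ → ℕ}
    (hG : IsGraphOn n A) (hcov : ∀ u v, A u v → 0 < int u ∨ 0 < int v)
    (h : Covers A int pa pb k (fun u v => u < n ∧ v < n) (Finset.range k)) : Colorable A k := by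
  classical
  obtain ⟨f, g, hadm, hsurj⟩ := h
  have hinner : ∀ u v, A u v → 0 < int u → 0 < int v → u < v →
      f u v < k ∧ f u v = g u v ∧ InPalette pa pb u (f u v) ∧ InPalette pa pb v (f u v) := by
    intro u v hA hu hv huv
    obtain ⟨h1, -, ⟨-, h2, h3, h4⟩ | ⟨h2, -⟩⟩ := hadm u v ⟨hG.lt hA, hG.lt_right hA⟩
      (Or.inl ⟨huv, hu, hv, hA⟩)
    · exact ⟨h1, h2, h3, h4⟩
    · omega
  have hleaf : ∀ u, ∃ x y, int u = 0 → (∃ z, A u z) → f u u < k ∧ g u u < k ∧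
      (∀ z, A u z → InPalette pa pb z (f u u) ∨ InPalette pa pb z (g u u)) ∧ A u x ∧ A u y ∧
      InPalette pa pb x (f u u) ∧ InPalette pa pb y (g u u) ∧ (x = y → f u u = g u u) := by
    intro u
    by_cases hu : int u = 0 ∧ ∃ z, A u z
    · obtain ⟨hu, z, hz⟩ := hu
      obtain ⟨h1, h2, ⟨h3, -⟩ | ⟨-, h3, x, y, h4⟩⟩ := hadm u u ⟨hG.lt hz, hG.lt hz⟩
        (Or.inr ⟨rfl, hu, z, hz⟩)
      · exact absurd h3 (lt_irrefl _)
      · exact ⟨x, y, fun _ _ => ⟨h1, h2, h3, h4⟩⟩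
    · exact ⟨0, 0, fun h1 h2 => absurd ⟨h1, h2⟩ hu⟩
  choose X Y hXY using hleaf
  -- the colour of an edge at the vertex `u`, which is not interior
  let ℓ : ℕ → ℕ → ℕ := fun u z => if z = X u then f u u else if z = Y u then g u u else
    if InPalette pa pb z (f u u) then f u u else g u u
  have hℓ : ∀ u z, int u = 0 → A u z → ℓ u z < k ∧ InPalette pa pb z (ℓ u z) ∧
      (ℓ u z = f u u ∨ ℓ u z = g u u) := by
    intro u z hu hz
    obtain ⟨h1, h2, h3, h4, h5, h6, h7, h8⟩ := hXY u hu ⟨z, hz⟩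
    simp only [ℓ]
    by_cases e1 : z = X u
    · rw [if_pos e1, e1]; exact ⟨h1, h6, Or.inl rfl⟩
    by_cases e2 : z = Y u
    · rw [if_neg e1, if_pos e2, e2]; exact ⟨h2, h7, Or.inr rfl⟩
    rw [if_neg e1, if_neg e2]
    by_cases e3 : InPalette pa pb z (f u u)
    · rw [if_pos e3]; exact ⟨h1, e3, Or.inl rfl⟩
    · rw [if_neg e3]; exact ⟨h2, (h3 z hz).resolve_left e3, Or.inr rfl⟩
  -- The order of the first two cases is irrelevant on edges, since at most one end is not interior.
  let c : ℕ → ℕ → ℕ := fun u v => if int u = 0 then ℓ u v else if int v = 0 then ℓ v u else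
    if u < v then f u v else f v u
  have hcl : ∀ u v, int u = 0 → c u v = ℓ u v := fun u v h => if_pos h
  have hcl' : ∀ u v, A u v → int v = 0 → c u v = ℓ v u := fun u v hA h => by
    have : ¬ int u = 0 := by rcases hcov u v hA with h | h <;> omega
    simp only [c, if_neg this, if_pos h]
  have hci : ∀ u v, 0 < int u → 0 < int v → u < v → c u v = f u v := fun u v hu hv h => by
    simp only [c, if_neg hu.ne', if_neg hv.ne', if_pos h]
  have hci' : ∀ u v, 0 < int u → 0 < int v → v < u → c u v = f v u := fun u v hu hv h => by
    simp only [c, if_neg hu.ne', if_neg hv.ne', if_neg h.not_gt]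
  have hsymm : ∀ u v, A u v → c u v = c v u := by
    intro u v hA
    by_cases hu : int u = 0
    · rw [hcl u v hu, hcl' v u (hG.symm hA) hu]
    by_cases hv : int v = 0
    · rw [hcl' u v hA hv, hcl v u hv]
    rcases lt_or_gt_of_ne (hG.ne hA) with h | h
    · rw [hci u v (by omega) (by omega) h, hci' v u (by omega) (by omega) h]
    · rw [hci' u v (by omega) (by omega) h, hci v u (by omega) (by omega) h]
  refine ⟨c, ⟨fun h => hsymm _ _ h, fun u => ?_⟩, fun u v hA => ?_, fun a ha => ?_⟩
  · by_cases hu : int u = 0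
    · refine ⟨f u u, g u u, fun v hA => ?_⟩
      rw [hcl u v hu]
      exact (hℓ u v hu hA).2.2
    · refine ⟨pa u, pb u, fun v hA => ?_⟩
      by_cases hv : int v = 0
      · rw [hcl' u v hA hv]
        exact (hℓ v u hv (hG.symm hA)).2.1
      rcases lt_or_gt_of_ne (hG.ne hA) with h | h
      · rw [hci u v (by omega) (by omega) h]
        exact (hinner u v hA (by omega) (by omega) h).2.2.1
      · rw [hci' u v (by omega) (by omega) h]
        exact (hinner v u (hG.symm hA) (by omega) (by omega) h).2.2.2
  · by_cases hu : int u = 0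
    · rw [hcl u v hu]; exact (hℓ u v hu hA).1
    by_cases hv : int v = 0
    · rw [hcl' u v hA hv]; exact (hℓ v u hv (hG.symm hA)).1
    rcases lt_or_gt_of_ne (hG.ne hA) with h | h
    · rw [hci u v (by omega) (by omega) h]
      exact (hinner u v hA (by omega) (by omega) h).1
    · rw [hci' u v (by omega) (by omega) h]
      exact (hinner v u (hG.symm hA) (by omega) (by omega) h).1
  · obtain ⟨u, v, -, hact, hfg⟩ := hsurj a (Finset.mem_range.2 ha)
    rcases hact with ⟨h1, h2, h3, h4⟩ | ⟨rfl, h1, h2⟩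
    · refine ⟨u, v, h4, ?_⟩
      rw [hci u v h2 h3 h1]
      have := (hinner u v h4 h2 h3 h1).2.1
      omega
    · obtain ⟨-, -, -, hx, hy, -, -, hxy⟩ := hXY u h1 h2
      rcases hfg with rfl | rfl
      · exact ⟨u, X u, hx, by rw [hcl u _ h1]; exact if_pos rfl⟩
      · refine ⟨u, Y u, hy, ?_⟩
        rw [hcl u _ h1]
        simp only [ℓ]
        by_cases e : Y u = X u
        · rw [if_pos e]; exact hxy e.symm
        · rw [if_neg e, if_pos trivial]

/-! ### Palettes in the order of the search -/

/-- The number of free colours in the palettes of the first `i` vertices: two for an interior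
root, one for the other interior vertices. -/
def slot (ord int root : ℕ → ℕ) (i : ℕ) : ℕ :=
  ∑ p ∈ Finset.range i, if 0 < int (ord p) then if 0 < root (ord p) then 2 else 1 else 0

theorem slot_succ (ord int root : ℕ → ℕ) (i : ℕ) : slot ord int root (i + 1) =
    slot ord int root i + if 0 < int (ord i) then if 0 < root (ord i) then 2 else 1 else 0 :=
  Finset.sum_range_succ _ _

theorem slot_mono (ord int root : ℕ → ℕ) : Monotone (slot ord int root) :=
  monotone_nat_of_le_succ fun i => by rw [slot_succ]; omega

/-- Every interior vertex is counted once by its parity, and an interior root once more for its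
second free colour. -/
theorem SearchForest.slot_eq {n : ℕ} {A : ℕ → ℕ → Prop} {ord int par dep root : ℕ → ℕ}
    (h : SearchForest n A ord int par dep root) : slot ord int root n =
      ((Finset.range n).filter fun u => 0 < int u ∧ dep u = 0).card +
      ((Finset.range n).filter fun u => 0 < int u ∧ 0 < dep u).card +
      ((Finset.range n).filter fun u => 0 < int u ∧ 0 < root u).card := by
  have h1 : slot ord int root n =
      ∑ u ∈ Finset.range n, if 0 < int u then if 0 < root u then 2 else 1 else 0 := by
    refine Finset.sum_bij (fun p _ => ord p) (fun p hp => ?_) (fun p hp q hq e => ?_)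
      (fun u hu => ?_) (fun p _ => rfl)
    · simpa using h.lt p (by simpa using hp)
    · exact h.inj p (by simpa using hp) q (by simpa using hq) e
    · obtain ⟨p, hp, e⟩ := h.surj u (by simpa using hu)
      exact ⟨p, by simpa using hp, e⟩
  rw [h1, Finset.card_filter, Finset.card_filter, Finset.card_filter, ← Finset.sum_add_distrib,
    ← Finset.sum_add_distrib]
  refine Finset.sum_congr rfl fun u _ => ?_
  split_ifs <;> omega

/-- The palettes `{pa u, pb u}` that belong to the free colours `val` and the choices `bit` of the
colour that is shared with the parent. -/
def IsPalettes (n : ℕ) (ord int par root val bit pa pb : ℕ → ℕ) : Prop :=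
  ∀ p < n, 0 < int (ord p) →
    (0 < root (ord p) → pa (ord p) = val (slot ord int root p) ∧
      pb (ord p) = val (slot ord int root p + 1)) ∧
    (root (ord p) = 0 → pa (ord p) = (if 0 < bit (slot ord int root p) then pb (par (ord p))
        else pa (par (ord p))) ∧ pb (ord p) = val (slot ord int root p))

/-! ### Restricted growth sequences and free colours -/

/-- The first `i` terms of `v` are a restricted growth sequence with exactly the values
below `j`. -/
def RestrictedGrowth (v : ℕ → ℕ) : ℕ → ℕ → Prop
  | 0, j => j = 0
  | i + 1, j => v i < j ∧ RestrictedGrowth v i j ∨ v i + 1 = j ∧ RestrictedGrowth v i (j - 1)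

theorem RestrictedGrowth.lt {v : ℕ → ℕ} {i j : ℕ} (h : RestrictedGrowth v i j) :
    ∀ l < i, v l < j := by
  induction i generalizing j with
  | zero => exact fun l hl => absurd hl (Nat.not_lt_zero _)
  | succ i ih =>
    intro l hl
    rcases h with ⟨h1, h2⟩ | ⟨h1, h2⟩ <;> rcases Nat.lt_succ_iff_lt_or_eq.1 hl with hl | rfl
    · exact ih h2 l hl
    · exact h1
    · have := ih h2 l hl; omega
    · omega

theorem RestrictedGrowth.congr {v v' : ℕ → ℕ} {i j : ℕ} (h : RestrictedGrowth v i j)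
    (hv : ∀ l < i, v' l = v l) : RestrictedGrowth v' i j := by
  induction i generalizing j with
  | zero => exact h
  | succ i ih =>
    unfold RestrictedGrowth
    rw [hv i (by omega)]
    rcases h with ⟨h1, h2⟩ | ⟨h1, h2⟩
    · exact Or.inl ⟨h1, ih h2 fun l hl => hv l (by omega)⟩
    · exact Or.inr ⟨h1, ih h2 fun l hl => hv l (by omega)⟩

/-- Colours are renamed in the order of their first appearance. A new value is swapped with the
least unused number; the names given before are different from both and stay fixed. -/
theorem exists_perm_restrictedGrowth (v : ℕ → ℕ) (N : ℕ) : ∃ π : Equiv.Perm ℕ,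
    RestrictedGrowth (fun i => π (v i)) N ((Finset.range N).image v).card := by
  induction N with
  | zero => exact ⟨1, rfl⟩
  | succ N ih =>
    obtain ⟨π, hπ⟩ := ih
    rw [Finset.range_add_one, Finset.image_insert]
    by_cases hmem : v N ∈ (Finset.range N).image v
    · rw [Finset.insert_eq_of_mem hmem]
      refine ⟨π, Or.inl ⟨?_, hπ⟩⟩
      obtain ⟨i, hi, e⟩ := Finset.mem_image.1 hmem
      have := hπ.lt i (Finset.mem_range.1 hi)
      rwa [e] at this
    · rw [Finset.card_insert_of_notMem hmem]
      refine ⟨Equiv.swap (π (v N)) ((Finset.range N).image v).card * π, Or.inr ⟨?_, ?_⟩⟩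
      · simp only [Equiv.Perm.mul_apply, Equiv.swap_apply_left]
      · rw [Nat.add_sub_cancel]
        refine hπ.congr fun i hi => ?_
        rw [Equiv.Perm.mul_apply]
        refine Equiv.swap_apply_of_ne_of_ne ?_ (hπ.lt i hi).ne
        refine fun e => hmem ?_
        rw [← π.injective e]
        exact Finset.mem_image_of_mem v (Finset.mem_range.2 hi)

/-- Completeness of the enumeration. The sequences depend only on the colouring, while the last
clause allows any arrays that agree with them on the slots, which is what the program knows about
its own arrays. -/
theorem SearchForest.exists_palettes {n k : ℕ} {A : ℕ → ℕ → Prop} {ord int par dep root : ℕ → ℕ}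
    (hG : IsGraphOn n A) (h : SearchForest n A ord int par dep root) (hcol : Colorable A k) :
    ∃ val bit : ℕ → ℕ, RestrictedGrowth val (slot ord int root n) k ∧ (∀ i, bit i ≤ 1) ∧
      ∀ val' bit' pa pb : ℕ → ℕ, (∀ i < slot ord int root n, val' i = val i ∧ bit' i = bit i) →
        IsPalettes n ord int par root val' bit' pa pb →
        Covers A int pa pb k (fun u v => u < n ∧ v < n) (Finset.range k) := by
  classical
  obtain ⟨c, hc, hlt, hsurj⟩ := hcol
  -- the palettes of the colouring
  have hpal : ∀ u, ∃ x y, 0 < int u → u < n → A u x ∧ A u y ∧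
      (∀ z, A u z → c u z = c u x ∨ c u z = c u y) ∧ (root u = 0 → x = par u) := by
    intro u
    by_cases hu : 0 < int u ∧ u < n
    · obtain ⟨hu, hun⟩ := hu
      obtain ⟨x, hx, hxp⟩ : ∃ x, A u x ∧ (root u = 0 → x = par u) := by
        by_cases hr : root u = 0
        · obtain ⟨p, hp, rfl⟩ := h.surj u hun
          obtain ⟨q, -, h1, h2, -⟩ := h.parent p hp hr
          exact ⟨ord q, hG.symm h2, fun _ => h1.symm⟩
        · obtain ⟨w, hw, -⟩ := h.exists_child hu
          exact ⟨w, hw, fun h' => absurd h' hr⟩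
      by_cases hy : ∃ y, A u y ∧ c u y ≠ c u x
      · obtain ⟨y, hy, hne⟩ := hy
        refine ⟨x, y, fun _ _ => ⟨hx, hy, fun z hz => ?_, hxp⟩⟩
        obtain ⟨p, q, hpq⟩ := hc.two u
        have := hpq x hx
        have := hpq y hy
        have := hpq z hz
        omega
      · push Not at hy
        exact ⟨x, x, fun _ _ => ⟨hx, hx, fun z hz => Or.inl (hy z hz), hxp⟩⟩
    · exact ⟨0, 0, fun h1 h2 => absurd ⟨h1, h2⟩ hu⟩
  choose X Y hXY using hpal
  let pa₀ : ℕ → ℕ := fun u => c u (X u)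
  let pb₀ : ℕ → ℕ := fun u => c u (Y u)
  let sl := slot ord int root
  -- The position of the vertex to which the slot `s` belongs. Taking the greatest candidate skips
  -- the vertices that have no slot.
  let own : ℕ → ℕ := fun s => Nat.findGreatest (fun p => sl p ≤ s) n
  have hown : ∀ p < n, ∀ s, sl p ≤ s → s < sl (p + 1) → own s = p := by
    intro p hp s h1 h2
    refine le_antisymm ?_ (Nat.le_findGreatest hp.le h1)
    by_contra hlt'
    have h3 : sl (own s) ≤ s := Nat.findGreatest_spec (P := fun p => sl p ≤ s) hp.le h1
    have h4 : sl (p + 1) ≤ sl (own s) := slot_mono ord int root (by omega)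
    omega
  have hownlt : ∀ s < sl n, own s < n ∧ sl (own s) ≤ s ∧ s < sl (own s + 1) := by
    intro s hs
    have h0 : sl 0 ≤ s := by simp [sl, slot]
    have h1 : sl (own s) ≤ s :=
      Nat.findGreatest_spec (P := fun p => sl p ≤ s) (Nat.zero_le n) h0
    have h2 : own s < n := by
      refine lt_of_le_of_ne (Nat.findGreatest_le n) fun e => ?_
      rw [e] at h1; omega
    refine ⟨h2, h1, ?_⟩
    by_contra h3
    have := Nat.le_findGreatest (P := fun p => sl p ≤ s) (n := n) (m := own s + 1) h2
      (by omega)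
    exact absurd this (by simp [own])
  have hsucc : ∀ p, sl (p + 1) =
      sl p + if 0 < int (ord p) then if 0 < root (ord p) then 2 else 1 else 0 :=
    slot_succ ord int root
  let val₀ : ℕ → ℕ := fun s => if 0 < root (ord (own s)) ∧ s = sl (own s) then pa₀ (ord (own s))
    else pb₀ (ord (own s))
  -- The bit tells which colour of the parent's palette the edge to the parent has; it is 1 if that
  -- is the second one.
  let bit₀ : ℕ → ℕ := fun s => if pa₀ (ord (own s)) = pb₀ (par (ord (own s))) then 1 else 0
  have hroot : ∀ p < n, 0 < int (ord p) → 0 < root (ord p) →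
      sl p + 1 < sl n ∧ pa₀ (ord p) = val₀ (sl p) ∧ pb₀ (ord p) = val₀ (sl p + 1) := by
    intro p hp hi hr
    have hs := hsucc p
    rw [if_pos hi, if_pos hr] at hs
    have h1 := hown p hp (sl p) le_rfl (by omega)
    have h2 := hown p hp (sl p + 1) (by omega) (by omega)
    have h3 : sl (p + 1) ≤ sl n := slot_mono ord int root hp
    refine ⟨by omega, ?_, ?_⟩
    · simp only [val₀, h1, and_true, hr, if_true]
    · simp only [val₀, h2]
      rw [if_neg]
      omega
  have hnon : ∀ p < n, 0 < int (ord p) → root (ord p) = 0 → sl p < sl n ∧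
      pa₀ (ord p) = (if 0 < bit₀ (sl p) then pb₀ (par (ord p)) else pa₀ (par (ord p))) ∧
      pb₀ (ord p) = val₀ (sl p) := by
    intro p hp hi hr
    have hs := hsucc p
    rw [if_pos hi, if_neg (by omega)] at hs
    have h1 := hown p hp (sl p) le_rfl (by omega)
    have h3 : sl (p + 1) ≤ sl n := slot_mono ord int root hp
    refine ⟨by omega, ?_, ?_⟩
    · simp only [bit₀, h1]
      obtain ⟨q, hq, e1, e2, e3, -⟩ := h.parent p hp hr
      have hX := (hXY (ord p) hi (h.lt p hp)).2.2.2 hr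
      have hpp := (hXY (ord q) e3 (h.lt q (by omega))).2.2.1 (ord p) e2
      have hpa : pa₀ (ord p) = c (ord q) (ord p) := by
        simp only [pa₀]; rw [hX, e1, hc.symm e2]
      by_cases hb : pa₀ (ord p) = pb₀ (par (ord p))
      · rw [if_pos hb, if_pos Nat.one_pos, hb]
      · rw [if_neg hb, if_neg (lt_irrefl 0), e1, hpa]
        rw [e1, hpa] at hb
        exact hpp.resolve_right hb
    · simp only [val₀, h1]
      rw [if_neg]
      omega
  -- Every colour occurs at an interior vertex, by `cover`, hence in a palette. Inherited colours
  -- are traced back along the order to an ancestor, so each colour is the free colour of some slot.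
  have himg : (Finset.range (sl n)).image val₀ = Finset.range k := by
    ext a
    simp only [Finset.mem_image, Finset.mem_range]
    constructor
    · rintro ⟨s, hs, rfl⟩
      obtain ⟨h1, h2, h3⟩ := hownlt s hs
      have hi : 0 < int (ord (own s)) := by
        by_contra hi
        have := hsucc (own s)
        rw [if_neg hi] at this
        omega
      obtain ⟨hx, hy, -⟩ := hXY _ hi (h.lt _ h1)
      simp only [val₀]
      split_ifs
      exacts [hlt _ _ hx, hlt _ _ hy]
    · intro ha
      have key : ∀ p, p < n → 0 < int (ord p) → (∃ s < sl n, val₀ s = pa₀ (ord p)) ∧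
          ∃ s < sl n, val₀ s = pb₀ (ord p) := by
        intro p
        induction p using Nat.strong_induction_on with
        | _ p ih =>
          intro hp hi
          by_cases hr : root (ord p) = 0
          · obtain ⟨h1, h2, h3⟩ := hnon p hp hi hr
            obtain ⟨q, hq, e1, -, e3, -⟩ := h.parent p hp hr
            have hq' := ih q hq (by omega) e3
            refine ⟨?_, sl p, h1, h3.symm⟩
            rw [h2, e1]
            split_ifs
            exacts [hq'.2, hq'.1]
          · obtain ⟨h1, h2, h3⟩ := hroot p hp hi (by omega)
            exact ⟨⟨_, by omega, h2.symm⟩, _, h1, h3.symm⟩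
      have key' : ∀ u v, A u v → 0 < int u → ∃ s < sl n, val₀ s = c u v := by
        intro u v hA hu
        have hun := hG.lt hA
        obtain ⟨p, hp, rfl⟩ := h.surj u hun
        rcases (hXY _ hu hun).2.2.1 v hA with e | e
        · rw [e]; exact (key p hp hu).1
        · rw [e]; exact (key p hp hu).2
      obtain ⟨u, v, hA, rfl⟩ := hsurj a ha
      rcases h.cover u v hA with hu | hv
      · exact key' u v hA hu
      · rw [hc.symm hA]; exact key' v u (hG.symm hA) hv
  obtain ⟨π, hπ⟩ := exists_perm_restrictedGrowth val₀ (sl n)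
  rw [himg, Finset.card_range] at hπ
  have hπlt : ∀ a < k, π a < k := by
    intro a ha
    have := Finset.mem_range.2 ha
    rw [← himg] at this
    obtain ⟨s, hs, rfl⟩ := Finset.mem_image.1 this
    exact hπ.lt s (Finset.mem_range.1 hs)
  have hπsurj : ∀ b < k, ∃ a < k, π a = b := by
    have : (Finset.range k).image π = Finset.range k := by
      refine Finset.eq_of_subset_of_card_le (fun x hx => ?_) ?_
      · obtain ⟨a, ha, rfl⟩ := Finset.mem_image.1 hx
        exact Finset.mem_range.2 (hπlt a (Finset.mem_range.1 ha))
      · rw [Finset.card_image_of_injective _ π.injective]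
    intro b hb
    rw [← Finset.mem_range, ← this] at hb
    obtain ⟨a, ha, e⟩ := Finset.mem_image.1 hb
    exact ⟨a, Finset.mem_range.1 ha, e⟩
  refine ⟨fun s => π (val₀ s), bit₀, hπ, fun s => ?_, fun val' bit' pa pb hagree hP => ?_⟩
  · simp only [bit₀]; split_ifs <;> omega
  -- Parents come earlier in the order, so by induction the palettes rebuilt from the sequences are
  -- the renamed palettes of the colouring.
  have hpab : ∀ p, p < n → 0 < int (ord p) → pa (ord p) = π (pa₀ (ord p)) ∧
      pb (ord p) = π (pb₀ (ord p)) := by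
    intro p
    induction p using Nat.strong_induction_on with
    | _ p ih =>
      intro hp hi
      by_cases hr : root (ord p) = 0
      · obtain ⟨h1, h2, h3⟩ := hnon p hp hi hr
        obtain ⟨q, hq, e1, -, e3, -⟩ := h.parent p hp hr
        obtain ⟨g1, g2⟩ := (hP p hp hi).2 hr
        obtain ⟨i1, i2⟩ := ih q hq (by omega) e3
        obtain ⟨a1, a2⟩ := hagree _ h1
        refine ⟨?_, ?_⟩
        · rw [g1, h2, a2, e1, i1, i2]
          exact (apply_ite π _ _ _).symm
        · rw [g2, a1, h3]
      · obtain ⟨h1, h2, h3⟩ := hroot p hp hi (by omega)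
        obtain ⟨g1, g2⟩ := (hP p hp hi).1 (by omega)
        rw [g1, g2, h2, h3]
        exact ⟨(hagree _ (lt_trans (Nat.lt_succ_self _) h1)).1, (hagree _ h1).1⟩
  refine covers_of_color (c := fun u v => π (c u v)) hG h.cover
    ⟨fun hA => by rw [hc.symm hA], fun u => ?_⟩ (fun u v hA => hπlt _ (hlt u v hA))
    (fun b hb => ?_) (fun u v hu hA => ?_)
  · obtain ⟨p, q, hpq⟩ := hc.two u
    refine ⟨π p, π q, fun v hA => ?_⟩
    rcases hpq v hA with e | e
    · exact Or.inl (by rw [e])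
    · exact Or.inr (by rw [e])
  · obtain ⟨a, ha, rfl⟩ := hπsurj b hb
    obtain ⟨u, v, hA, rfl⟩ := hsurj a ha
    exact ⟨u, v, hA, rfl⟩
  · have hun := hG.lt hA
    obtain ⟨p, hp, rfl⟩ := h.surj u hun
    obtain ⟨g1, g2⟩ := hpab p hp hu
    rcases (hXY _ hu hun).2.2.1 v hA with e | e
    · exact Or.inl (by rw [g1, e])
    · exact Or.inr (by rw [g2, e])

/-! ### Ranking restricted growth sequences with choices -/

/-- The number of pairs of a restricted growth sequence of length `i` with exactly `j` values and
a sequence of `i` bits. -/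
def weight : ℕ → ℕ → ℕ
  | 0, j => if j = 0 then 1 else 0
  | i + 1, j => 2 * (j * weight i j + if j = 0 then 0 else weight i (j - 1))

/-- Half of `weight (i + 1) j`. -/
def halfWeight (i j : ℕ) : ℕ := j * weight i j + if j = 0 then 0 else weight i (j - 1)

theorem weight_succ (i j : ℕ) : weight (i + 1) j = 2 * halfWeight i j := rfl

/-- The pair of sequences `v` and `b` has rank `r`. -/
def IsRank (v b : ℕ → ℕ) : ℕ → ℕ → ℕ → Prop
  | 0, j, r => j = 0 ∧ r = 0
  | i + 1, j, r => ∃ r',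
      v i < j ∧ IsRank v b i j r' ∧ r = b i * halfWeight i j + v i * weight i j + r' ∨
      v i + 1 = j ∧ IsRank v b i (j - 1) r' ∧ r = b i * halfWeight i j + j * weight i j + r'

/-- The bit, the last term and the rank of the rest are the digits of a mixed-radix number. The
block for a last term that is new starts at `j * weight i j` and has length `weight i (j - 1)`.
Since only an upper bound is needed to reach every sequence, ranks are not shown to be distinct. -/
theorem IsRank.lt {v b : ℕ → ℕ} (hb : ∀ i, b i ≤ 1) {i j r : ℕ} (h : IsRank v b i j r) :
    r < weight i j := by
  induction i generalizing j r with
  | zero => obtain ⟨rfl, rfl⟩ := h; simp [weight]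
  | succ i ih =>
    have h0 := Nat.mul_le_mul_right (halfWeight i j) (hb i)
    rw [weight_succ]
    obtain ⟨r', ⟨h1, h2, h3⟩ | ⟨h1, h2, h3⟩⟩ := h
    · have h4 := ih h2
      have h5 : (v i + 1) * weight i j ≤ j * weight i j := Nat.mul_le_mul_right _ h1
      have h6 : j * weight i j ≤ halfWeight i j := Nat.le_add_right _ _
      rw [add_mul] at h5
      omega
    · have h4 := ih h2
      have h6 : halfWeight i j = j * weight i j + weight i (j - 1) := by
        rw [halfWeight, if_neg (by omega)]
      omega

theorem RestrictedGrowth.exists_rank {v : ℕ → ℕ} (b : ℕ → ℕ) {i j : ℕ}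
    (h : RestrictedGrowth v i j) : ∃ r, IsRank v b i j r := by
  induction i generalizing j with
  | zero => exact ⟨0, h, rfl⟩
  | succ i ih =>
    rcases h with ⟨h1, h2⟩ | ⟨h1, h2⟩
    · obtain ⟨r, hr⟩ := ih h2
      exact ⟨_, r, Or.inl ⟨h1, hr, rfl⟩⟩
    · obtain ⟨r, hr⟩ := ih h2
      exact ⟨_, r, Or.inr ⟨h1, hr, rfl⟩⟩

/-! ### The number of sequences to be tried -/

/-- The generating function of `weight · j` is (2x)^j divided by the product of 1 - 2lx over 1 ≤ l ≤
j. At x = 1/K each single term is at most the sum of the series, which is the claim; the proof by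
the recurrence avoids the series. -/
theorem weight_mul_prod_le {K j : ℕ} (hj : 2 * j ≤ K) (i : ℕ) :
    weight i j * ∏ l ∈ Finset.range j, (K - 2 * (l + 1)) ≤ 2 ^ j * K ^ i := by
  induction i generalizing j with
  | zero =>
    rcases Nat.eq_zero_or_pos j with rfl | hj'
    · simp [weight]
    · simp [weight, hj'.ne']
  | succ i ih =>
    rw [weight]
    rcases j with _ | j
    · simp
    · rw [if_neg (by omega), Nat.add_sub_cancel]
      have h1 := ih hj
      have h2 := ih (j := j) (by omega)
      -- With this `d` the two summands of the recurrence carry the factors `2 * (j + 1)` and `d`,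
      -- which add up to `K`.
      obtain ⟨d, hd⟩ : ∃ d, K = 2 * (j + 1) + d := ⟨K - 2 * (j + 1), by omega⟩
      rw [Finset.prod_range_succ] at h1 ⊢
      rw [show K - 2 * (j + 1) = d by omega] at h1 ⊢
      generalize ∏ l ∈ Finset.range j, (K - 2 * (l + 1)) = p at h1 h2 ⊢
      calc 2 * ((j + 1) * weight i (j + 1) + weight i j) * (p * d)
          = 2 * (j + 1) * (weight i (j + 1) * (p * d)) + 2 * d * (weight i j * p) := by ring
        _ ≤ 2 * (j + 1) * (2 ^ (j + 1) * K ^ i) + 2 * d * (2 ^ j * K ^ i) := by gcongr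
        _ = 2 ^ (j + 1) * (K ^ i * (2 * (j + 1) + d)) := by ring
        _ = 2 ^ (j + 1) * K ^ (i + 1) := by rw [← hd, pow_succ K i]

/-! ### The product in the denominator, compared with powers of k -/

/-- The product of the numbers `k, k + 2, …, 3 * k - 2`. -/
def stepProd (k : ℕ) : ℕ := ∏ m ∈ Finset.range k, (k + 2 * m)

theorem prod_eq_stepProd (k : ℕ) :
    ∏ l ∈ Finset.range k, (3 * k - 2 * (l + 1)) = stepProd k := by
  rw [stepProd, ← Finset.prod_range_reflect]
  refine Finset.prod_congr rfl fun l hl => ?_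
  have := Finset.mem_range.1 hl
  omega

theorem stepProd_pos (k : ℕ) : 0 < stepProd k :=
  Finset.prod_pos fun m hm => by have := Finset.mem_range.1 hm; omega

/-- Multiplied by `k`, the left product runs from `k` in steps of two, so it is `stepProd k` times
3k, 3k + 2 and 3k + 4. -/
theorem stepProd_add_two {k : ℕ} (hk : 0 < k) :
    stepProd (k + 2) = 3 * (3 * k + 2) * (3 * k + 4) * stepProd k := by
  have h1 : k * stepProd (k + 2) = ∏ m ∈ Finset.range (k + 3), (k + 2 * m) := by
    rw [Finset.prod_range_succ', stepProd, mul_comm]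
    congr 1
    exact Finset.prod_congr rfl fun m _ => by ring
  rw [Finset.prod_range_succ, Finset.prod_range_succ, Finset.prod_range_succ, ← stepProd] at h1
  refine Nat.eq_of_mul_eq_mul_left hk ?_
  rw [h1]
  ring

/-- (1 + 2/k)^k ≤ e² ≤ 7.39. -/
theorem add_two_pow_le {k : ℕ} (hk : 0 < k) : 100 * (k + 2) ^ k ≤ 739 * k ^ k := by
  have hk' : (0 : ℝ) < k := by exact_mod_cast hk
  have h1 : ((k : ℝ) + 2) ^ k ≤ Real.exp 2 * (k : ℝ) ^ k := by
    have h2 : (k : ℝ) + 2 = (2 / k + 1) * k := by field_simp; ring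
    rw [h2, mul_pow]
    refine mul_le_mul_of_nonneg_right ?_ (by positivity)
    calc (2 / (k : ℝ) + 1) ^ k ≤ Real.exp (2 / k) ^ k :=
          pow_le_pow_left₀ (by positivity) (Real.add_one_le_exp _) _
      _ = Real.exp 2 := by rw [← Real.exp_nat_mul]; congr 1; field_simp
  have h2 : Real.exp 2 ≤ 7.39 := by
    have h3 : Real.exp 2 = Real.exp 1 * Real.exp 1 := by rw [← Real.exp_add]; norm_num
    have := Real.exp_one_lt_d9
    have := Real.exp_pos 1
    rw [h3]
    nlinarith
  have h3 : (100 : ℝ) * (k + 2) ^ k ≤ 739 * (k : ℝ) ^ k := by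
    have : (0 : ℝ) < (k : ℝ) ^ k := by positivity
    nlinarith
  exact_mod_cast h3

/-- From k to k + 2 the left side grows by at most 81·e²·(k+2)², with leading coefficient below 599,
and the right side by 25·3·(3k+2)(3k+4), with leading coefficient 675. The constant absorbs the
small cases. -/
theorem exists_pow_le_stepProd : ∃ C, ∀ k, (9 * k) ^ k ≤ C * (5 ^ k * stepProd k) := by
  refine ⟨∑ k ∈ Finset.range 18, (9 * k) ^ k, fun k => ?_⟩
  induction k using Nat.strong_induction_on with
  | _ k ih =>
    rcases Nat.lt_or_ge k 18 with hk | hk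
    · have h1 : (9 * k) ^ k ≤ ∑ k ∈ Finset.range 18, (9 * k) ^ k :=
        Finset.single_le_sum (f := fun k => (9 * k) ^ k) (fun _ _ => Nat.zero_le _)
          (Finset.mem_range.2 hk)
      have h2 : 1 ≤ 5 ^ k * stepProd k := Nat.mul_pos (by positivity) (stepProd_pos k)
      exact h1.trans (Nat.le_mul_of_pos_right _ h2)
    · obtain ⟨k, rfl⟩ : ∃ l, k = l + 2 := ⟨k - 2, by omega⟩
      generalize ∑ k ∈ Finset.range 18, (9 * k) ^ k = C at ih ⊢
      have h1 := ih k (by omega)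
      have h2 := add_two_pow_le (show 0 < k by omega)
      rw [stepProd_add_two (by omega)]
      refine le_of_mul_le_mul_left ?_ (show 0 < 100 by norm_num)
      -- True from k = 16 on and false at 15; therefore the induction starts at 18 = 16 + 2.
      have h3 : 81 * 739 * (k + 2) ^ 2 ≤ 100 * 25 * (3 * (3 * k + 2) * (3 * k + 4)) := by
        nlinarith
      calc 100 * (9 * (k + 2)) ^ (k + 2) = 81 * (k + 2) ^ 2 * 9 ^ k * (100 * (k + 2) ^ k) := by
            rw [mul_pow]; ring
        _ ≤ 81 * (k + 2) ^ 2 * 9 ^ k * (739 * k ^ k) := by gcongr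
        _ = 81 * 739 * (k + 2) ^ 2 * (9 * k) ^ k := by rw [mul_pow]; ring
        _ ≤ 100 * 25 * (3 * (3 * k + 2) * (3 * k + 4)) * (C * (5 ^ k * stepProd k)) := by gcongr
        _ = 100 * (C * (5 ^ (k + 2) * (3 * (3 * k + 2) * (3 * k + 4) * stepProd k))) := by ring

/-- With K = 3k the bound is 4^k (9k²)^k / `stepProd k`. One factor (9k)^k against the product costs
5^k, which leaves (4k)^k · 5^k. -/
theorem exists_weight_le :
    ∃ C, ∀ k i, i ≤ 2 * k → 2 ^ k * weight i k ≤ C * (20 * k) ^ k := by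
  obtain ⟨C, hC⟩ := exists_pow_le_stepProd
  refine ⟨C, fun k i hi => ?_⟩
  rcases Nat.eq_zero_or_pos k with rfl | hk
  · obtain rfl : i = 0 := by omega
    have := hC 0
    simp [weight, stepProd] at this ⊢
    omega
  have h1 := weight_mul_prod_le (K := 3 * k) (j := k) (by omega) i
  rw [prod_eq_stepProd] at h1
  refine le_of_mul_le_mul_right ?_ (stepProd_pos k)
  calc 2 ^ k * weight i k * stepProd k = 2 ^ k * (weight i k * stepProd k) := by ring
    _ ≤ 2 ^ k * (2 ^ k * (3 * k) ^ i) := by gcongr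
    _ ≤ 2 ^ k * (2 ^ k * (3 * k) ^ (2 * k)) := by gcongr; omega
    _ = (4 * k) ^ k * (9 * k) ^ k := by
        rw [pow_mul, ← mul_pow, ← mul_pow, ← mul_pow]; congr 1; ring
    _ ≤ (4 * k) ^ k * (C * (5 ^ k * stepProd k)) := by gcongr; exact hC k
    _ = C * (20 * k) ^ k * stepProd k := by
        rw [show 20 * k = 4 * k * 5 by ring, mul_pow (4 * k) 5]; ring

/-- A crude bound, needed only to see that the table entries stay below the cap. -/
theorem weight_le (i j : ℕ) : weight i j ≤ (2 * (j + 1)) ^ i := by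
  induction i generalizing j with
  | zero => rw [weight]; split_ifs <;> simp
  | succ i ih =>
    rw [weight, pow_succ]
    have h1 := ih j
    rcases j with _ | j
    · simp
    · rw [if_neg (by omega), Nat.add_sub_cancel]
      have h2 : weight i j ≤ (2 * (j + 1 + 1)) ^ i :=
        (ih j).trans (Nat.pow_le_pow_left (by omega) i)
      have := Nat.mul_le_mul_left (j + 1) h1
      nlinarith

/-! ### Reasoning about programs -/

namespace RAM

@[simp] theorem St.set_r (σ : St) (x y : Reg) (n : ℕ) :
    (σ.set x n).r y = if y = x then n else σ.r y := by
  simp only [St.set, Function.update_apply]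

@[simp] theorem St.set_a (σ : St) (x : Reg) (n : ℕ) : (σ.set x n).a = σ.a := rfl

@[simp] theorem St.put_r (σ : St) (a : Arr) (i n : ℕ) : (σ.put a i n).r = σ.r := rfl

@[simp] theorem St.put_a (σ : St) (a b : Arr) (i n : ℕ) :
    (σ.put a i n).a b = if b = a then Function.update (σ.a a) i n else σ.a b := by
  simp only [St.put, Function.update_apply]

namespace Expr

/-- The expression has a positive value. -/
def Holds (E : Env) (e : Expr) (σ : St) : Prop := 0 < e.eval E σ

/-- zero -/
def zero : Expr := bool false

/-- one -/
def one : Expr := bool true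

/-- `e < f` -/
def lt (e f : Expr) : Expr := sub f e

/-- negation -/
def not (e : Expr) : Expr := sub one e

/-- conjunction -/
def and (e f : Expr) : Expr := ite e f zero

/-- disjunction -/
def or (e f : Expr) : Expr := ite e one f

/-- `e ≤ f` -/
def le (e f : Expr) : Expr := not (lt f e)

/-- `e = f` -/
def eq (e f : Expr) : Expr := and (le e f) (le f e)

/-- `e` holds for some value of `x` below the parameter `i`. -/
def ex (x : Reg) (i : Par) (e : Expr) : Expr := lt (find x i e) (par i)

/-- `e` holds for all values of `x` below the parameter `i`. -/
def all (x : Reg) (i : Par) (e : Expr) : Expr := not (ex x i (not e))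

variable {E : Env} {σ : St}

@[simp] theorem eval_zero : zero.eval E σ = 0 := rfl

@[simp] theorem eval_var (x : Reg) : (var x).eval E σ = σ.r x := rfl

@[simp] theorem eval_par (i : Par) : (par i).eval E σ = E.β i := rfl

@[simp] theorem eval_get (a : Arr) (e : Expr) : (get a e).eval E σ = σ.a a (e.eval E σ) := rfl

@[simp] theorem eval_add (e f : Expr) :
    (add e f).eval E σ = min (e.eval E σ + f.eval E σ) E.V := rfl

@[simp] theorem eval_sub (e f : Expr) : (sub e f).eval E σ = e.eval E σ - f.eval E σ := rfl

@[simp] theorem eval_one : one.eval E σ = 1 := rfl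

@[simp] theorem holds_lt {e f : Expr} : (lt e f).Holds E σ ↔ e.eval E σ < f.eval E σ := by
  simp only [Holds, lt, eval]; omega

@[simp] theorem holds_not {e : Expr} : (not e).Holds E σ ↔ ¬ e.Holds E σ := by
  simp only [Holds, not, eval, eval_one]; omega

@[simp] theorem holds_and {e f : Expr} : (and e f).Holds E σ ↔ e.Holds E σ ∧ f.Holds E σ := by
  simp only [Holds, and, eval, eval_zero]
  split_ifs with h <;> simp [h]

@[simp] theorem holds_or {e f : Expr} : (or e f).Holds E σ ↔ e.Holds E σ ∨ f.Holds E σ := by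
  simp only [Holds, or, eval, eval_one]
  split_ifs with h <;> simp [h]

@[simp] theorem holds_le {e f : Expr} : (le e f).Holds E σ ↔ e.eval E σ ≤ f.eval E σ := by
  rw [le, holds_not, holds_lt, not_lt]

@[simp] theorem holds_eq {e f : Expr} : (eq e f).Holds E σ ↔ e.eval E σ = f.eval E σ := by
  rw [eq, holds_and, holds_le, holds_le]; omega

theorem find_spec (x : Reg) (i : Par) (e : Expr) (E : Env) (σ : St) :
    ((find x i e).eval E σ < E.β i → e.Holds E (σ.set x ((find x i e).eval E σ))) ∧
      ∀ j < (find x i e).eval E σ, ¬ e.Holds E (σ.set x j) := by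
  have h := searchDown_spec (fun j => e.eval E (σ.set x j)) (E.β i) (E.β i)
  refine ⟨h.1, fun j hj => ?_⟩
  have := h.2 j (by omega) hj
  simp only [Holds]
  omega

theorem find_le (x : Reg) (i : Par) (e : Expr) (E : Env) (σ : St) :
    (find x i e).eval E σ ≤ E.β i := searchDown_le _ _ _

@[simp] theorem holds_ex {x : Reg} {i : Par} {e : Expr} :
    (ex x i e).Holds E σ ↔ ∃ j < E.β i, e.Holds E (σ.set x j) := by
  have h := find_spec x i e E σ
  have hle := find_le x i e E σ
  rw [ex, holds_lt]
  refine ⟨fun hlt => ⟨_, hlt, h.1 hlt⟩, fun ⟨j, hj, hj'⟩ => ?_⟩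
  by_contra hc
  exact h.2 j (lt_of_lt_of_le hj (not_lt.1 hc)) hj'

@[simp] theorem holds_all {x : Reg} {i : Par} {e : Expr} :
    (all x i e).Holds E σ ↔ ∀ j < E.β i, e.Holds E (σ.set x j) := by
  rw [all, holds_not, holds_ex]
  simp only [holds_not]
  push Not
  rfl

@[simp] theorem holds_get {a : Arr} {e : Expr} : (get a e).Holds E σ ↔ 0 < σ.a a (e.eval E σ) := Iff.rfl

@[simp] theorem holds_par {i : Par} : (par i).Holds E σ ↔ 0 < E.β i := Iff.rfl

@[simp] theorem holds_var {x : Reg} : (var x).Holds E σ ↔ 0 < σ.r x := Iff.rfl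

/-! ### Running times as monomials in the loop parameters -/

/-- How often searches bounded by a parameter are nested. -/
def deg (j : Par) : Expr → ℕ
  | bool _ => 0
  | var _ => 0
  | par _ => 0
  | get _ e => e.deg j
  | add e f => max (e.deg j) (f.deg j)
  | sub e f => max (e.deg j) (f.deg j)
  | ite e f g => max (e.deg j) (max (f.deg j) (g.deg j))
  | find _ i e => e.deg j + if i = j then 1 else 0

/-- The constant in the bound for the time. -/
def const : Expr → ℕ
  | bool _ => 1
  | var _ => 2
  | par _ => 2
  | get _ e => e.const + 9
  | add e f => e.const + f.const + 3
  | sub e f => e.const + f.const + 1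
  | ite e f g => e.const + f.const + g.const + 3
  | find _ _ e => e.const + 22

end Expr

/-- The product of the powers of the parameters, increased by one, with exponents `f`. -/
def Env.mon (E : Env) (f : Par → ℕ) : ℕ :=
  (E.β .n + 1) ^ f .n * (E.β .k + 1) ^ f .k * (E.β .lim + 1) ^ f .lim *
    (E.β .dim + 1) ^ f .dim * (E.β .tot + 1) ^ f .tot

theorem Env.mon_mono (E : Env) {f g : Par → ℕ} (h : ∀ i, f i ≤ g i) : E.mon f ≤ E.mon g := by
  unfold Env.mon
  have hp : ∀ i, (E.β i + 1) ^ f i ≤ (E.β i + 1) ^ g i := fun i =>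
    Nat.pow_le_pow_right (by omega) (h i)
  exact Nat.mul_le_mul (Nat.mul_le_mul (Nat.mul_le_mul (Nat.mul_le_mul (hp _) (hp _)) (hp _))
    (hp _)) (hp _)

theorem Env.mon_pos (E : Env) (f : Par → ℕ) : 1 ≤ E.mon f := by
  unfold Env.mon; exact Nat.succ_le_of_lt (by positivity)

theorem Env.mon_add (E : Env) (f : Par → ℕ) (i : Par) :
    E.mon (fun j => f j + if i = j then 1 else 0) = (E.β i + 1) * E.mon f := by
  unfold Env.mon
  cases i <;> simp only [reduceCtorEq, if_true, if_false, add_zero, pow_succ] <;> ring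

/-- Each parameter enters increased by one, so the monomials are positive and monotone in the
exponents. A search multiplies the time by its bound and raises one exponent. -/
theorem Expr.time_le (E : Env) (e : Expr) : e.time E ≤ e.const * E.mon fun j => e.deg j := by
  have key : ∀ (e' : Expr) (g : Par → ℕ), (∀ j, e'.deg j ≤ g j) →
      e'.time E ≤ e'.const * E.mon (fun j => e'.deg j) → e'.time E ≤ e'.const * E.mon g :=
    fun e' g hg h => h.trans (Nat.mul_le_mul_left _ (E.mon_mono hg))
  induction e with
  | bool b => have := E.mon_pos fun j => (bool b).deg j; simp only [time, const]; omega
  | var x => have := E.mon_pos fun j => (var x).deg j; simp only [time, const]; omega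
  | par i => have := E.mon_pos fun j => (par i).deg j; simp only [time, const]; omega
  | get a e ih =>
    have h := E.mon_pos fun j => (get a e).deg j
    simp only [time, const, add_mul]
    have : e.time E ≤ e.const * E.mon fun j => (get a e).deg j := ih
    omega
  | add e f ihe ihf =>
    have h := E.mon_pos fun j => (add e f).deg j
    have h1 := key e (fun j => (add e f).deg j) (fun j => le_max_left _ _) ihe
    have h2 := key f (fun j => (add e f).deg j) (fun j => le_max_right _ _) ihf
    simp only [time, const, add_mul]
    omega
  | sub e f ihe ihf =>
    have h := E.mon_pos fun j => (sub e f).deg j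
    have h1 := key e (fun j => (sub e f).deg j) (fun j => le_max_left _ _) ihe
    have h2 := key f (fun j => (sub e f).deg j) (fun j => le_max_right _ _) ihf
    simp only [time, const, add_mul]
    omega
  | ite e f g ihe ihf ihg =>
    have h := E.mon_pos fun j => (ite e f g).deg j
    have h1 := key e (fun j => (ite e f g).deg j) (fun j => le_max_left _ _) ihe
    have h2 := key f (fun j => (ite e f g).deg j)
      (fun j => (le_max_left _ _).trans (le_max_right _ _)) ihf
    have h3 := key g (fun j => (ite e f g).deg j)
      (fun j => (le_max_right _ _).trans (le_max_right _ _)) ihg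
    simp only [time, const, add_mul]
    omega
  | find x i e ih =>
    have h : (E.mon fun j => (find x i e).deg j) = (E.β i + 1) * E.mon fun j => e.deg j :=
      E.mon_add _ i
    rw [h]
    have h0 := E.mon_pos fun j => e.deg j
    simp only [time, const]
    generalize E.mon (fun j => e.deg j) = M at *
    calc E.β i * (e.time E + 11) + 11 ≤ E.β i * (e.const * M + 11 * M) + 11 * M := by
          gcongr <;> omega
      _ ≤ (e.const + 22) * ((E.β i + 1) * M) := by nlinarith

namespace Cmd

/-- How often loops bounded by a parameter are nested. -/
def deg (j : Par) : Cmd → ℕ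
  | skip => 0
  | set _ e => e.deg j
  | put _ e f => max (e.deg j) (f.deg j)
  | seq c d => max (c.deg j) (d.deg j)
  | ite e c d => max (e.deg j) (max (c.deg j) (d.deg j))
  | loop _ i c => c.deg j + if i = j then 1 else 0

/-- The constant in the bound for the time. -/
def const : Cmd → ℕ
  | skip => 0
  | set _ e => e.const + 2
  | put _ e f => e.const + f.const + 9
  | seq c d => c.const + d.const
  | ite e c d => e.const + c.const + d.const + 3
  | loop _ _ c => c.const + 14

theorem time_le (E : Env) (c : Cmd) : c.time E ≤ c.const * E.mon fun j => c.deg j := by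
  have keyE : ∀ (e : Expr) (g : Par → ℕ), (∀ j, e.deg j ≤ g j) → e.time E ≤ e.const * E.mon g :=
    fun e g hg => (e.time_le E).trans (Nat.mul_le_mul_left _ (E.mon_mono hg))
  have key : ∀ (c' : Cmd) (g : Par → ℕ), (∀ j, c'.deg j ≤ g j) →
      c'.time E ≤ c'.const * E.mon (fun j => c'.deg j) → c'.time E ≤ c'.const * E.mon g :=
    fun c' g hg h => h.trans (Nat.mul_le_mul_left _ (E.mon_mono hg))
  induction c with
  | skip => simp [time]
  | set x e =>
    have h := E.mon_pos fun j => (set x e).deg j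
    have h1 := keyE e (fun j => (set x e).deg j) fun j => le_rfl
    simp only [time, const, add_mul]
    omega
  | put a e f =>
    have h := E.mon_pos fun j => (put a e f).deg j
    have h1 := keyE e (fun j => (put a e f).deg j) fun j => le_max_left _ _
    have h2 := keyE f (fun j => (put a e f).deg j) fun j => le_max_right _ _
    simp only [time, const, add_mul]
    omega
  | seq c d hc hd =>
    have h1 := key c (fun j => (seq c d).deg j) (fun j => le_max_left _ _) hc
    have h2 := key d (fun j => (seq c d).deg j) (fun j => le_max_right _ _) hd
    simp only [time, const, add_mul]
    omega
  | ite e c d hc hd =>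
    have h := E.mon_pos fun j => (ite e c d).deg j
    have h1 := keyE e (fun j => (ite e c d).deg j) (fun j => le_max_left _ _)
    have h2 := key c (fun j => (ite e c d).deg j)
      (fun j => (le_max_left _ _).trans (le_max_right _ _)) hc
    have h3 := key d (fun j => (ite e c d).deg j)
      (fun j => (le_max_right _ _).trans (le_max_right _ _)) hd
    simp only [time, const, add_mul]
    omega
  | loop x i c ih =>
    have h : (E.mon fun j => (loop x i c).deg j) = (E.β i + 1) * E.mon fun j => c.deg j :=
      E.mon_add _ i
    rw [h]
    have h0 := E.mon_pos fun j => c.deg j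
    simp only [time, const]
    generalize E.mon (fun j => c.deg j) = M at *
    calc E.β i * (c.time E + 8) + 6 ≤ E.β i * (c.const * M + 8 * M) + 6 * M := by
          gcongr <;> omega
      _ ≤ (c.const + 14) * ((E.β i + 1) * M) := by nlinarith

/-! ### What a command leaves unchanged -/

/-- The variables that a command may change. -/
def regs : Cmd → List Reg
  | skip => []
  | set x _ => [x]
  | put _ _ _ => []
  | seq c d => c.regs ++ d.regs
  | ite _ c d => c.regs ++ d.regs
  | loop x _ c => x :: c.regs

/-- The arrays that a command may change. -/
def arrs : Cmd → List Arr
  | skip => []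
  | set _ _ => []
  | put a _ _ => [a]
  | seq c d => c.arrs ++ d.arrs
  | ite _ c d => c.arrs ++ d.arrs
  | loop _ _ c => c.arrs

/-- A syntactic frame rule: for concrete commands the hypothesis is settled by evaluating the list.
-/
theorem run_r (E : Env) {x : Reg} (c : Cmd) (h : x ∉ c.regs) (σ : St) :
    (c.run E σ).r x = σ.r x := by
  induction c generalizing σ with
  | skip => rfl
  | set y e => rw [run, St.set_r, if_neg (by simpa [regs] using h)]
  | put a e f => rfl
  | seq c d hc hd =>
    simp only [regs, List.mem_append, not_or] at h
    rw [run, hd h.2, hc h.1]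
  | ite e c d hc hd =>
    simp only [regs, List.mem_append, not_or] at h
    rw [run]; split_ifs
    exacts [hc h.1 σ, hd h.2 σ]
  | loop y i c hc =>
    simp only [regs, List.mem_cons, not_or] at h
    exact iter_inv (fun _ (s : St) => s.r x = σ.r x) rfl fun j _ s hs => by
      rw [hc h.2, St.set_r, if_neg h.1, hs]

theorem run_a (E : Env) {a : Arr} (c : Cmd) (h : a ∉ c.arrs) (σ : St) :
    (c.run E σ).a a = σ.a a := by
  induction c generalizing σ with
  | skip => rfl
  | set y e => rfl
  | put b e f => rw [run, St.put_a, if_neg (by simpa [arrs] using h)]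
  | seq c d hc hd =>
    simp only [arrs, List.mem_append, not_or] at h
    rw [run, hd h.2, hc h.1]
  | ite e c d hc hd =>
    simp only [arrs, List.mem_append, not_or] at h
    rw [run]; split_ifs
    exacts [hc h.1 σ, hd h.2 σ]
  | loop y i c hc =>
    exact iter_inv (fun _ (s : St) => s.a a = σ.a a) rfl fun j _ s hs => by
      rw [hc h, St.set_a, hs]

variable {E : Env} {σ : St}

@[simp] theorem run_seq (c d : Cmd) : (seq c d).run E σ = d.run E (c.run E σ) := rfl

@[simp] theorem run_set (x : Reg) (e : Expr) : (set x e).run E σ = σ.set x (e.eval E σ) := rfl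

@[simp] theorem run_put (a : Arr) (e f : Expr) :
    (put a e f).run E σ = σ.put a (e.eval E σ) (f.eval E σ) := rfl

@[simp] theorem run_skip : skip.run E σ = σ := rfl

theorem run_ite_pos {e : Expr} {c d : Cmd} (h : e.Holds E σ) : (ite e c d).run E σ = c.run E σ :=
  if_pos h

theorem run_ite_neg {e : Expr} {c d : Cmd} (h : ¬ e.Holds E σ) : (ite e c d).run E σ = d.run E σ :=
  if_neg h

theorem run_loop {x : Reg} {i : Par} {c : Cmd} (I : ℕ → St → Prop) (h₀ : I 0 σ)
    (h : ∀ j < E.β i, ∀ s, I j s → I (j + 1) (c.run E (s.set x j))) :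
    I (E.β i) ((loop x i c).run E σ) := iter_inv I h₀ h

end Cmd

end RAM

/-! ### The preparatory part of the algorithm -/

namespace RAM

infixr:60 ";;" => Cmd.seq

/-- Fill the array `a`, with the initial value `e` and the next value `f` of the variable `z`. -/
def tabulate (a : Arr) (i : Par) (e f : Expr) : Cmd :=
  .set .z e ;; .loop .u i (.put a (.var .u) (.var .z) ;; .set .z f)

theorem run_tabulate {E : Env} {σ : St} {a : Arr} {i : Par} {e f : Expr} (g : ℕ → ℕ)
    (h0 : e.eval E σ = g 0)
    (hs : ∀ j < E.β i, ∀ σ' : St, σ'.r .z = g j → f.eval E σ' = g (j + 1)) :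
    (∀ j < E.β i, ((tabulate a i e f).run E σ).a a j = g j) ∧
      ((tabulate a i e f).run E σ).r .z = g (E.β i) := by
  unfold tabulate
  rw [Cmd.run_seq, Cmd.run_set]
  refine Cmd.run_loop (fun l s => (∀ j < l, s.a a j = g j) ∧ s.r .z = g l) ?_ ?_
  · simp [h0]
  · rintro j hj s ⟨h1, h2⟩
    simp only [Cmd.run_seq, Cmd.run_put, Cmd.run_set, Expr.eval_var, St.set_r, St.set_a, St.put_a,
      if_true, reduceCtorEq, if_false]
    refine ⟨fun l hl => ?_, hs j hj _ (by simpa using h2)⟩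
    rw [Function.update_apply]
    split_ifs with h
    · rw [h, h2]
    · exact h1 l (by omega)

/-- The entry of the adjacency matrix. -/
def adjE (x y : Expr) : Expr := .get .adj (.add (.get .row x) y)

/-- The state holds the adjacency matrix of `A`. -/
structure AdjTable (E : Env) (A : ℕ → ℕ → Prop) (σ : St) : Prop where
  row : ∀ u < E.β .n, σ.a .row u = E.β .n * u
  adj : ∀ u < E.β .n, ∀ v < E.β .n, 0 < σ.a .adj (E.β .n * u + v) ↔ A u v
  cap : E.β .n * E.β .n ≤ E.V

theorem AdjTable.of_eq {E : Env} {A : ℕ → ℕ → Prop} {σ σ' : St} (h : AdjTable E A σ)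
    (h1 : σ'.a .row = σ.a .row) (h2 : σ'.a .adj = σ.a .adj) : AdjTable E A σ' :=
  ⟨h1 ▸ h.row, h2 ▸ h.adj, h.cap⟩

/-- The table of row addresses replaces a multiplication, and `cap` guarantees that the sum of
address and column is not truncated. -/
theorem AdjTable.holds {E : Env} {A : ℕ → ℕ → Prop} {σ σ' : St} (h : AdjTable E A σ) {x y : Expr}
    {u v : ℕ} (hx : x.eval E σ' = u) (hy : y.eval E σ' = v) (hu : u < E.β .n) (hv : v < E.β .n)
    (h1 : σ'.a .row = σ.a .row := by rfl) (h2 : σ'.a .adj = σ.a .adj := by rfl) :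
    (adjE x y).Holds E σ' ↔ A u v := by
  rw [← h.adj _ hu _ hv]
  have h3 : E.β .n * (u + 1) ≤ E.β .n * E.β .n := Nat.mul_le_mul_left _ hu
  have h4 := h.cap
  rw [mul_add, mul_one] at h3
  simp only [adjE, Expr.holds_get, Expr.eval_add, Expr.eval_get, hx, hy, h1, h2, h.row _ hu]
  rw [min_eq_left (by omega)]

/-! ### Depth-first search as a program -/

/-- Visit the unvisited neighbour `w` of the visited vertex `u`. -/
def visitChild : Cmd :=
  .put .par (.var .w) (.var .u) ;; .put .int (.var .u) .one ;;
  .put .dep (.var .w) (.sub .one (.get .dep (.var .u)))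

/-- Visit the vertex `w` as a root. -/
def visitRoot : Cmd := .put .root (.var .w) .one ;; .put .dep (.var .w) .zero

/-- The vertex that was visited `p + 1` visits ago. -/
def recent : Expr := .get .ord (.sub (.sub (.var .i) .one) (.var .p))

/-- A visit of the depth-first search. -/
def dfsStep : Cmd :=
  .set .p (.find .p .n (.and (.lt (.var .p) (.var .i))
    (.ex .w .n (.and (adjE recent (.var .w)) (.not (.get .vis (.var .w))))))) ;;
  .ite (.lt (.var .p) (.par .n))
    (.set .u recent ;;
      .set .w (.find .w .n (.and (adjE (.var .u) (.var .w)) (.not (.get .vis (.var .w))))) ;;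
      visitChild)
    (.set .w (.find .w .n (.not (.get .vis (.var .w)))) ;; visitRoot) ;;
  .put .vis (.var .w) .one ;; .put .ord (.var .i) (.var .w)

/-- The state holds the result of `i` visits of a depth-first search. -/
def St.Search (E : Env) (A : ℕ → ℕ → Prop) (σ : St) (i : ℕ) : Prop :=
  SearchState (E.β .n) A i (σ.a .vis) (σ.a .ord) (σ.a .int) (σ.a .par) (σ.a .dep) (σ.a .root)

/-- The variable `p` counts visits backwards, so the least hit of the search is the latest visited
vertex with an unvisited neighbour. If there is none, `find` returns `n` and a new root is opened.
-/
theorem search_dfsStep {E : Env} {A : ℕ → ℕ → Prop} {σ : St} {i : ℕ} (hG : IsGraphOn (E.β .n) A)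
    (hT : AdjTable E A σ) (hi : σ.r .i = i) (hin : i < E.β .n) (hS : σ.Search E A i) :
    (dfsStep.run E σ).Search E A (i + 1) := by
  have hord : ∀ q < i, σ.a .ord q < E.β .n := hS.lt
  unfold dfsStep
  rw [Cmd.run_seq, Cmd.run_set, Cmd.run_seq]
  have hspec := Expr.find_spec .p .n (.and (.lt (.var .p) (.var .i))
    (.ex .w .n (.and (adjE recent (.var .w)) (.not (.get .vis (.var .w)))))) E σ
  generalize (Expr.find .p .n _).eval E σ = p at hspec ⊢
  have hcond : ∀ j, (Expr.and (.lt (.var .p) (.var .i)) (.ex .w .n (.and (adjE recent (.var .w))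
      (.not (.get .vis (.var .w)))))).Holds E (σ.set .p j) ↔
      j < i ∧ ∃ w < E.β .n, A (σ.a .ord (i - 1 - j)) w ∧ σ.a .vis w = 0 := by
    intro j
    simp only [Expr.holds_and, Expr.holds_lt, Expr.eval_var, St.set_r, if_true, reduceCtorEq,
      if_false, hi, Expr.holds_ex]
    refine and_congr_right fun hj => exists_congr fun w => and_congr_right fun hw => ?_
    have hrec : recent.eval E ((σ.set .p j).set .w w) = σ.a .ord (i - 1 - j) := by
      simp [recent, hi]
    rw [hT.holds hrec (show _ = w by simp) (hord _ (by omega)) hw]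
    simp
  by_cases hp : p < E.β .n
  · obtain ⟨hpi, w', hw', hA', hv'⟩ := (hcond p).1 (hspec.1 hp)
    rw [Cmd.run_ite_pos (by simpa using hp)]
    simp only [Cmd.run_seq, Cmd.run_set]
    have hrec : recent.eval E (σ.set .p p) = σ.a .ord (i - 1 - p) := by simp [recent, hi]
    rw [hrec]
    have hu := hord (i - 1 - p) (by omega)
    have hspecw := Expr.find_spec .w .n (.and (adjE (.var .u) (.var .w))
      (.not (.get .vis (.var .w)))) E ((σ.set .p p).set .u (σ.a .ord (i - 1 - p)))
    have hex : (Expr.ex .w .n (.and (adjE (.var .u) (.var .w))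
      (.not (.get .vis (.var .w))))).Holds E ((σ.set .p p).set .u (σ.a .ord (i - 1 - p))) := by
      rw [Expr.holds_ex]
      exact ⟨w', hw', Expr.holds_and.2 ⟨(hT.holds (by simp) (by simp) hu hw').2 hA',
        by simpa using hv'⟩⟩
    rw [Expr.ex, Expr.holds_lt, Expr.eval_par] at hex
    generalize (Expr.find .w .n _).eval E _ = w at hspecw hex ⊢
    have hw := Expr.holds_and.1 (hspecw.1 hex)
    have hA := (hT.holds (by simp) (by simp) hu hex).1 hw.1
    have hv := hw.2
    simp only [Expr.eval_var, St.set_r, if_true, Expr.holds_not,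
      Expr.holds_get, St.set_a, not_lt, Nat.le_zero] at hv
    have := SearchState.visit_child hS (p := i - 1 - p) (w := w) (by omega) hex hA hv ?_
    · simpa [St.Search, visitChild, hi] using this
    · intro q hq hqi y hy
      by_contra hvy
      have hpq : i - 1 - (i - 1 - q) = q := by omega
      refine hspec.2 (i - 1 - q) (by omega) ((hcond _).2 ⟨by omega, y, hG.lt_right hy, ?_, by omega⟩)
      rwa [hpq]
  · rw [Cmd.run_ite_neg (by simpa using hp)]
    simp only [Cmd.run_seq, Cmd.run_set]
    have hspecw := Expr.find_spec .w .n (.not (.get .vis (.var .w))) E (σ.set .p p)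
    have hex : (Expr.ex .w .n (.not (.get .vis (.var .w)))).Holds E (σ.set .p p) := by
      rw [Expr.holds_ex]
      obtain ⟨w, hw, hv⟩ := hS.exists_unvisited hin
      exact ⟨w, hw, by simpa using hv⟩
    rw [Expr.ex, Expr.holds_lt, Expr.eval_par] at hex
    generalize (Expr.find .w .n _).eval E _ = w at hspecw hex ⊢
    have hw := hspecw.1 hex
    simp only [Expr.eval_var, St.set_r, if_true, Expr.holds_not,
      Expr.holds_get, St.set_a, not_lt, Nat.le_zero] at hw
    have := SearchState.visit_root hS (w := w) hex hw ?_
    · simpa [St.Search, visitRoot, hi] using this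
    · intro q hq y hy
      by_contra hvy
      have hpq : i - 1 - (i - 1 - q) = q := by omega
      refine hspec.2 (i - 1 - q) (by omega) ((hcond _).2 ⟨by omega, y, hG.lt_right hy, ?_, by omega⟩)
      rwa [hpq]

/-- Depth-first search. -/
def dfs : Cmd := .loop .i .n dfsStep

theorem search_dfs {E : Env} {A : ℕ → ℕ → Prop} {σ : St} (hG : IsGraphOn (E.β .n) A)
    (hT : AdjTable E A σ) (hS : σ.Search E A 0) : (dfs.run E σ).Search E A (E.β .n) := by
  refine (Cmd.run_loop (fun i s => AdjTable E A s ∧ s.Search E A i) ⟨hT, hS⟩ ?_).2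
  rintro i hi s ⟨h1, h2⟩
  refine ⟨h1.of_eq ?_ ?_, search_dfsStep hG (h1.of_eq rfl rfl) (by simp) hi h2⟩
  · rw [Cmd.run_a _ _ (by decide)]; rfl
  · rw [Cmd.run_a _ _ (by decide)]; rfl

/-! ### Counting the interior vertices -/

/-- Count the interior vertices by the parity of their depth, and the interior roots. -/
def countCmd : Cmd :=
  .set .ev .zero ;; .set .od .zero ;; .set .ro .zero ;;
  .loop .u .n (.ite (.get .int (.var .u))
    (.ite (.get .dep (.var .u)) (.set .od (.add (.var .od) .one))
      (.set .ev (.add (.var .ev) .one)) ;;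
    .ite (.get .root (.var .u)) (.set .ro (.add (.var .ro) .one)) .skip) .skip) ;;
  .set .ns (.add (.add (.var .ev) (.var .od)) (.var .ro))

theorem run_countCmd {E : Env} {σ : St} (hV : 2 * E.β .n ≤ E.V) :
    (countCmd.run E σ).r .ev =
      ((Finset.range (E.β .n)).filter fun u => 0 < σ.a .int u ∧ σ.a .dep u = 0).card ∧
    (countCmd.run E σ).r .od =
      ((Finset.range (E.β .n)).filter fun u => 0 < σ.a .int u ∧ 0 < σ.a .dep u).card ∧
    (countCmd.run E σ).r .ro =
      ((Finset.range (E.β .n)).filter fun u => 0 < σ.a .int u ∧ 0 < σ.a .root u).card ∧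
    (countCmd.run E σ).r .ns = (countCmd.run E σ).r .ev + (countCmd.run E σ).r .od +
      (countCmd.run E σ).r .ro := by
  have hsucc : ∀ (P : ℕ → Prop) [DecidablePred P] (j : ℕ),
      ((Finset.range (j + 1)).filter P).card =
        ((Finset.range j).filter P).card + if P j then 1 else 0 := fun P _ j => by
    rw [Finset.card_filter, Finset.card_filter, Finset.sum_range_succ]
  have hle : ∀ (P : ℕ → Prop) [DecidablePred P] (j : ℕ),
      ((Finset.range j).filter P).card ≤ j := fun P _ j => by
    simpa using Finset.card_filter_le (Finset.range j) P
  -- The two parity classes are disjoint, so the three counts sum to at most `2 * n`, and the last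
  -- addition is exact too.
  have hdisj : ∀ j, ((Finset.range j).filter fun u => 0 < σ.a .int u ∧ σ.a .dep u = 0).card +
      ((Finset.range j).filter fun u => 0 < σ.a .int u ∧ 0 < σ.a .dep u).card ≤ j := by
    intro j
    induction j with
    | zero => simp
    | succ j ih =>
      rw [hsucc, hsucc]
      split_ifs <;> omega
  unfold countCmd
  simp only [Cmd.run_seq (E := E), Cmd.run_set]
  generalize hσ' : Cmd.run E (.loop .u .n _) _ = σ'
  have key : σ'.a = σ.a ∧
      σ'.r .ev = ((Finset.range (E.β .n)).filter fun u => 0 < σ.a .int u ∧ σ.a .dep u = 0).card ∧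
      σ'.r .od = ((Finset.range (E.β .n)).filter fun u => 0 < σ.a .int u ∧ 0 < σ.a .dep u).card ∧
      σ'.r .ro =
        ((Finset.range (E.β .n)).filter fun u => 0 < σ.a .int u ∧ 0 < σ.a .root u).card := by
    rw [← hσ']
    refine Cmd.run_loop (fun j s => s.a = σ.a ∧
      s.r .ev = ((Finset.range j).filter fun u => 0 < σ.a .int u ∧ σ.a .dep u = 0).card ∧
      s.r .od = ((Finset.range j).filter fun u => 0 < σ.a .int u ∧ 0 < σ.a .dep u).card ∧
      s.r .ro = ((Finset.range j).filter fun u => 0 < σ.a .int u ∧ 0 < σ.a .root u).card) ?_ ?_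
    · simp
    · rintro j hj s ⟨h1, h2, h3, h4⟩
      rw [hsucc, hsucc, hsucc, ← h2, ← h3, ← h4]
      have e2 := hle (fun u => 0 < σ.a .int u ∧ σ.a .dep u = 0) j
      have e3 := hle (fun u => 0 < σ.a .int u ∧ 0 < σ.a .dep u) j
      have e4 := hle (fun u => 0 < σ.a .int u ∧ 0 < σ.a .root u) j
      rw [← h2] at e2
      rw [← h3] at e3
      rw [← h4] at e4
      by_cases c1 : 0 < σ.a .int j
      · rw [Cmd.run_ite_pos (by simpa [h1] using c1), Cmd.run_seq]
        by_cases c2 : 0 < σ.a .dep j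
        · rw [Cmd.run_ite_pos (σ := s.set .u j) (by simpa [h1] using c2)]
          by_cases c3 : 0 < σ.a .root j
          · rw [Cmd.run_ite_pos (by simpa [h1] using c3)]
            simp [h1, c1, c2, c3, c2.ne']
            omega
          · rw [Cmd.run_ite_neg (by simpa [h1] using c3)]
            simp [h1, c1, c2, c3, c2.ne']
            omega
        · rw [Cmd.run_ite_neg (σ := s.set .u j) (by simpa [h1] using c2)]
          have c2' : σ.a .dep j = 0 := by omega
          by_cases c3 : 0 < σ.a .root j
          · rw [Cmd.run_ite_pos (by simpa [h1] using c3)]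
            simp [h1, c1, c2', c3]
            omega
          · rw [Cmd.run_ite_neg (by simpa [h1] using c3)]
            simp [h1, c1, c2', c3]
            omega
      · rw [Cmd.run_ite_neg (by simpa [h1] using c1)]
        simp [h1, c1, h2, h3, h4]
  obtain ⟨k1, k2, k3, k4⟩ := key
  simp only [St.set_r, reduceCtorEq, if_false, if_true, Expr.eval_add, Expr.eval_var]
  refine ⟨k2, k3, k4, ?_⟩
  have e1 := hdisj (E.β .n)
  have e4 := hle (fun u => 0 < σ.a .int u ∧ 0 < σ.a .root u) (E.β .n)
  rw [← k2, ← k3] at e1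
  rw [← k4] at e4
  omega

/-! ### The table of weights -/

/-- The index of the entry in row `i` and column `j` of a table. -/
def cellE (i j : Expr) : Expr := .add (.get .off i) j

/-- Compute the next row of the table of weights in the column `j`. -/
def weightCell : Cmd :=
  .set .t .zero ;;
  .loop .l .lim (.ite (.lt (.var .l) (.var .j))
    (.set .t (.add (.var .t) (.get .wt (cellE (.var .i) (.var .j))))) .skip) ;;
  .ite (.var .j) (.set .t (.add (.var .t) (.get .wt (cellE (.var .i) (.sub (.var .j) .one)))))
    .skip ;;
  .put .ht (cellE (.var .i) (.var .j)) (.var .t) ;;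
  .put .wt (.add (cellE (.var .i) (.par .lim)) (.var .j)) (.add (.var .t) (.var .t))

/-- The table of weights. -/
def weightTable : Cmd :=
  .put .wt .zero .one ;; .loop .i .lim (.loop .j .lim weightCell)

/-- The bounds for the parameters that are needed in order that additions are exact. -/
structure Env.Cap (E : Env) : Prop where
  lim : E.β .lim = 2 * E.β .n + 2
  k_le : E.β .k ≤ 2 * E.β .n + 1
  pow_le : 2 ^ (8 * (51 + E.β .n * E.β .n)) ≤ E.V

theorem Env.Cap.le {E : Env} (h : E.Cap) {m : ℕ} (hm : m ≤ 8 * (51 + E.β .n * E.β .n)) :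
    m ≤ E.V :=
  (hm.trans (Nat.lt_two_pow_self).le).trans h.pow_le

theorem Env.Cap.two_pow_le {E : Env} (h : E.Cap) {m : ℕ} (hm : m ≤ 8 * (51 + E.β .n * E.β .n)) :
    2 ^ m ≤ E.V :=
  (Nat.pow_le_pow_right (by norm_num) hm).trans h.pow_le

/-- For j < 2n + 2 the base 2(j + 1) is at most 2^(n+2), and i ≤ 2n + 2 gives an exponent
(n+2)(2n+2), which the exponent of the cap dominates. -/
theorem Env.Cap.weight_le {E : Env} (h : E.Cap) {i j : ℕ} (hi : i ≤ E.β .lim)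
    (hj : j < E.β .lim) : weight i j ≤ E.V := by
  have hl := h.lim
  generalize hn : E.β .n = n at *
  have h1 : 2 * (j + 1) ≤ 2 ^ (n + 2) := by
    have : n < 2 ^ n := Nat.lt_two_pow_self
    rw [pow_add]
    omega
  calc weight i j ≤ (2 * (j + 1)) ^ i := _root_.weight_le i j
    _ ≤ (2 ^ (n + 2)) ^ i := Nat.pow_le_pow_left h1 i
    _ = 2 ^ ((n + 2) * i) := (pow_mul ..).symm
    _ ≤ E.V := h.two_pow_le (by rw [hn]; nlinarith)

theorem Env.Cap.cell_le {E : Env} (h : E.Cap) {i j : ℕ} (hi : i ≤ E.β .lim)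
    (hj : j ≤ E.β .lim) : E.β .lim * i + E.β .lim + j ≤ E.V := by
  refine h.le ?_
  have hl := h.lim
  generalize E.β .n = n at *
  rw [hl] at hi hj ⊢
  have := Nat.mul_le_mul_left (2 * n + 2) hi
  nlinarith [sq_nonneg ((n : ℤ) - 2)]

theorem cell_inj {m a b c d : ℕ} (hb : b < m) (hd : d < m) (h : m * a + b = m * c + d) :
    a = c ∧ b = d := by
  have h1 := congrArg (· / m) h
  simp only [Nat.mul_add_div (show 0 < m by omega), Nat.div_eq_of_lt hb, Nat.div_eq_of_lt hd] at h1
  obtain rfl : a = c := by omega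
  exact ⟨rfl, by omega⟩

/-- The array `off` holds the addresses of the rows of the tables. -/
def OffTable (E : Env) (σ : St) : Prop := ∀ u < E.β .lim, σ.a .off u = E.β .lim * u

theorem eval_cellE {E : Env} {σ : St} (hE : E.Cap) (ho : OffTable E σ) {x y : Expr} {i j : ℕ}
    (hx : x.eval E σ = i) (hy : y.eval E σ = j) (hi : i < E.β .lim) (hj : j ≤ E.β .lim) :
    (cellE x y).eval E σ = E.β .lim * i + j := by
  have := hE.cell_le hi.le hj
  simp only [cellE, Expr.eval_add, Expr.eval_get, hx, hy, ho i hi]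
  omega

/-- Multiplication by `j` is done by `lim` rounds of which the first `j` add the weight. All partial
sums are at most `halfWeight i j`, so none is truncated. -/
theorem run_weightCell {E : Env} {σ : St} (hE : E.Cap) (ho : OffTable E σ) {i j : ℕ}
    (hi : σ.r .i = i) (hj : σ.r .j = j) (hi' : i < E.β .lim) (hj' : j < E.β .lim)
    (hw : ∀ l < E.β .lim, σ.a .wt (E.β .lim * i + l) = weight i l) :
    (weightCell.run E σ).a .ht = Function.update (σ.a .ht) (E.β .lim * i + j) (halfWeight i j) ∧
    (weightCell.run E σ).a .wt =
      Function.update (σ.a .wt) (E.β .lim * (i + 1) + j) (weight (i + 1) j) := by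
  have hcap := hE.weight_le (i := i + 1) hi' hj'
  rw [weight_succ] at hcap
  have hjw : j * weight i j ≤ halfWeight i j := Nat.le_add_right _ _
  unfold weightCell
  rw [Cmd.run_seq, Cmd.run_set, Cmd.run_seq]
  generalize hσ₁ : Cmd.run E (.loop .l .lim _) _ = σ₁
  have h₁ : σ₁.a = σ.a ∧ σ₁.r .i = i ∧ σ₁.r .j = j ∧ σ₁.r .t = j * weight i j := by
    rw [← hσ₁]
    have := Cmd.run_loop (E := E) (x := .l) (i := .lim) (σ := σ.set .t (Expr.zero.eval E σ))
      (c := .ite (.lt (.var .l) (.var .j))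
        (.set .t (.add (.var .t) (.get .wt (cellE (.var .i) (.var .j))))) .skip)
      (fun l s => s.a = σ.a ∧ s.r .i = i ∧ s.r .j = j ∧ s.r .t = min l j * weight i j) (by
        simp [hi, hj]) (by
        rintro l hl s ⟨e1, e2, e3, e4⟩
        by_cases hlj : l < j
        · have hc : (cellE (.var .i) (.var .j)).eval E (s.set .l l) = E.β .lim * i + j :=
            eval_cellE hE (fun u hu => by rw [St.set_a, e1]; exact ho u hu) (by simpa using e2)
              (by simpa using e3) hi' hj'.le
          rw [Cmd.run_ite_pos (by simpa [e3] using hlj)]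
          simp only [Cmd.run_set, Expr.eval_add, Expr.eval_var, Expr.eval_get, hc, St.set_r,
            St.set_a, reduceCtorEq, if_false, if_true, e1, e2, e3, e4, hw j hj', true_and]
          have h1 : min l j = l := by omega
          have h2 : min (l + 1) j = l + 1 := by omega
          have h3 : (l + 1) * weight i j ≤ j * weight i j := Nat.mul_le_mul_right _ hlj
          rw [h1, h2]
          rw [add_mul, one_mul] at h3 ⊢
          omega
        · rw [Cmd.run_ite_neg (by simpa [e3] using hlj)]
          have h1 : min l j = j := by omega
          have h2 : min (l + 1) j = j := by omega
          simp [e1, e2, e3, e4, h1, h2])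
    rw [min_eq_right hj'.le] at this
    exact this
  clear hσ₁
  obtain ⟨e1, e2, e3, e4⟩ := h₁
  have ho₁ : OffTable E σ₁ := fun u hu => by rw [e1]; exact ho u hu
  rw [Cmd.run_seq]
  generalize hσ₂ : Cmd.run E (.ite _ _ _) σ₁ = σ₂
  have h₂ : σ₂.a = σ.a ∧ σ₂.r .i = i ∧ σ₂.r .j = j ∧ σ₂.r .t = halfWeight i j := by
    rw [← hσ₂]
    by_cases hj0 : 0 < j
    · rw [Cmd.run_ite_pos (by simpa [e3] using hj0)]
      have hc : (cellE (.var .i) (.sub (.var .j) .one)).eval E σ₁ = E.β .lim * i + (j - 1) :=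
        eval_cellE hE ho₁ (by simpa using e2) (by simp [e3]) hi' (by omega)
      have hh : halfWeight i j = j * weight i j + weight i (j - 1) := by
        rw [halfWeight, if_neg hj0.ne']
      simp only [Cmd.run_set, Expr.eval_add, Expr.eval_var, Expr.eval_get, hc, St.set_r,
        St.set_a, reduceCtorEq, if_false, if_true, e1, e2, e3, e4, hw (j - 1) (by omega), true_and]
      omega
    · rw [Cmd.run_ite_neg (by simpa [e3] using hj0)]
      obtain rfl : j = 0 := by omega
      simp [e1, e2, e3, e4, halfWeight]
  clear hσ₂
  obtain ⟨f1, f2, f3, f4⟩ := h₂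
  have ho₂ : OffTable E σ₂ := fun u hu => by rw [f1]; exact ho u hu
  have hc := eval_cellE hE ho₂ (x := .var .i) (y := .var .j) f2 f3 hi' hj'.le
  have hc' : (cellE (.var .i) (.par .lim)).eval E (σ₂.put .ht (E.β .lim * i + j) (σ₂.r .t)) =
      E.β .lim * i + E.β .lim :=
    eval_cellE hE (fun u hu => by simpa using ho₂ u hu) (by simpa using f2) rfl hi' le_rfl
  rw [f4] at hc'
  have hle := hE.cell_le hi'.le hj'.le
  simp only [Cmd.run_seq, Cmd.run_put, Expr.eval_add, Expr.eval_var, hc, hc', St.put_a, St.put_r,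
    reduceCtorEq, if_true, if_false, f1, f3, f4, true_and]
  rw [min_eq_left hle, min_eq_left (by omega), weight_succ, two_mul, mul_add, mul_one]

/-- The round for row `i` reads this row and writes row `i + 1` of the weights, so they reach one
row further than the half weights. By `cell_inj` different entries never share a cell. -/
theorem run_weightTable {E : Env} {σ : St} (hE : E.Cap) (ho : OffTable E σ)
    (h0 : ∀ i, σ.a .wt i = 0) : (∀ i ≤ E.β .lim, ∀ j < E.β .lim,
      (weightTable.run E σ).a .wt (E.β .lim * i + j) = weight i j) ∧
    ∀ i < E.β .lim, ∀ j < E.β .lim,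
      (weightTable.run E σ).a .ht (E.β .lim * i + j) = halfWeight i j := by
  unfold weightTable
  rw [Cmd.run_seq, Cmd.run_put]
  have := Cmd.run_loop (E := E) (x := .i) (i := .lim) (c := .loop .j .lim weightCell)
    (σ := σ.put .wt (Expr.zero.eval E σ) (Expr.one.eval E σ))
    (fun i s => OffTable E s ∧ (∀ i' ≤ i, ∀ j < E.β .lim,
        s.a .wt (E.β .lim * i' + j) = weight i' j) ∧
      ∀ i' < i, ∀ j < E.β .lim, s.a .ht (E.β .lim * i' + j) = halfWeight i' j) ?_ ?_
  · exact this.2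
  · refine ⟨fun u hu => by simpa using ho u hu, fun i' hi' j hj => ?_, by simp⟩
    obtain rfl : i' = 0 := by omega
    simp only [St.put_a, if_true, Expr.eval_zero, Expr.eval_one, mul_zero, zero_add, weight,
      Function.update_apply, h0]
  · rintro i hi s ⟨s1, s2, s3⟩
    have := Cmd.run_loop (E := E) (x := .j) (i := .lim) (c := weightCell) (σ := s.set .i i)
      (fun j s => s.r .i = i ∧ OffTable E s ∧ (∀ i' ≤ i, ∀ j < E.β .lim,
          s.a .wt (E.β .lim * i' + j) = weight i' j) ∧
        (∀ i' < i, ∀ j < E.β .lim, s.a .ht (E.β .lim * i' + j) = halfWeight i' j) ∧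
        (∀ j' < j, s.a .wt (E.β .lim * (i + 1) + j') = weight (i + 1) j') ∧
        ∀ j' < j, s.a .ht (E.β .lim * i + j') = halfWeight i j')
      ⟨by simp, s1, s2, s3, by simp, by simp⟩ ?_
    · obtain ⟨-, t1, t2, t3, t4, t5⟩ := this
      refine ⟨t1, fun i' hi' j hj => ?_, fun i' hi' j hj => ?_⟩
      · rcases Nat.lt_or_ge i i' with h | h
        · obtain rfl : i' = i + 1 := by omega
          exact t4 j hj
        · exact t2 i' h j hj
      · rcases Nat.lt_succ_iff_lt_or_eq.1 hi' with h | rfl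
        · exact t3 i' h j hj
        · exact t5 j hj
    · rintro j hj s ⟨t0, t1, t2, t3, t4, t5⟩
      obtain ⟨w1, w2⟩ := run_weightCell (σ := s.set .j j) hE t1 (by simpa using t0) (by simp) hi hj
        (t2 i le_rfl)
      refine ⟨by rw [Cmd.run_r _ _ (by decide)]; simpa using t0, fun u hu => ?_,
        fun i' hi' l hl => ?_, fun i' hi' l hl => ?_, fun l hl => ?_, fun l hl => ?_⟩
      · rw [Cmd.run_a _ _ (by decide)]; exact t1 u hu
      · rw [w2, Function.update_of_ne]
        · exact t2 i' hi' l hl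
        · intro e; have := (cell_inj hl hj e).1; omega
      · rw [w1, Function.update_of_ne]
        · exact t3 i' hi' l hl
        · intro e; have := (cell_inj hl hj e).1; omega
      · rw [w2, Function.update_apply]
        split_ifs with e
        · rw [(cell_inj (by omega) hj e).2]
        · exact t4 l (lt_of_le_of_ne (by omega) fun h => e (by rw [h]))
      · rw [w1, Function.update_apply]
        split_ifs with e
        · rw [(cell_inj (by omega) hj e).2]
        · exact t5 l (lt_of_le_of_ne (by omega) fun h => e (by rw [h]))

/-! ### The easy cases and the number of trials -/

/-- Answer if this is easy, or set the number of sequences to be tried. -/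
def decideCmd : Cmd :=
  .set .res .zero ;; .set .tot .zero ;;
  .ite (.par .k)
    (.ite (.lt (.add (.par .n) (.par .n)) (.par .k)) .skip
      (.ite (.or (.le (.par .k) (.var .ev)) (.le (.par .k) (.add (.var .od) (.var .ro))))
        (.set .res .one) (.set .tot (.get .wt (cellE (.var .ns) (.par .k))))))
    (.ite (.add (.var .ev) (.var .od)) .skip (.set .res .one))

/-- Everything that comes before the trial of sequences. -/
def prepare : Cmd :=
  tabulate .row .n .zero (.add (.var .z) (.par .n)) ;;
  tabulate .off .lim .zero (.add (.var .z) (.par .lim)) ;;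
  tabulate .pw .k .one (.add (.var .z) (.var .z)) ;; .set .dim (.var .z) ;;
  dfs ;; countCmd ;; weightTable ;; decideCmd

/-- The state after the preparation. -/
structure Prepared (E : Env) (A : ℕ → ℕ → Prop) (σ : St) : Prop where
  adj : AdjTable E A σ
  off : OffTable E σ
  pw : ∀ i < E.β .k, σ.a .pw i = 2 ^ i
  forest : SearchForest (E.β .n) A (σ.a .ord) (σ.a .int) (σ.a .par) (σ.a .dep) (σ.a .root)
  wt : ∀ i < E.β .lim, ∀ j < E.β .lim, σ.a .wt (E.β .lim * i + j) = weight i j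
  ht : ∀ i < E.β .lim, ∀ j < E.β .lim, σ.a .ht (E.β .lim * i + j) = halfWeight i j
  ns : σ.r .ns = slot (σ.a .ord) (σ.a .int) (σ.a .root) (E.β .n)
  ns_lt : σ.r .ns < E.β .lim

/-- In the two decided cases the number of trials is zero, so that the main loop is empty and the
answer stands. In the third case the clipped value of `k` is `k` itself. -/
theorem run_prepare {E : Env} {A : ℕ → ℕ → Prop} {σ : St} {k : ℕ} (hE : E.Cap)
    (hG : IsGraphOn (E.β .n) A) (hk : E.β .k = min k (2 * E.β .n + 1))
    (hadj : ∀ u < E.β .n, ∀ v < E.β .n, 0 < σ.a .adj (E.β .n * u + v) ↔ A u v)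
    (h0 : ∀ a, a ≠ .adj → σ.a a = fun _ => 0) :
    let σ' := prepare.run E σ
    Prepared E A σ' ∧ σ'.r .dim = 2 ^ E.β .k ∧
      (σ'.r .res = 1 ∧ σ'.r .tot = 0 ∧ Colorable A k ∨
        σ'.r .res = 0 ∧ σ'.r .tot = 0 ∧ ¬ Colorable A k ∨
        σ'.r .res = 0 ∧ E.β .k = k ∧ σ'.r .ns ≤ 2 * k ∧ σ'.r .tot = weight (σ'.r .ns) k ∧
          k < E.β .lim) := by
  intro σ'
  have hl := hE.lim
  have hkl := hE.k_le
  have hnn : E.β .n * E.β .n ≤ E.V := hE.le (by omega)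
  have h2n : 2 * E.β .n ≤ E.V := hE.le (by nlinarith [sq_nonneg ((E.β .n : ℤ) - 1)])
  -- the tables of addresses and powers
  let σ₁ := (tabulate .row .n .zero (.add (.var .z) (.par .n))).run E σ
  have h₁ : ∀ j < E.β .n, σ₁.a .row j = E.β .n * j :=
    (run_tabulate (fun j => E.β .n * j) (by simp) fun j hj s hs => by
      have h3 : E.β .n * (j + 1) ≤ E.β .n * E.β .n := Nat.mul_le_mul_left _ hj
      simp only [Expr.eval_add, Expr.eval_var, Expr.eval_par, hs]
      rw [mul_add, mul_one] at h3 ⊢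
      omega).1
  let σ₂ := (tabulate .off .lim .zero (.add (.var .z) (.par .lim))).run E σ₁
  have h₂ : OffTable E σ₂ :=
    (run_tabulate (fun j => E.β .lim * j) (by simp) fun j hj s hs => by
      have h3 := hE.cell_le hj.le (Nat.zero_le _)
      simp only [Expr.eval_add, Expr.eval_var, Expr.eval_par, hs]
      rw [mul_add, mul_one]
      omega).1
  let σ₃ := (tabulate .pw .k .one (.add (.var .z) (.var .z))).run E σ₂
  have h₃ : (∀ j < E.β .k, σ₃.a .pw j = 2 ^ j) ∧ σ₃.r .z = 2 ^ E.β .k :=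
    run_tabulate (fun j => 2 ^ j) (by simp) fun j hj s hs => by
      have h3 : 2 ^ (j + 1) ≤ E.V :=
        hE.two_pow_le (by nlinarith [sq_nonneg ((E.β .n : ℤ) - 1)])
      simp only [Expr.eval_add, Expr.eval_var, hs]
      rw [pow_succ] at h3 ⊢
      omega
  let σ₄ := σ₃.set .dim (σ₃.r .z)
  have hrow : σ₄.a .row = σ₁.a .row := by
    simp only [σ₄, σ₃, σ₂, St.set_a]
    rw [Cmd.run_a _ _ (by decide), Cmd.run_a _ _ (by decide)]
  have hadj₄ : σ₄.a .adj = σ.a .adj := by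
    simp only [σ₄, σ₃, σ₂, σ₁, St.set_a]
    rw [Cmd.run_a _ _ (by decide), Cmd.run_a _ _ (by decide), Cmd.run_a _ _ (by decide)]
  have hz : ∀ a, a ≠ .adj → a ≠ .row → a ≠ .off → a ≠ .pw → σ₄.a a = fun _ => 0 := by
    intro a a1 a2 a3 a4
    simp only [σ₄, σ₃, σ₂, σ₁, St.set_a]
    rw [Cmd.run_a _ _ (by simpa [tabulate, Cmd.arrs] using a4),
      Cmd.run_a _ _ (by simpa [tabulate, Cmd.arrs] using a3),
      Cmd.run_a _ _ (by simpa [tabulate, Cmd.arrs] using a2), h0 a a1]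
  have hT₄ : AdjTable E A σ₄ := ⟨hrow ▸ h₁, hadj₄ ▸ hadj, hnn⟩
  -- the search
  let σ₅ := dfs.run E σ₄
  have hS₅ : σ₅.Search E A (E.β .n) := by
    refine search_dfs hG hT₄ ?_
    unfold St.Search
    rw [hz .vis (by decide) (by decide) (by decide) (by decide),
      hz .int (by decide) (by decide) (by decide) (by decide),
      hz .root (by decide) (by decide) (by decide) (by decide)]
    exact SearchState.start
  have hF₅ := hS₅.forest hG
  let σ₆ := countCmd.run E σ₅
  obtain ⟨c1, c2, c3, c4⟩ := run_countCmd (E := E) (σ := σ₅) h2n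
  change σ₆.r .ev = _ at c1
  change σ₆.r .od = _ at c2
  change σ₆.r .ro = _ at c3
  change σ₆.r .ns = σ₆.r .ev + σ₆.r .od + σ₆.r .ro at c4
  have hns : σ₆.r .ns = slot (σ₅.a .ord) (σ₅.a .int) (σ₅.a .root) (E.β .n) := by
    rw [hF₅.slot_eq, c4, c1, c2, c3]
  have hsum : σ₆.r .ev + σ₆.r .od + σ₆.r .ro ≤ 2 * E.β .n := by
    rw [← c4, hns, slot]
    refine (Finset.sum_le_card_nsmul _ _ 2 fun p _ => ?_).trans ?_
    · split_ifs <;> omega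
    · simp [mul_comm]
  let σ₇ := weightTable.run E σ₆
  have ho₆ : OffTable E σ₆ := by
    intro u hu
    simp only [σ₆, σ₅, σ₄, σ₃]
    rw [Cmd.run_a _ _ (by decide), Cmd.run_a _ _ (by decide), St.set_a, Cmd.run_a _ _ (by decide)]
    exact h₂ u hu
  obtain ⟨hwt, hht⟩ := run_weightTable (σ := σ₆) hE ho₆ (fun i => by
    simp only [σ₆, σ₅]
    rw [Cmd.run_a _ _ (by decide), Cmd.run_a _ _ (by decide),
      hz .wt (by decide) (by decide) (by decide) (by decide)])
  have hr₇ : ∀ x, x ∉ weightTable.regs → σ₇.r x = σ₆.r x := fun x hx => Cmd.run_r _ _ hx _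
  have hσ' : σ' = decideCmd.run E σ₇ := rfl
  have ha' : σ'.a = σ₇.a := funext fun a => by rw [hσ', Cmd.run_a _ _ (by simp [decideCmd, Cmd.arrs])]
  have ha₇ : ∀ a, a ≠ .wt → a ≠ .ht → σ₇.a a = σ₅.a a := fun a a1 a2 => by
    simp only [σ₇, σ₆]
    rw [Cmd.run_a _ _ (by simp [weightTable, weightCell, Cmd.arrs, a1, a2]),
      Cmd.run_a _ _ (by simp [countCmd, Cmd.arrs])]
  have hns' : σ'.r .ns = σ₆.r .ns := by
    rw [hσ', Cmd.run_r _ _ (by decide), hr₇ _ (by decide)]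
  have hofs : OffTable E σ₇ := fun u hu => by
    simp only [σ₇]; rw [Cmd.run_a _ _ (by decide)]; exact ho₆ u hu
  refine ⟨⟨?_, ?_, fun i hi => ?_, ?_, ?_, ?_, ?_, ?_⟩, ?_, ?_⟩
  · refine hT₄.of_eq ?_ ?_
    · rw [ha', ha₇ _ (by decide) (by decide)]; exact Cmd.run_a _ _ (by decide) _
    · rw [ha', ha₇ _ (by decide) (by decide)]; exact Cmd.run_a _ _ (by decide) _
  · exact fun u hu => by rw [ha']; exact hofs u hu
  · rw [ha', ha₇ _ (by decide) (by decide), ← h₃.1 i hi]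
    simp only [σ₅]
    rw [Cmd.run_a _ _ (by decide)]
    rfl
  · rw [ha', ha₇ _ (by decide) (by decide), ha₇ _ (by decide) (by decide),
      ha₇ _ (by decide) (by decide), ha₇ _ (by decide) (by decide), ha₇ _ (by decide) (by decide)]
    exact hF₅
  · rw [ha']; exact fun i hi => hwt i hi.le
  · rw [ha']; exact hht
  · rw [hns', hns, ha', ha₇ _ (by decide) (by decide), ha₇ _ (by decide) (by decide),
      ha₇ _ (by decide) (by decide)]
  · rw [hns', c4]; omega
  · rw [hσ', Cmd.run_r _ _ (by decide), hr₇ _ (by decide)]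
    simp only [σ₆, σ₅, σ₄]
    rw [Cmd.run_r _ _ (by decide), Cmd.run_r _ _ (by decide), ← h₃.2]
    simp
  · have e1 : σ₇.r .ev = σ₆.r .ev := hr₇ _ (by decide)
    have e2 : σ₇.r .od = σ₆.r .od := hr₇ _ (by decide)
    have e3 : σ₇.r .ro = σ₆.r .ro := hr₇ _ (by decide)
    have e4 : σ₇.r .ns = σ₆.r .ns := hr₇ _ (by decide)
    rw [hns', hσ']
    unfold decideCmd
    simp only [Cmd.run_seq, Cmd.run_set, Expr.eval_zero]
    by_cases hk0 : 0 < E.β .k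
    · rw [Cmd.run_ite_pos (by simpa using hk0)]
      by_cases hk1 : 2 * E.β .n < E.β .k
      · rw [Cmd.run_ite_pos (by simp only [Expr.holds_lt, Expr.eval_add, Expr.eval_par]; omega)]
        -- If even the clipped value exceeds `2 * n`, then so does `k`, and there are not enough
        -- vertices for that many colours.
        refine Or.inr (Or.inl ⟨by simp, by simp, fun hc => ?_⟩)
        have := hc.le hG
        omega
      · rw [Cmd.run_ite_neg (by simp only [Expr.holds_lt, Expr.eval_add, Expr.eval_par]; omega)]
        have hkk : E.β .k = k := by omega
        rw [hkk] at hk0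
        have hadd : min (σ₆.r .od + σ₆.r .ro) E.V = σ₆.r .od + σ₆.r .ro := by omega
        by_cases hk2 : k ≤ σ₆.r .ev ∨ k ≤ σ₆.r .od + σ₆.r .ro
        · rw [Cmd.run_ite_pos (by simpa [e1, e2, e3, hkk, hadd] using hk2)]
          refine Or.inl ⟨by simp, by simp, ?_⟩
          rcases hk2 with h | h
          · exact hF₅.colorable_of_le_even hG hk0 (c1 ▸ h)
          · exact hF₅.colorable_of_le_odd hG hk0 (by rwa [← c2, ← c3])
        · rw [Cmd.run_ite_neg (by simpa [e1, e2, e3, hkk, hadd] using hk2)]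
          -- Both easy tests have failed, so ev < k and od + ro < k, which yields the bound `2 * k`
          -- on the number of slots.
          refine Or.inr (Or.inr ⟨by simp, hkk, by omega, ?_, by omega⟩)
          have hc : (cellE (.var .ns) (.par .k)).eval E ((σ₇.set .res 0).set .tot 0) =
              E.β .lim * σ₆.r .ns + k :=
            eval_cellE (σ := (σ₇.set .res 0).set .tot 0) hE hofs (by simpa using e4) (by simpa using hkk) (by omega) (by omega)
          simp only [Cmd.run_set, Expr.eval_get, hc, St.set_r, if_true, St.set_a]
          exact hwt _ (by omega) _ (by omega)
    · rw [Cmd.run_ite_neg (by simpa using hk0)]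
      obtain rfl : k = 0 := by omega
      have hadd : min (σ₆.r .ev + σ₆.r .od) E.V = σ₆.r .ev + σ₆.r .od := by omega
      rw [colorable_zero]
      -- For k = 0 the question is whether there are edges: an interior vertex has an edge to a
      -- child, and every edge has an interior end.
      by_cases hz0 : 0 < σ₆.r .ev + σ₆.r .od
      · rw [Cmd.run_ite_pos (by
          simp only [Expr.Holds, Expr.eval_add, Expr.eval_var, St.set_r, reduceCtorEq, if_false, e1,
            e2]
          omega)]
        refine Or.inr (Or.inl ⟨by simp, by simp, fun hno => ?_⟩)
        have hu : ∃ u, 0 < σ₅.a .int u := by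
          rcases Nat.eq_zero_or_pos (σ₆.r .ev) with h | h
          · rw [h, zero_add, c2, Finset.card_pos] at hz0
            obtain ⟨u, hu⟩ := hz0
            exact ⟨u, (Finset.mem_filter.1 hu).2.1⟩
          · rw [gt_iff_lt, c1, Finset.card_pos] at h
            obtain ⟨u, hu⟩ := h
            exact ⟨u, (Finset.mem_filter.1 hu).2.1⟩
        obtain ⟨u, hu⟩ := hu
        obtain ⟨w, hw, -⟩ := hF₅.exists_child hu
        exact hno u w hw
      · rw [Cmd.run_ite_neg (by
          simp only [Expr.Holds, Expr.eval_add, Expr.eval_var, St.set_r, reduceCtorEq, if_false, e1,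
            e2]
          omega)]
        refine Or.inl ⟨by simp, by simp, fun u v hA => ?_⟩
        have hno : ∀ u < E.β .n, ¬ 0 < σ₅.a .int u := by
          intro u hu hi
          have h1 := Finset.card_eq_zero.1 (c1.symm.trans (show σ₆.r .ev = 0 by omega))
          have h2 := Finset.card_eq_zero.1 (c2.symm.trans (show σ₆.r .od = 0 by omega))
          rcases Nat.eq_zero_or_pos (σ₅.a .dep u) with h | h
          · exact (Finset.filter_eq_empty_iff.1 h1) (Finset.mem_range.2 hu) ⟨hi, h⟩
          · exact (Finset.filter_eq_empty_iff.1 h2) (Finset.mem_range.2 hu) ⟨hi, h⟩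
        rcases hF₅.cover u v hA with h | h
        · exact hno u (hG.lt hA) h
        · exact hno v (hG.lt_right hA) h

end RAM

/-! ### Trying the sequences -/

namespace RAM

/-- The weight for the current row and column. -/
def wtE : Expr := .get .wt (cellE (.var .i) (.var .j))

/-- The half weight for the current row and column. -/
def htE : Expr := .get .ht (cellE (.var .i) (.var .j))

/-- Determine a bit from the rank. -/
def unrankBit : Cmd :=
  .put .bit (.var .i) .zero ;;
  .ite (.le htE (.var .r)) (.put .bit (.var .i) .one ;; .set .r (.sub (.var .r) htE)) .skip

/-- Divide the rank by the weight. -/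
def unrankDiv : Cmd :=
  .set .d .zero ;;
  .loop .l .lim (.ite (.and (.lt (.var .d) (.var .j)) (.le wtE (.var .r)))
    (.set .r (.sub (.var .r) wtE) ;; .set .d (.add (.var .d) .one)) .skip)

/-- Determine a term of the sequence. -/
def unrankVal : Cmd :=
  .ite (.lt (.var .d) (.var .j)) (.put .val (.var .i) (.var .d))
    (.put .val (.var .i) (.sub (.var .j) .one) ;; .set .j (.sub (.var .j) .one))

/-- Determine the sequences of rank `g`. -/
def unrank : Cmd :=
  .set .r (.var .g) ;; .set .j (.par .k) ;;
  .loop .p .lim (.set .i (.sub (.sub (.par .lim) .one) (.var .p)) ;;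
    .ite (.lt (.var .i) (.var .ns)) (unrankBit ;; unrankDiv ;; unrankVal) .skip)

/-- The tables of weights. -/
structure WeightTables (E : Env) (σ : St) : Prop where
  off : OffTable E σ
  wt : ∀ i < E.β .lim, ∀ j < E.β .lim, σ.a .wt (E.β .lim * i + j) = weight i j
  ht : ∀ i < E.β .lim, ∀ j < E.β .lim, σ.a .ht (E.β .lim * i + j) = halfWeight i j

theorem WeightTables.of_eq {E : Env} {σ σ' : St} (h : WeightTables E σ)
    (h1 : σ'.a .off = σ.a .off) (h2 : σ'.a .wt = σ.a .wt) (h3 : σ'.a .ht = σ.a .ht) :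
    WeightTables E σ' :=
  ⟨fun u hu => by rw [h1]; exact h.off u hu, h2 ▸ h.wt, h3 ▸ h.ht⟩

theorem WeightTables.eval_wtE {E : Env} {σ : St} (hE : E.Cap) (h : WeightTables E σ) {i j : ℕ}
    (hi : σ.r .i = i) (hj : σ.r .j = j) (hi' : i < E.β .lim) (hj' : j < E.β .lim) :
    wtE.eval E σ = weight i j := by
  rw [wtE, Expr.eval_get, eval_cellE hE h.off (x := .var .i) (y := .var .j) hi hj hi' hj'.le, h.wt i hi' j hj']

theorem WeightTables.eval_htE {E : Env} {σ : St} (hE : E.Cap) (h : WeightTables E σ) {i j : ℕ}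
    (hi : σ.r .i = i) (hj : σ.r .j = j) (hi' : i < E.β .lim) (hj' : j < E.β .lim) :
    htE.eval E σ = halfWeight i j := by
  rw [htE, Expr.eval_get, eval_cellE hE h.off (x := .var .i) (y := .var .j) hi hj hi' hj'.le, h.ht i hi' j hj']

theorem run_unrankBit {E : Env} {σ : St} (hE : E.Cap) (h : WeightTables E σ) {i j b r : ℕ}
    (hi : σ.r .i = i) (hj : σ.r .j = j) (hi' : i < E.β .lim) (hj' : j < E.β .lim) (hb : b ≤ 1)
    (hr : r < halfWeight i j) (hσ : σ.r .r = b * halfWeight i j + r) :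
    (unrankBit.run E σ).r .r = r ∧ (unrankBit.run E σ).a .bit = Function.update (σ.a .bit) i b := by
  have h1 : htE.eval E (σ.put .bit i 0) = halfWeight i j :=
    WeightTables.eval_htE hE (h.of_eq rfl rfl rfl) hi hj hi' hj'
  have h2 : htE.eval E ((σ.put .bit i 0).put .bit i 1) = halfWeight i j :=
    WeightTables.eval_htE hE (h.of_eq rfl rfl rfl) hi hj hi' hj'
  unfold unrankBit
  simp only [Cmd.run_seq, Cmd.run_put, Expr.eval_var, Expr.eval_zero, hi]
  obtain rfl | rfl : b = 0 ∨ b = 1 := by omega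
  · rw [Cmd.run_ite_neg (by simp [h1, hσ, hr])]
    simp [hσ]
  · rw [Cmd.run_ite_pos (by simp [h1, hσ])]
    simp [hi, h2, hσ]

/-- Division by repeated subtraction, with the quotient capped at `j`. The cap matters: `j` stands
for a new value, and the remainder may then exceed `weight i j`, since that block has length `weight
i (j - 1)`. -/
theorem run_unrankDiv {E : Env} {σ : St} (hE : E.Cap) (h : WeightTables E σ) {i j d r : ℕ}
    (hi : σ.r .i = i) (hj : σ.r .j = j) (hi' : i < E.β .lim) (hj' : j < E.β .lim) (hd : d ≤ j)
    (hr : d < j → r < weight i j) (hσ : σ.r .r = d * weight i j + r) :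
    (unrankDiv.run E σ).r .r = r ∧ (unrankDiv.run E σ).r .d = d := by
  have hV : E.β .lim + 1 ≤ E.V := by
    have := hE.cell_le (i := 1) (j := 1) (by have := hE.lim; omega) (by have := hE.lim; omega)
    omega
  unfold unrankDiv
  rw [Cmd.run_seq, Cmd.run_set]
  have := Cmd.run_loop (E := E) (x := .l) (i := .lim) (σ := σ.set .d (Expr.zero.eval E σ))
    (c := .ite (.and (.lt (.var .d) (.var .j)) (.le wtE (.var .r)))
      (.set .r (.sub (.var .r) wtE) ;; .set .d (.add (.var .d) .one)) .skip)
    (fun l s => s.a = σ.a ∧ s.r .i = i ∧ s.r .j = j ∧ s.r .d = min l d ∧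
      s.r .r = (d - min l d) * weight i j + r) (by simp [hi, hj, hσ]) ?_
  · obtain ⟨-, -, -, h1, h2⟩ := this
    rw [min_eq_right (by omega)] at h1 h2
    exact ⟨by simpa using h2, h1⟩
  · rintro l hl s ⟨s1, s2, s3, s4, s5⟩
    have hw : wtE.eval E (s.set .l l) = weight i j :=
      WeightTables.eval_wtE hE (h.of_eq (by simp [s1]) (by simp [s1]) (by simp [s1]))
        (by simpa using s2) (by simpa using s3) hi' hj'
    by_cases hld : l < d
    · have e1 : min l d = l := by omega
      have e2 : min (l + 1) d = l + 1 := by omega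
      obtain ⟨c, rfl⟩ : ∃ c, d = l + 1 + c := ⟨d - (l + 1), by omega⟩
      rw [e1] at s4 s5
      rw [show l + 1 + c - l = c + 1 by omega, add_mul, one_mul] at s5
      rw [e2, show l + 1 + c - (l + 1) = c by omega]
      rw [Cmd.run_ite_pos (by simp [s3, s4, hw, s5]; omega)]
      simp [s1, s2, s3, s4, s5, hw]
      omega
    · have e1 : min l d = d := by omega
      have e2 : min (l + 1) d = d := by omega
      rw [e1] at s4 s5
      rw [e2]
      rw [Cmd.run_ite_neg (by simp [s3, s4, hw, s5]; exact hr)]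
      simp [s1, s2, s3, s4, s5]

/-- The leading digits of a rank belong to the last term, so the positions are treated from the
highest one down. Since `lim` bounds the loop, the positions beyond the sequence are skipped. -/
theorem run_unrank {E : Env} {σ : St} (hE : E.Cap) (h : WeightTables E σ) {v b : ℕ → ℕ}
    (hb : ∀ i, b i ≤ 1) {N : ℕ} (hN : σ.r .ns = N) (hN' : N ≤ E.β .lim) (hk : E.β .k < E.β .lim)
    (hg : IsRank v b N (E.β .k) (σ.r .g)) :
    ∀ i < N, (unrank.run E σ).a .val i = v i ∧ (unrank.run E σ).a .bit i = b i := by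
  unfold unrank
  simp only [Cmd.run_seq (E := E) (σ := σ), Cmd.run_set]
  rw [Cmd.run_seq, Cmd.run_set]
  have := Cmd.run_loop (E := E) (x := .p) (i := .lim)
    (σ := (σ.set .r ((Expr.var .g).eval E σ)).set .j ((Expr.par .k).eval E (σ.set .r
      ((Expr.var .g).eval E σ))))
    (c := .set .i (.sub (.sub (.par .lim) .one) (.var .p)) ;;
      .ite (.lt (.var .i) (.var .ns)) (unrankBit ;; unrankDiv ;; unrankVal) .skip)
    (fun p s => s.r .ns = N ∧ WeightTables E s ∧ s.r .j < E.β .lim ∧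
      IsRank v b (min N (E.β .lim - p)) (s.r .j) (s.r .r) ∧
      ∀ i < N, E.β .lim - p ≤ i → s.a .val i = v i ∧ s.a .bit i = b i) ?_ ?_
  · obtain ⟨-, -, -, -, h1⟩ := this
    exact fun i hi => h1 i hi (by omega)
  · refine ⟨by simpa using hN, h.of_eq rfl rfl rfl, by simpa using hk, ?_, fun i hi hi' => ?_⟩
    · rw [Nat.sub_zero, min_eq_left hN']
      simpa using hg
    · omega
  · rintro p hp s ⟨s1, s2, s3, s4, s5⟩
    obtain ⟨i, hi⟩ : ∃ i, i = E.β .lim - 1 - p := ⟨_, rfl⟩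
    rw [Cmd.run_seq, Cmd.run_set]
    simp only [Expr.eval_sub, Expr.eval_par, Expr.eval_one, Expr.eval_var, St.set_r, if_true, ← hi]
    set s' := (s.set .p p).set .i i with hs'
    have t1 : s'.r .ns = N := by simpa [hs'] using s1
    have t2 : WeightTables E s' := s2.of_eq rfl rfl rfl
    have ti : s'.r .i = i := by simp [hs']
    have tj : s'.r .j = s.r .j := by simp [hs']
    have tr : s'.r .r = s.r .r := by simp [hs']
    have ta : s'.a = s.a := rfl
    by_cases hiN : i < N
    · rw [Cmd.run_ite_pos (by simp [ti, t1, hiN])]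
      rw [show min N (E.β .lim - p) = i + 1 by omega] at s4
      -- Both cases of `IsRank` in one form: the quotient `d` is the last term, or `j` if this term
      -- is a new value.
      obtain ⟨d, r', hd1, hd2, hv, hlt, hrank⟩ : ∃ d r', d ≤ s.r .j ∧
          (d < s.r .j → r' < weight i (s.r .j)) ∧ v i = (if d < s.r .j then d else s.r .j - 1) ∧
          d * weight i (s.r .j) + r' < halfWeight i (s.r .j) ∧
          s.r .r = b i * halfWeight i (s.r .j) + (d * weight i (s.r .j) + r') ∧
          IsRank v b i (if d < s.r .j then s.r .j else s.r .j - 1) r' := by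
        generalize s.r .j = j at s4 ⊢
        generalize s.r .r = r at s4 ⊢
        obtain ⟨r', ⟨c1, c2, c3⟩ | ⟨c1, c2, c3⟩⟩ := s4
        · have h4 := c2.lt hb
          refine ⟨v i, r', c1.le, fun _ => h4, by rw [if_pos c1], ?_, by omega,
            by rwa [if_pos c1]⟩
          have h5 : (v i + 1) * weight i j ≤ j * weight i j := Nat.mul_le_mul_right _ c1
          have h6 : j * weight i j ≤ halfWeight i j := Nat.le_add_right _ _
          rw [add_mul] at h5
          omega
        · have h4 := c2.lt hb
          refine ⟨j, r', le_rfl, fun hc => absurd hc (lt_irrefl _), ?_, ?_, by omega,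
            by rwa [if_neg (lt_irrefl _)]⟩
          · rw [if_neg (lt_irrefl _)]; omega
          · rw [halfWeight, if_neg (by omega)]; omega
      obtain ⟨hrank1, hrank2⟩ := hrank
      have hilim : i < E.β .lim := by omega
      rw [Cmd.run_seq, Cmd.run_seq]
      obtain ⟨u1, u2⟩ := run_unrankBit (σ := s') hE t2 ti tj hilim s3 (hb i) hlt (tr.trans hrank1)
      set s₁ := unrankBit.run E s' with hs₁
      have w1 : ∀ x, x ≠ .r → s₁.r x = s'.r x := fun x hx =>
        Cmd.run_r _ _ (by simpa [unrankBit, Cmd.regs] using hx) _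
      have w2 : ∀ a, a ≠ .bit → s₁.a a = s.a a := fun x hx =>
        Cmd.run_a _ _ (by simpa [unrankBit, Cmd.arrs] using hx) _
      have t2₁ : WeightTables E s₁ := s2.of_eq (w2 _ (by decide)) (w2 _ (by decide))
        (w2 _ (by decide))
      obtain ⟨x1, x2⟩ := run_unrankDiv (σ := s₁) hE t2₁ ((w1 _ (by decide)).trans ti)
        ((w1 _ (by decide)).trans tj) hilim s3 hd1 hd2 u1
      set s₂ := unrankDiv.run E s₁ with hs₂
      have w3 : s₂.a = s₁.a := funext fun a => Cmd.run_a _ _ (by simp [unrankDiv, Cmd.arrs]) _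
      have yi : s₂.r .i = i := by
        rw [hs₂, Cmd.run_r _ _ (by decide), w1 _ (by decide), ti]
      have yj : s₂.r .j = s.r .j := by
        rw [hs₂, Cmd.run_r _ _ (by decide), w1 _ (by decide), tj]
      have yn : s₂.r .ns = N := by
        rw [hs₂, Cmd.run_r _ _ (by decide), w1 _ (by decide), t1]
      have key : ∃ s₃, unrankVal.run E s₂ = s₃ ∧ s₃.r .ns = N ∧
          s₃.r .j = (if d < s.r .j then s.r .j else s.r .j - 1) ∧ s₃.r .r = r' ∧
          s₃.a .val = Function.update (s.a .val) i (v i) ∧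
          (∀ a, a ≠ .val → s₃.a a = s₁.a a) := by
        refine ⟨_, rfl, ?_⟩
        unfold unrankVal
        by_cases hdj : d < s.r .j
        · rw [Cmd.run_ite_pos (by simpa [x2, yj] using hdj)]
          rw [if_pos hdj] at hv ⊢
          refine ⟨by simpa using yn, by simpa using yj, by simpa using x1, ?_, fun a ha => ?_⟩
          · simp [yi, x2, w3, w2 .val (by decide), hv]
          · simp [ha, w3]
        · rw [Cmd.run_ite_neg (by simpa [x2, yj] using hdj)]
          rw [if_neg hdj] at hv ⊢
          refine ⟨by simpa using yn, by simp [yj], by simpa using x1, ?_, fun a ha => ?_⟩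
          · simp [yi, yj, w3, w2 .val (by decide), hv]
          · simp [ha, w3]
      obtain ⟨s₃, hs₃, z1, z2, z3, z4, z5⟩ := key
      rw [hs₃, show min N (E.β .lim - (p + 1)) = i by omega, z1, z2, z3]
      refine ⟨rfl, t2₁.of_eq (z5 _ (by decide)) (z5 _ (by decide)) (z5 _ (by decide)), ?_, hrank2,
        fun l hl hl' => ?_⟩
      · split_ifs <;> omega
      · rw [z4, z5 _ (by decide), u2, ta]
        by_cases hli : l = i
        · subst hli; simp
        · rw [Function.update_of_ne hli, Function.update_of_ne hli]
          exact s5 l hl (by omega)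
    · rw [Cmd.run_ite_neg (by simpa [ti, t1] using hiN), Cmd.run_skip]
      rw [show min N (E.β .lim - p) = N by omega] at s4
      rw [show min N (E.β .lim - (p + 1)) = N by omega, tj, tr]
      exact ⟨t1, t2, s3, s4, fun l hl hl' => s5 l hl (by omega)⟩

/-! ### Palettes as a program -/

/-- Determine the palettes from the sequences. -/
def palettes : Cmd :=
  .set .s .zero ;;
  .loop .i .n (.set .u (.get .ord (.var .i)) ;;
    .ite (.get .int (.var .u))
      (.ite (.get .root (.var .u))
        (.put .pa (.var .u) (.get .val (.var .s)) ;;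
          .put .pb (.var .u) (.get .val (.add (.var .s) .one)) ;;
          .set .s (.add (.add (.var .s) .one) .one))
        (.put .pa (.var .u) (.ite (.get .bit (.var .s)) (.get .pb (.get .par (.var .u)))
            (.get .pa (.get .par (.var .u)))) ;;
          .put .pb (.var .u) (.get .val (.var .s)) ;; .set .s (.add (.var .s) .one))) .skip)

/-- A parent precedes its children and no vertex occurs twice in the order, so palettes are final
when they are read and are not overwritten later. -/
theorem run_palettes {E : Env} {A : ℕ → ℕ → Prop} {σ : St} (hE : E.Cap)
    (hF : SearchForest (E.β .n) A (σ.a .ord) (σ.a .int) (σ.a .par) (σ.a .dep) (σ.a .root))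
    (hslot : slot (σ.a .ord) (σ.a .int) (σ.a .root) (E.β .n) ≤ E.β .lim) :
    IsPalettes (E.β .n) (σ.a .ord) (σ.a .int) (σ.a .par) (σ.a .root) (σ.a .val) (σ.a .bit)
      ((palettes.run E σ).a .pa) ((palettes.run E σ).a .pb) := by
  have hV : E.β .lim + 2 ≤ E.V := by
    have := hE.cell_le (i := 1) (j := 2) (by have := hE.lim; omega) (by have := hE.lim; omega)
    omega
  unfold palettes
  rw [Cmd.run_seq, Cmd.run_set]
  refine (Cmd.run_loop (E := E) (x := .i) (i := .n) (fun i s => (∀ a, a ≠ .pa → a ≠ .pb →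
    s.a a = σ.a a) ∧ s.r .s = slot (σ.a .ord) (σ.a .int) (σ.a .root) i ∧
    IsPalettes i (σ.a .ord) (σ.a .int) (σ.a .par) (σ.a .root) (σ.a .val) (σ.a .bit)
      (s.a .pa) (s.a .pb)) ?_ ?_).2.2
  · exact ⟨fun a _ _ => rfl, by simp [slot], fun p hp => absurd hp (Nat.not_lt_zero _)⟩
  rintro i hi s ⟨s1, s2, s3⟩
  have hsl : slot (σ.a .ord) (σ.a .int) (σ.a .root) i ≤ E.β .lim :=
    (slot_mono _ _ _ hi.le).trans hslot
  have hsucc := slot_succ (σ.a .ord) (σ.a .int) (σ.a .root) i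
  generalize hn : slot (σ.a .ord) (σ.a .int) (σ.a .root) i = c at *
  have hext : ∀ pa pb x y, pa = Function.update (s.a .pa) (σ.a .ord i) x →
      pb = Function.update (s.a .pb) (σ.a .ord i) y →
      (0 < σ.a .int (σ.a .ord i) → (0 < σ.a .root (σ.a .ord i) → x = σ.a .val c ∧
        y = σ.a .val (c + 1)) ∧ (σ.a .root (σ.a .ord i) = 0 →
        x = (if 0 < σ.a .bit c then s.a .pb (σ.a .par (σ.a .ord i))
          else s.a .pa (σ.a .par (σ.a .ord i))) ∧ y = σ.a .val c)) →
      IsPalettes (i + 1) (σ.a .ord) (σ.a .int) (σ.a .par) (σ.a .root) (σ.a .val) (σ.a .bit)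
        pa pb := by
    rintro pa pb x y rfl rfl hxy p hp hinn
    have hne : ∀ q < i, σ.a .ord q ≠ σ.a .ord i := fun q hq e =>
      hq.ne (hF.inj q (by omega) i hi e)
    have hpar : ∀ q ≤ i, σ.a .root (σ.a .ord q) = 0 →
        σ.a .par (σ.a .ord q) ≠ σ.a .ord i := fun q hq hr => by
      obtain ⟨q', hq', e, -⟩ := hF.parent q (by omega) hr
      rw [e]; exact hne q' (by omega)
    rcases Nat.lt_succ_iff_lt_or_eq.1 hp with hp | rfl
    · rw [Function.update_of_ne (hne p hp), Function.update_of_ne (hne p hp)]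
      refine ⟨(s3 p hp hinn).1, fun hr => ?_⟩
      rw [Function.update_of_ne (hpar p hp.le hr), Function.update_of_ne (hpar p hp.le hr)]
      exact (s3 p hp hinn).2 hr
    · rw [Function.update_self, Function.update_self, hn]
      refine ⟨(hxy hinn).1, fun hr => ?_⟩
      rw [Function.update_of_ne (hpar p le_rfl hr), Function.update_of_ne (hpar p le_rfl hr)]
      exact (hxy hinn).2 hr
  have a1 := s1 .ord (by decide) (by decide)
  have a2 := s1 .int (by decide) (by decide)
  have a3 := s1 .root (by decide) (by decide)
  have a4 := s1 .val (by decide) (by decide)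
  have a5 := s1 .bit (by decide) (by decide)
  have a6 := s1 .par (by decide) (by decide)
  refine ⟨fun a ha ha' => ?_, ?_⟩
  · rw [Cmd.run_a _ _ (by simp [Cmd.arrs, ha, ha'])]
    exact s1 a ha ha'
  rw [Cmd.run_seq, Cmd.run_set]
  simp only [Expr.eval_get, Expr.eval_var, St.set_r, if_true, St.set_a, a1]
  rw [hsucc]
  by_cases h1 : 0 < σ.a .int (σ.a .ord i)
  · rw [Cmd.run_ite_pos (by simpa [a2] using h1), if_pos h1]
    by_cases h2 : 0 < σ.a .root (σ.a .ord i)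
    · rw [Cmd.run_ite_pos (by simpa [a3] using h2), if_pos h2]
      refine ⟨by simp [s2]; omega, hext _ _ (σ.a .val c) (σ.a .val (c + 1)) ?_ ?_
        fun _ => ⟨fun _ => ⟨rfl, rfl⟩, fun h => absurd h h2.ne'⟩⟩
      · simp [s2, a4]
      · have : min (c + 1) E.V = c + 1 := by omega
        simp [s2, a4, this]
    · rw [Cmd.run_ite_neg (by simpa [a3] using h2), if_neg h2]
      refine ⟨by simp [s2]; omega, hext _ _ (if 0 < σ.a .bit c then
        s.a .pb (σ.a .par (σ.a .ord i)) else s.a .pa (σ.a .par (σ.a .ord i))) (σ.a .val c) ?_ ?_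
        fun _ => ⟨fun h => absurd h h2, fun _ => ⟨rfl, rfl⟩⟩⟩
      · simp [Expr.eval, s2, a5, a6]
      · simp [s2, a4]
  · rw [Cmd.run_ite_neg (by simpa [a2] using h1), if_neg h1]
    exact ⟨by simpa using s2, hext _ _ (s.a .pa (σ.a .ord i)) (s.a .pb (σ.a .ord i))
      (by simp) (by simp) fun h => absurd h h1⟩

end RAM

/-! ### Sets of colours as binary numbers -/

/-- The number with the binary digits in `s`. -/
def maskOf (s : Finset ℕ) : ℕ := ∑ i ∈ s, 2 ^ i

theorem maskOf_lt {s : Finset ℕ} {k : ℕ} (h : ∀ i ∈ s, i < k) : maskOf s < 2 ^ k :=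
  Nat.geomSum_lt le_rfl h

theorem maskOf_eq_zero {s : Finset ℕ} : maskOf s = 0 ↔ s = ∅ := by
  simp [maskOf, Finset.sum_eq_zero_iff, Finset.eq_empty_iff_forall_notMem]

theorem maskOf_range (k : ℕ) : maskOf (Finset.range k) = 2 ^ k - 1 := by
  induction k with
  | zero => rfl
  | succ k ih =>
    rw [maskOf, Finset.sum_range_succ, ← maskOf, ih, pow_succ]
    have := Nat.two_pow_pos k
    omega

theorem maskOf_erase (s : Finset ℕ) (a : ℕ) :
    maskOf (s.erase a) = maskOf s - if a ∈ s then 2 ^ a else 0 := by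
  split_ifs with h
  · have := Finset.sum_erase_add s (fun i => 2 ^ i) h
    rw [maskOf, maskOf, ← this]
    omega
  · rw [Finset.erase_eq_of_notMem h, Nat.sub_zero]

theorem maskOf_filter_succ (s : Finset ℕ) (i : ℕ) : maskOf (s.filter (· < i + 1)) =
    maskOf (s.filter (· < i)) + if i ∈ s then 2 ^ i else 0 := by
  unfold maskOf
  rw [Finset.sum_filter, Finset.sum_filter, ← Finset.sum_ite_eq' s i (fun j => 2 ^ j),
    ← Finset.sum_add_distrib]
  refine Finset.sum_congr rfl fun j _ => ?_
  split_ifs <;> omega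

namespace RAM

/-- Determine the binary digits of `mask`. -/
def bits : Cmd :=
  .set .rem (.var .mask) ;;
  .loop .j .k (.set .i (.sub (.sub (.par .k) .one) (.var .j)) ;;
    .ite (.le (.get .pw (.var .i)) (.var .rem))
      (.put .bt (.var .i) .one ;; .set .rem (.sub (.var .rem) (.get .pw (.var .i))))
      (.put .bt (.var .i) .zero))

/-- Digits are taken greedily from the top; what remains below position `i` is less than `2 ^ i`. -/
theorem run_bits {E : Env} {σ : St} (hpw : ∀ i < E.β .k, σ.a .pw i = 2 ^ i) {s : Finset ℕ}
    (hs : ∀ i ∈ s, i < E.β .k) (hm : σ.r .mask = maskOf s) :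
    ∀ i < E.β .k, 0 < (bits.run E σ).a .bt i ↔ i ∈ s := by
  unfold bits
  rw [Cmd.run_seq, Cmd.run_set]
  have := Cmd.run_loop (E := E) (x := .j) (i := .k) (σ := σ.set .rem ((Expr.var .mask).eval E σ))
    (c := .set .i (.sub (.sub (.par .k) .one) (.var .j)) ;;
    .ite (.le (.get .pw (.var .i)) (.var .rem))
      (.put .bt (.var .i) .one ;; .set .rem (.sub (.var .rem) (.get .pw (.var .i))))
      (.put .bt (.var .i) .zero))
    (fun j t => t.a .pw = σ.a .pw ∧ t.r .rem = maskOf (s.filter (· < E.β .k - j)) ∧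
      ∀ i < E.β .k, E.β .k - j ≤ i → (0 < t.a .bt i ↔ i ∈ s)) ?_ ?_
  · exact fun i hi => this.2.2 i hi (by omega)
  · refine ⟨rfl, ?_, fun i hi hi' => by omega⟩
    rw [Nat.sub_zero, Finset.filter_true_of_mem hs]
    simpa using hm
  · rintro j hj t ⟨t1, t2, t3⟩
    obtain ⟨i, hi⟩ : ∃ i, i = E.β .k - 1 - j := ⟨_, rfl⟩
    rw [show E.β .k - j = i + 1 by omega, maskOf_filter_succ] at t2
    rw [show E.β .k - (j + 1) = i by omega]
    have hlt : maskOf (s.filter (· < i)) < 2 ^ i := maskOf_lt fun l hl => (Finset.mem_filter.1 hl).2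
    have hpi := hpw i (by omega)
    rw [Cmd.run_seq, Cmd.run_set]
    simp only [Expr.eval_sub, Expr.eval_par, Expr.eval_one, Expr.eval_var, St.set_r, if_true, ← hi]
    by_cases his : i ∈ s
    · rw [if_pos his] at t2
      rw [Cmd.run_ite_pos (by simp [t1, t2, hpi])]
      refine ⟨by simpa using t1, by simp [t1, t2, hpi], fun l hl hl' => ?_⟩
      by_cases hli : l = i
      · subst hli; simp [his]
      · simpa [hli] using t3 l hl (by omega)
    · rw [if_neg his, add_zero] at t2
      rw [Cmd.run_ite_neg (by simp [t1, t2, hpi, hlt])]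
      refine ⟨by simpa using t1, by simpa using t2, fun l hl hl' => ?_⟩
      by_cases hli : l = i
      · subst hli; simp [his]
      · simpa [hli] using t3 l hl (by omega)

/-! ### The dynamic program over sets of colours -/

/-- The colour `a` is in the palette of `x`. -/
def inPaletteE (x a : Expr) : Expr := .or (.eq a (.get .pa x)) (.eq a (.get .pb x))

theorem holds_inPaletteE {E : Env} {σ : St} {x a : Expr} : (inPaletteE x a).Holds E σ ↔
    InPalette (σ.a .pa) (σ.a .pb) (x.eval E σ) (a.eval E σ) := by
  simp [inPaletteE, InPalette]

/-- There is a choice to be made for the pair `(u, v)`. -/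
def activeE : Expr :=
  .or (.and (.lt (.var .u) (.var .v)) (.and (.get .int (.var .u)) (.and (.get .int (.var .v))
      (adjE (.var .u) (.var .v)))))
    (.and (.eq (.var .u) (.var .v)) (.and (.not (.get .int (.var .u)))
      (.ex .w .n (adjE (.var .u) (.var .w)))))

theorem holds_activeE {E : Env} {A : ℕ → ℕ → Prop} {σ : St} (hG : IsGraphOn (E.β .n) A)
    (hT : AdjTable E A σ) {u v : ℕ} (hu : σ.r .u = u) (hv : σ.r .v = v) (hu' : u < E.β .n)
    (hv' : v < E.β .n) : activeE.Holds E σ ↔ Active A (σ.a .int) u v := by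
  have h1 : (adjE (.var .u) (.var .v)).Holds E σ ↔ A u v := hT.holds hu hv hu' hv'
  have h2 : (Expr.ex .w .n (adjE (.var .u) (.var .w))).Holds E σ ↔ ∃ x, A u x := by
    rw [Expr.holds_ex]
    constructor
    · rintro ⟨x, hx, h⟩
      exact ⟨x, (hT.holds (by simpa using hu) (by simp) hu' hx).1 h⟩
    · rintro ⟨x, hx⟩
      exact ⟨x, hG.lt_right hx,
        (hT.holds (by simpa using hu) (by simp) hu' (hG.lt_right hx)).2 hx⟩
  simp only [activeE, Active, Expr.holds_or, Expr.holds_and, Expr.holds_lt, Expr.holds_eq,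
    Expr.holds_not, Expr.holds_get, Expr.eval_var, h1, h2, hu, hv, not_lt, Nat.le_zero]

/-- The colours `y` and `z` may be chosen for the pair `(u, v)`. -/
def admissibleE : Expr :=
  .or (.and (.lt (.var .u) (.var .v)) (.and (.eq (.var .y) (.var .z))
      (.and (inPaletteE (.var .u) (.var .y)) (inPaletteE (.var .v) (.var .y)))))
    (.and (.eq (.var .u) (.var .v)) (.and
      (.all .w .n (.or (.not (adjE (.var .u) (.var .w)))
        (.or (inPaletteE (.var .w) (.var .y)) (inPaletteE (.var .w) (.var .z)))))
      (.ex .w .n (.ex .t .n (.and (adjE (.var .u) (.var .w)) (.and (adjE (.var .u) (.var .t))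
        (.and (inPaletteE (.var .w) (.var .y)) (.and (inPaletteE (.var .t) (.var .z))
          (.or (.not (.eq (.var .w) (.var .t))) (.eq (.var .y) (.var .z)))))))))))

theorem holds_admissibleE {E : Env} {A : ℕ → ℕ → Prop} {σ : St} (hG : IsGraphOn (E.β .n) A)
    (hT : AdjTable E A σ) {u v a b : ℕ} (hu : σ.r .u = u) (hv : σ.r .v = v) (hu' : u < E.β .n)
    (ha : σ.r .y = a) (hb : σ.r .z = b) (ha' : a < E.β .k) (hb' : b < E.β .k) :
    admissibleE.Holds E σ ↔ Admissible A (σ.a .pa) (σ.a .pb) (E.β .k) u v a b := by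
  have h1 : (Expr.all .w .n (.or (.not (adjE (.var .u) (.var .w)))
      (.or (inPaletteE (.var .w) (.var .y)) (inPaletteE (.var .w) (.var .z))))).Holds E σ ↔
      ∀ x, A u x → InPalette (σ.a .pa) (σ.a .pb) x a ∨ InPalette (σ.a .pa) (σ.a .pb) x b := by
    rw [Expr.holds_all]
    have key : ∀ x < E.β .n, (Expr.or (.not (adjE (.var .u) (.var .w)))
        (.or (inPaletteE (.var .w) (.var .y)) (inPaletteE (.var .w) (.var .z)))).Holds E
        (σ.set .w x) ↔ (A u x → InPalette (σ.a .pa) (σ.a .pb) x a ∨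
          InPalette (σ.a .pa) (σ.a .pb) x b) := by
      intro x hx
      have h : (adjE (.var .u) (.var .w)).Holds E (σ.set .w x) ↔ A u x :=
        hT.holds (by simpa using hu) (by simp) hu' hx
      simp only [Expr.holds_or, Expr.holds_not, h, holds_inPaletteE, Expr.eval_var, St.set_r,
        St.set_a, reduceCtorEq, if_true, if_false, ha, hb]
      tauto
    exact ⟨fun h x hx => (key x (hG.lt_right hx)).1 (h x (hG.lt_right hx)) hx,
      fun h x hx => (key x hx).2 (h x)⟩
  have h2 : (Expr.ex .w .n (.ex .t .n (.and (adjE (.var .u) (.var .w))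
      (.and (adjE (.var .u) (.var .t)) (.and (inPaletteE (.var .w) (.var .y))
        (.and (inPaletteE (.var .t) (.var .z)) (.or (.not (.eq (.var .w) (.var .t)))
          (.eq (.var .y) (.var .z))))))))).Holds E σ ↔ ∃ x y, A u x ∧ A u y ∧
      InPalette (σ.a .pa) (σ.a .pb) x a ∧ InPalette (σ.a .pa) (σ.a .pb) y b ∧ (x = y → a = b) := by
    simp only [Expr.holds_ex]
    have key : ∀ x < E.β .n, ∀ y < E.β .n, (Expr.and (adjE (.var .u) (.var .w))
        (.and (adjE (.var .u) (.var .t)) (.and (inPaletteE (.var .w) (.var .y))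
        (.and (inPaletteE (.var .t) (.var .z)) (.or (.not (.eq (.var .w) (.var .t)))
          (.eq (.var .y) (.var .z))))))).Holds E ((σ.set .w x).set .t y) ↔ A u x ∧ A u y ∧
        InPalette (σ.a .pa) (σ.a .pb) x a ∧ InPalette (σ.a .pa) (σ.a .pb) y b ∧
          (x = y → a = b) := by
      intro x hx y hy
      have h : (adjE (.var .u) (.var .w)).Holds E ((σ.set .w x).set .t y) ↔ A u x :=
        hT.holds (by simpa using hu) (by simp) hu' hx
      have h' : (adjE (.var .u) (.var .t)).Holds E ((σ.set .w x).set .t y) ↔ A u y :=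
        hT.holds (by simpa using hu) (by simp) hu' hy
      simp only [Expr.holds_and, Expr.holds_or, Expr.holds_not, Expr.holds_eq, h, h',
        holds_inPaletteE, Expr.eval_var, St.set_r, St.set_a, reduceCtorEq, if_true, if_false, ha,
        hb]
      tauto
    constructor
    · rintro ⟨x, hx, y, hy, h⟩
      exact ⟨x, y, (key x hx y hy).1 h⟩
    · rintro ⟨x, y, h⟩
      exact ⟨x, hG.lt_right h.1, y, hG.lt_right h.2.1,
        (key x (hG.lt_right h.1) y (hG.lt_right h.2.1)).2 h⟩
  simp only [admissibleE, Admissible, Expr.holds_or, Expr.holds_and, Expr.holds_lt, Expr.holds_eq,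
    holds_inPaletteE, Expr.eval_var, h1, h2, hu, hv, ha, hb, ha', hb', true_and]

/-- The digits of `mask`, without those at the positions `y` and `z`. -/
def restE : Expr :=
  .sub (.sub (.var .mask) (.ite (.get .bt (.var .y)) (.get .pw (.var .y)) .zero))
    (.ite (.and (.get .bt (.var .z)) (.not (.eq (.var .y) (.var .z)))) (.get .pw (.var .z)) .zero)

/-- If both colours coincide, the second subtraction must not take place; this matches membership of
`b` in `s.erase a`. -/
theorem eval_restE {E : Env} {σ : St} (hpw : ∀ i < E.β .k, σ.a .pw i = 2 ^ i) {s : Finset ℕ}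
    (hbt : ∀ i < E.β .k, 0 < σ.a .bt i ↔ i ∈ s) (hm : σ.r .mask = maskOf s) {a b : ℕ}
    (ha : σ.r .y = a) (hb : σ.r .z = b) (ha' : a < E.β .k) (hb' : b < E.β .k) :
    restE.eval E σ = maskOf ((s.erase a).erase b) := by
  have h1 : (Expr.ite (.get .bt (.var .y)) (.get .pw (.var .y)) .zero).eval E σ =
      if a ∈ s then 2 ^ a else 0 := by
    rw [Expr.eval]
    refine if_congr ?_ ?_ rfl
    · rw [Expr.eval_get, Expr.eval_var, ha, hbt a ha']
    · rw [Expr.eval_get, Expr.eval_var, ha, hpw a ha']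
  have h2 : (Expr.ite (.and (.get .bt (.var .z)) (.not (.eq (.var .y) (.var .z))))
      (.get .pw (.var .z)) .zero).eval E σ = if b ∈ s.erase a then 2 ^ b else 0 := by
    rw [Expr.eval]
    refine if_congr ?_ ?_ rfl
    · change Expr.Holds E (.and _ _) σ ↔ _
      simp only [Expr.holds_and, Expr.holds_get, Expr.holds_not, Expr.holds_eq, Expr.eval_var, ha,
        hb, hbt b hb', Finset.mem_erase]
      exact ⟨fun h => ⟨fun e => h.2 e.symm, h.1⟩, fun h => ⟨h.2, fun e => h.1 e.symm⟩⟩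
    · rw [Expr.eval_get, Expr.eval_var, hb, hpw b hb']
  rw [maskOf_erase, maskOf_erase, restE, Expr.eval_sub, Expr.eval_sub, h1, h2, Expr.eval_var, hm]

/-- Some choice for the pair `(u, v)` leaves a set of colours that is covered already. -/
def coverE : Expr := .ex .y .k (.ex .z .k (.and admissibleE (.get .cov restE)))

/-- Take the choices for the pair `(u, v)` into account. -/
def coverStep : Cmd :=
  .ite activeE (.loop .x .dim (.set .mask (.sub (.sub (.par .dim) .one) (.var .x)) ;; bits ;;
    .put .cov (.var .mask) coverE)) .skip

/-- The array `cov` tells which sets of colours are covered by choices for the pairs in `D`. -/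
def CovTable (E : Env) (A : ℕ → ℕ → Prop) (D : ℕ → ℕ → Prop) (σ : St) : Prop :=
  ∀ s : Finset ℕ, (∀ i ∈ s, i < E.β .k) → (0 < σ.a .cov (maskOf s) ↔
    Covers A (σ.a .int) (σ.a .pa) (σ.a .pb) (E.β .k) D s)

/-- One table is updated in place, from the largest mask downwards. Erasing colours never increases
the mask, so the entries consulted still refer to `D`; if nothing is erased, the entry itself is
read before it is written. -/
theorem run_coverStep {E : Env} {A : ℕ → ℕ → Prop} {σ : St} (hG : IsGraphOn (E.β .n) A)
    (hT : AdjTable E A σ) (hpw : ∀ i < E.β .k, σ.a .pw i = 2 ^ i) (hdim : E.β .dim = 2 ^ E.β .k)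
    {u v : ℕ} (hu : σ.r .u = u) (hv : σ.r .v = v) (hu' : u < E.β .n) (hv' : v < E.β .n)
    {D D' : ℕ → ℕ → Prop} (hD : ¬ D u v) (hD' : ∀ u' v', D' u' v' ↔ D u' v' ∨ u' = u ∧ v' = v)
    (hc : CovTable E A D σ) : CovTable E A D' (coverStep.run E σ) := by
  have hact := holds_activeE hG hT hu hv hu' hv'
  unfold coverStep
  by_cases ha : Active A (σ.a .int) u v
  · rw [Cmd.run_ite_pos (hact.2 ha)]
    have := Cmd.run_loop (E := E) (x := .x) (i := .dim) (σ := σ)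
      (c := .set .mask (.sub (.sub (.par .dim) .one) (.var .x)) ;; bits ;;
        .put .cov (.var .mask) coverE)
      -- After `x` rounds exactly the entries with masks from `dim - x` on refer to the enlarged set
      -- of pairs.
      (fun x t => (∀ a, a ≠ .cov → a ≠ .bt → t.a a = σ.a a) ∧ t.r .u = u ∧ t.r .v = v ∧
        ∀ s : Finset ℕ, (∀ i ∈ s, i < E.β .k) → (0 < t.a .cov (maskOf s) ↔
          Covers A (σ.a .int) (σ.a .pa) (σ.a .pb) (E.β .k)
            (if E.β .dim - x ≤ maskOf s then D' else D) s)) ?_ ?_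
    · obtain ⟨t1, -, -, t2⟩ := this
      intro s hs
      rw [t1 .int (by decide) (by decide), t1 .pa (by decide) (by decide),
        t1 .pb (by decide) (by decide), t2 s hs, if_pos (by omega)]
    · refine ⟨fun _ _ _ => rfl, hu, hv, fun s hs => ?_⟩
      have := maskOf_lt hs
      rw [if_neg (by omega)]
      exact hc s hs
    · rintro x hx t ⟨t1, t2, t3, t4⟩
      obtain ⟨m, hm⟩ : ∃ m, m = E.β .dim - 1 - x := ⟨_, rfl⟩
      rw [Cmd.run_seq, Cmd.run_set, Cmd.run_seq]
      simp only [Expr.eval_sub, Expr.eval_par, Expr.eval_one, Expr.eval_var, St.set_r, if_true,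
        ← hm]
      have hbits := fun s hs => run_bits (E := E) (σ := (t.set .x x).set .mask m)
        (fun i hi => by simpa [t1 .pw (by decide) (by decide)] using hpw i hi) (s := s) hs
      have ha₁ : ∀ a, a ≠ .bt → (bits.run E ((t.set .x x).set .mask m)).a a = t.a a :=
        fun a h => Cmd.run_a _ _ (by simpa [bits, Cmd.arrs] using h) _
      have hr₁ : ∀ y, y ≠ .rem → y ≠ .j → y ≠ .i →
          (bits.run E ((t.set .x x).set .mask m)).r y = ((t.set .x x).set .mask m).r y :=
        fun y h1 h2 h3 => Cmd.run_r _ _ (by simp [bits, Cmd.regs, h1, h2, h3]) _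
      generalize bits.run E ((t.set .x x).set .mask m) = t' at hbits ha₁ hr₁ ⊢
      have hmask : t'.r .mask = m := by rw [hr₁ _ (by decide) (by decide) (by decide)]; simp
      have htu : t'.r .u = u := by rw [hr₁ _ (by decide) (by decide) (by decide)]; simpa using t2
      have htv : t'.r .v = v := by rw [hr₁ _ (by decide) (by decide) (by decide)]; simpa using t3
      have hta : ∀ a, a ≠ .cov → a ≠ .bt → t'.a a = σ.a a := fun a h1 h2 => by
        rw [ha₁ a h2, t1 a h1 h2]
      have htc : t'.a .cov = t.a .cov := ha₁ _ (by decide)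
      rw [Cmd.run_put, Expr.eval_var, hmask]
      refine ⟨fun a h1 h2 => by simpa [h1] using hta a h1 h2, htu, htv, fun s hs => ?_⟩
      rw [St.put_a, if_pos rfl, Function.update_apply]
      by_cases hsm : maskOf s = m
      · rw [if_pos hsm, if_pos (by omega)]
        have hbt := hbits s hs (by simpa using hsm.symm)
        change coverE.Holds E t' ↔ _
        have hT' : AdjTable E A t' := hT.of_eq (hta _ (by decide) (by decide))
          (hta _ (by decide) (by decide))
        have hpw' : ∀ i < E.β .k, t'.a .pw i = 2 ^ i := by
          rw [hta .pw (by decide) (by decide)]; exact hpw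
        have key : ∀ a < E.β .k, ∀ b < E.β .k, (Expr.and admissibleE (.get .cov restE)).Holds E
            ((t'.set .y a).set .z b) ↔ Admissible A (σ.a .pa) (σ.a .pb) (E.β .k) u v a b ∧
              Covers A (σ.a .int) (σ.a .pa) (σ.a .pb) (E.β .k) D ((s.erase a).erase b) := by
          intro a ha b hb
          rw [Expr.holds_and, holds_admissibleE (σ := (t'.set .y a).set .z b) (u := u) (v := v)
            (a := a) (b := b) hG (hT'.of_eq rfl rfl) (by simpa using htu) (by simpa using htv) hu'
            (by simp) (by simp) ha hb, Expr.holds_get,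
            eval_restE (σ := (t'.set .y a).set .z b) (s := s) (a := a) (b := b) hpw' hbt
            (by simp [hmask, hsm]) (by simp) (by simp) ha hb]
          have hle : maskOf ((s.erase a).erase b) ≤ maskOf s := by
            rw [maskOf_erase, maskOf_erase]; omega
          have := t4 ((s.erase a).erase b) fun i hi =>
            hs i (Finset.mem_of_mem_erase (Finset.mem_of_mem_erase hi))
          rw [if_neg (by omega)] at this
          simp only [St.set_a]
          rw [htc, this, hta .pa (by decide) (by decide), hta .pb (by decide) (by decide)]
        rw [covers_step hD hD' ha, coverE]
        simp only [Expr.holds_ex]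
        constructor
        · rintro ⟨a, ha, b, hb, h⟩
          exact ⟨a, b, (key a ha b hb).1 h⟩
        · rintro ⟨a, b, h⟩
          exact ⟨a, h.1.1, b, h.1.2.1, (key a h.1.1 b h.1.2.1).2 h⟩
      · rw [if_neg hsm, htc, t4 s hs]
        have : E.β .dim - x ≤ maskOf s ↔ E.β .dim - (x + 1) ≤ maskOf s := by omega
        simp only [this]
  · rw [Cmd.run_ite_neg fun h => ha (hact.1 h), Cmd.run_skip]
    intro s hs
    rw [hc s hs]
    refine covers_congr fun u' v' h => ?_
    rw [hD' u' v']
    refine ⟨Or.inl, fun h' => h'.resolve_right ?_⟩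
    rintro ⟨rfl, rfl⟩
    exact ha h

/-- Determine the sets of colours that are covered by choices for all pairs. -/
def coverCmd : Cmd :=
  .loop .x .dim (.put .cov (.var .x) .zero) ;; .put .cov .zero .one ;;
  .loop .u .n (.loop .v .n coverStep)

/-- Without any pairs only the empty set is covered, which explains the initial table; the pairs are
then added in lexicographic order. -/
theorem run_coverCmd {E : Env} {A : ℕ → ℕ → Prop} {σ : St} (hG : IsGraphOn (E.β .n) A)
    (hT : AdjTable E A σ) (hpw : ∀ i < E.β .k, σ.a .pw i = 2 ^ i)
    (hdim : E.β .dim = 2 ^ E.β .k) :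
    CovTable E A (fun u v => u < E.β .n ∧ v < E.β .n) (coverCmd.run E σ) := by
  unfold coverCmd
  rw [Cmd.run_seq, Cmd.run_seq]
  have hinit := Cmd.run_loop (E := E) (x := .x) (i := .dim) (σ := σ)
    (c := .put .cov (.var .x) .zero)
    (fun x t => (∀ a, a ≠ .cov → t.a a = σ.a a) ∧ ∀ m < x, t.a .cov m = 0)
    ⟨fun _ _ => rfl, by simp⟩ (by
      rintro x hx t ⟨t1, t2⟩
      refine ⟨fun a ha => by simpa [ha] using t1 a ha, fun m hm => ?_⟩
      simp only [Cmd.run_put, St.put_a, if_true, Function.update_apply, Expr.eval_var, St.set_r,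
        Expr.eval_zero, St.set_a]
      split_ifs with h
      · rfl
      · exact t2 m (by omega))
  generalize Cmd.run E (.loop .x .dim (.put .cov (.var .x) .zero)) σ = σ₁ at hinit ⊢
  obtain ⟨i1, i2⟩ := hinit
  rw [Cmd.run_put]
  simp only [Expr.eval_zero, Expr.eval_one]
  set σ₂ := σ₁.put .cov 0 1 with hσ₂
  have j1 : ∀ a, a ≠ .cov → σ₂.a a = σ.a a := fun a ha => by simpa [hσ₂, ha] using i1 a ha
  have hT₂ : AdjTable E A σ₂ := hT.of_eq (j1 _ (by decide)) (j1 _ (by decide))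
  have hC₂ : CovTable E A (fun _ _ => False) σ₂ := by
    intro s hs
    rw [covers_false (by simp), ← maskOf_eq_zero]
    have := maskOf_lt hs
    simp only [hσ₂, St.put_a, if_true, Function.update_apply]
    by_cases h : maskOf s = 0
    · simp [h]
    · rw [if_neg h, i2 _ (by omega)]; simp [h]
  have houter := Cmd.run_loop (E := E) (x := .u) (i := .n) (σ := σ₂) (c := .loop .v .n coverStep)
    (fun u t => AdjTable E A t ∧ t.a .pw = σ.a .pw ∧
      CovTable E A (fun u' v' => u' < u ∧ v' < E.β .n) t)
    ⟨hT₂, j1 _ (by decide), by simpa using hC₂⟩ ?_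
  · exact houter.2.2
  · rintro u hu t ⟨t1, t2, t3⟩
    have hinner := Cmd.run_loop (E := E) (x := .v) (i := .n) (σ := t.set .u u) (c := coverStep)
      (fun v t => t.r .u = u ∧ AdjTable E A t ∧ t.a .pw = σ.a .pw ∧
        CovTable E A (fun u' v' => u' < u ∧ v' < E.β .n ∨ u' = u ∧ v' < v) t)
      ⟨by simp, t1.of_eq rfl rfl, t2, by
        have h : CovTable E A (fun u' v' => u' < u ∧ v' < E.β .n) (t.set .u u) := t3
        simpa using h⟩ ?_
    · obtain ⟨-, h1, h2, h3⟩ := hinner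
      refine ⟨h1, h2, ?_⟩
      have : (fun u' v' => u' < u ∧ v' < E.β .n ∨ u' = u ∧ v' < E.β .n) =
          fun u' v' => u' < u + 1 ∧ v' < E.β .n := by
        funext u' v'
        refine propext ?_
        omega
      rwa [this] at h3
    · rintro v hv t ⟨r1, r2, r3, r4⟩
      refine ⟨?_, r2.of_eq ?_ ?_, ?_, ?_⟩
      · rw [Cmd.run_r _ _ (by decide)]; simpa using r1
      · rw [Cmd.run_a _ _ (by decide)]; rfl
      · rw [Cmd.run_a _ _ (by decide)]; rfl
      · rw [Cmd.run_a _ _ (by decide)]; exact r3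
      · refine run_coverStep (σ := t.set .v v) hG (r2.of_eq rfl rfl)
          (fun i hi => by rw [St.set_a, r3]; exact hpw i hi) hdim (u := u) (v := v)
          (by simpa using r1) (by simp) hu hv (D := fun u' v' => u' < u ∧ v' < E.β .n ∨ u' = u ∧ v' < v)
          (by omega) (fun u' v' => by omega) r4

/-! ### A single trial and the loop over all ranks -/

/-- Try the sequences of rank `g`. -/
def tryCmd : Cmd :=
  unrank ;; palettes ;; coverCmd ;;
  .ite (.get .cov (.sub (.par .dim) .one)) (.set .res .one) .skip

/-- Try all sequences. -/
def mainLoop : Cmd := .loop .g .tot tryCmd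

theorem Prepared.of_eq {E E' : Env} {A : ℕ → ℕ → Prop} {σ σ' : St} (h : Prepared E A σ)
    (hn : E'.β .n = E.β .n) (hk : E'.β .k = E.β .k) (hl : E'.β .lim = E.β .lim) (hV : E'.V = E.V)
    (hr : σ'.r .ns = σ.r .ns)
    (ha : ∀ a ∉ tryCmd.arrs, σ'.a a = σ.a a) : Prepared E' A σ' := by
  obtain ⟨⟨h1, h2, h3⟩, h4, h5, h6, h7, h8, h9, h10⟩ := h
  have e1 := ha .row (by decide)
  have e2 := ha .adj (by decide)
  have e3 := ha .off (by decide)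
  have e4 := ha .pw (by decide)
  have e5 := ha .ord (by decide)
  have e6 := ha .int (by decide)
  have e7 := ha .par (by decide)
  have e8 := ha .dep (by decide)
  have e9 := ha .root (by decide)
  have e10 := ha .wt (by decide)
  have e11 := ha .ht (by decide)
  unfold OffTable at h4
  constructor
  · constructor
    · rwa [e1, hn]
    · rwa [e2, hn]
    · rwa [hn, hV]
  · unfold OffTable; rwa [e3, hl]
  · rwa [e4, hk]
  · rwa [e5, e6, e7, e8, e9, hn]
  · rwa [e10, hl]
  · rwa [e11, hl]
  · rwa [e5, e6, e9, hn, hr]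
  · rwa [hr, hl]

/-- Soundness holds for every rank, whatever the sequences turn out to be, since a successful cover
always gives a colouring. Only completeness needs the correct unranking. -/
theorem run_tryCmd {E : Env} {A : ℕ → ℕ → Prop} {σ : St} (hE : E.Cap) (hG : IsGraphOn (E.β .n) A)
    (hP : Prepared E A σ) (hdim : E.β .dim = 2 ^ E.β .k) :
    ((tryCmd.run E σ).r .res = σ.r .res ∨
      (tryCmd.run E σ).r .res = 1 ∧ Colorable A (E.β .k)) ∧
    ∀ v b : ℕ → ℕ, (∀ i, b i ≤ 1) → E.β .k < E.β .lim →
      IsRank v b (σ.r .ns) (E.β .k) (σ.r .g) →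
      (∀ val bit pa pb : ℕ → ℕ, (∀ i < σ.r .ns, val i = v i ∧ bit i = b i) →
        IsPalettes (E.β .n) (σ.a .ord) (σ.a .int) (σ.a .par) (σ.a .root) val bit pa pb →
        Covers A (σ.a .int) pa pb (E.β .k) (fun u v => u < E.β .n ∧ v < E.β .n)
          (Finset.range (E.β .k))) → (tryCmd.run E σ).r .res = 1 := by
  unfold tryCmd
  rw [Cmd.run_seq, Cmd.run_seq, Cmd.run_seq]
  set σ₁ := unrank.run E σ with hσ₁
  set σ₂ := palettes.run E σ₁ with hσ₂
  set σ₃ := coverCmd.run E σ₂ with hσ₃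
  have f1 : ∀ a, a ≠ .val → a ≠ .bit → σ₁.a a = σ.a a := fun a h1 h2 =>
    Cmd.run_a _ _ (by simp [unrank, unrankBit, unrankDiv, unrankVal, Cmd.arrs, h1, h2]) _
  have f2 : ∀ a, a ≠ .pa → a ≠ .pb → σ₂.a a = σ₁.a a := fun a h1 h2 =>
    Cmd.run_a _ _ (by simp [palettes, Cmd.arrs, h1, h2]) _
  have f3 : ∀ a, a ≠ .cov → a ≠ .bt → σ₃.a a = σ₂.a a := fun a h1 h2 =>
    Cmd.run_a _ _ (by simp [coverCmd, coverStep, bits, Cmd.arrs, h1, h2]) _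
  have hres : σ₃.r .res = σ.r .res := by
    rw [hσ₃, Cmd.run_r _ _ (by decide), hσ₂, Cmd.run_r _ _ (by decide), hσ₁,
      Cmd.run_r _ _ (by decide)]
  have hF := hP.forest
  have o1 := f1 .ord (by decide) (by decide)
  have o2 := f1 .int (by decide) (by decide)
  have o3 := f1 .par (by decide) (by decide)
  have o4 := f1 .root (by decide) (by decide)
  have o5 := f1 .dep (by decide) (by decide)
  have hpal := run_palettes (E := E) (A := A) (σ := σ₁) hE (by rwa [o1, o2, o3, o4, o5])
    (by rw [o1, o2, o4, ← hP.ns]; exact hP.ns_lt.le)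
  rw [← hσ₂, o1, o2, o3, o4] at hpal
  have hcov := run_coverCmd (E := E) (A := A) (σ := σ₂) hG
    (hP.adj.of_eq ((f2 _ (by decide) (by decide)).trans (f1 _ (by decide) (by decide)))
      ((f2 _ (by decide) (by decide)).trans (f1 _ (by decide) (by decide))))
    (by rw [f2 _ (by decide) (by decide), f1 _ (by decide) (by decide)]; exact hP.pw) hdim
  have hfull := hcov (Finset.range (E.β .k)) fun i hi => Finset.mem_range.1 hi
  rw [← hσ₃, maskOf_range, f3 .int (by decide) (by decide), f2 .int (by decide) (by decide), o2,
    f3 .pa (by decide) (by decide), f3 .pb (by decide) (by decide)] at hfull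
  have htest : (Expr.get .cov (.sub (.par .dim) .one)).Holds E σ₃ ↔
      Covers A (σ.a .int) (σ₂.a .pa) (σ₂.a .pb) (E.β .k)
        (fun u v => u < E.β .n ∧ v < E.β .n) (Finset.range (E.β .k)) := by
    rw [← hfull, ← hdim]; rfl
  constructor
  · by_cases h : (Expr.get .cov (.sub (.par .dim) .one)).Holds E σ₃
    · rw [Cmd.run_ite_pos h]
      exact Or.inr ⟨by simp, Covers.colorable hG hF.cover (htest.1 h)⟩
    · rw [Cmd.run_ite_neg h]
      exact Or.inl hres
  · intro v b hb hk hrank hall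
    have hun := run_unrank (σ := σ) hE ⟨hP.off, hP.wt, hP.ht⟩ hb rfl hP.ns_lt.le hk hrank
    rw [Cmd.run_ite_pos (htest.2 (hall _ _ _ _ hun hpal))]
    simp

/-- The answer is never reset to zero, so it is enough that the rank of one suitable sequence is
among those tried. -/
theorem run_mainLoop {E : Env} {A : ℕ → ℕ → Prop} {σ : St} (hE : E.Cap)
    (hG : IsGraphOn (E.β .n) A) (hP : Prepared E A σ) (hdim : E.β .dim = 2 ^ E.β .k)
    (hk : E.β .k < E.β .lim) (htot : E.β .tot = weight (σ.r .ns) (E.β .k))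
    (hres : σ.r .res = 0) :
    (Colorable A (E.β .k) → (mainLoop.run E σ).r .res = 1) ∧
      (¬ Colorable A (E.β .k) → (mainLoop.run E σ).r .res = 0) := by
  have hstep : ∀ (g : ℕ) (s : St), (∀ a ∉ tryCmd.arrs, s.a a = σ.a a) → s.r .ns = σ.r .ns →
      Prepared E A (s.set .g g) ∧
        (∀ a ∉ tryCmd.arrs, (tryCmd.run E (s.set .g g)).a a = σ.a a) ∧
        (tryCmd.run E (s.set .g g)).r .ns = σ.r .ns := by
    intro g s h1 h2
    refine ⟨hP.of_eq rfl rfl rfl rfl (by simpa using h2) h1, fun a ha => ?_, ?_⟩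
    · rw [Cmd.run_a _ _ ha]; exact h1 a ha
    · rw [Cmd.run_r _ _ (by decide)]; simpa using h2
  constructor
  · intro hcol
    obtain ⟨v, b, hv, hb, hall⟩ := hP.forest.exists_palettes hG hcol
    rw [← hP.ns] at hv hall
    obtain ⟨g₀, hg₀⟩ := hv.exists_rank b
    have hlt : g₀ < E.β .tot := htot ▸ hg₀.lt hb
    refine (Cmd.run_loop (E := E) (x := .g) (i := .tot) (σ := σ) (c := tryCmd)
      (fun g s => (∀ a ∉ tryCmd.arrs, s.a a = σ.a a) ∧ s.r .ns = σ.r .ns ∧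
        (g₀ < g → s.r .res = 1)) ⟨fun _ _ => rfl, rfl, fun h => absurd h (Nat.not_lt_zero _)⟩
        ?_).2.2 hlt
    rintro g hg s ⟨s1, s2, s3⟩
    obtain ⟨p1, p2, p3⟩ := hstep g s s1 s2
    obtain ⟨t1, t2⟩ := run_tryCmd hE hG p1 hdim
    refine ⟨p2, p3, fun hgg => ?_⟩
    rcases Nat.lt_succ_iff_lt_or_eq.1 hgg with h | rfl
    · rcases t1 with t1 | t1
      · rw [t1]; simpa using s3 h
      · exact t1.1
    · refine t2 v b hb hk (by simpa [s2] using hg₀) ?_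
      have q1 := s1 .ord (by decide)
      have q2 := s1 .int (by decide)
      have q3 := s1 .par (by decide)
      have q4 := s1 .root (by decide)
      simpa [s2, q1, q2, q3, q4] using hall
  · intro hcol
    refine (Cmd.run_loop (E := E) (x := .g) (i := .tot) (σ := σ) (c := tryCmd)
      (fun g s => (∀ a ∉ tryCmd.arrs, s.a a = σ.a a) ∧ s.r .ns = σ.r .ns ∧ s.r .res = 0)
        ⟨fun _ _ => rfl, rfl, hres⟩ ?_).2.2
    rintro g hg s ⟨s1, s2, s3⟩
    obtain ⟨p1, p2, p3⟩ := hstep g s s1 s2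
    refine ⟨p2, p3, ?_⟩
    rcases (run_tryCmd hE hG p1 hdim).1 with t1 | t1
    · rw [t1]; simpa using s3
    · exact absurd t1.2 hcol

theorem run_mainLoop_of_tot_eq_zero {E : Env} {σ : St} (h : E.β .tot = 0) :
    mainLoop.run E σ = σ := by
  simp [mainLoop, Cmd.run, h, iter]

end RAM

/-! ### The program -/

namespace RAM

/-- The values of the parameters for the input `n`, `k`. -/
def solverEnv (R n k lim dim tot : ℕ) : Env where
  β := fun i => match i with
    | .n => n
    | .k => min k (2 * n + 1)
    | .lim => lim
    | .dim => dim
    | .tot => tot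
  V := 2 ^ (8 * (R + n * n))

theorem setupEnv_eq (R n k : ℕ) : setupEnv R n k = solverEnv R n k 0 0 0 := by
  unfold setupEnv solverEnv
  congr 1
  funext i
  cases i <;> rfl

/-- Parameters are constant while a compiled program runs. This lemma allows a value computed by one
program to become a loop bound of the next. -/
theorem Rep.setPar {E E' : Env} {B : ℕ} {σ : St} {m : Mem} (h : Rep E B σ m) (hB : 51 ≤ B)
    (i : Par) (v : ℕ) (hV : E'.V = E.V) (hi : E'.β i = v) (hne : ∀ j, j ≠ i → E'.β j = E.β j) :
    Rep E' B σ (Function.update m i.cell v) where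
  reg x := by
    have := x.cell_lt; have := i.le_cell
    rw [Function.update_of_ne (by omega), h.reg]
  par j := by
    by_cases hj : j = i
    · rw [hj, Function.update_self, hi]
    · have : j.cell ≠ i.cell := fun e => hj (Par.ctorIdx_injective (Nat.add_left_cancel e))
      rw [Function.update_of_ne this, h.par, hne j hj]
  cap := by
    have := i.cell_lt
    rw [Function.update_of_ne (by unfold capCell; omega), h.cap, hV]
  base := by
    have := i.cell_lt
    rw [Function.update_of_ne (by unfold baseCell; omega), h.base]
  arr a j := by
    have := i.cell_lt
    rw [Function.update_of_ne (by omega), h.arr]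

theorem ok_solverEnv {R n k lim dim tot W : ℕ} (hR : 51 ≤ R) (hlim : lim ≤ 2 * n + 2)
    (hdim : dim ≤ 2 ^ (8 * (R + n * n))) (htot : tot ≤ 2 ^ (8 * (R + n * n)))
    (hW : 32 * 2 ^ (8 * (R + n * n)) + (R + n * n) + 64 ≤ W) :
    (solverEnv R n k lim dim tot).Ok (R + n * n) W := by
  have h1 : 8 * (R + n * n) < 2 ^ (8 * (R + n * n)) := Nat.lt_two_pow_self
  have h2 : 2 * n ≤ n * n + 1 := by nlinarith [sq_nonneg ((n : ℤ) - 1)]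
  refine ⟨Nat.one_le_two_pow, fun i => ?_, hW, by omega⟩
  change (solverEnv R n k lim dim tot).β i ≤ 2 ^ (8 * (R + n * n))
  cases i <;> simp only [solverEnv] <;> omega

theorem cap_solverEnv {R : ℕ} (hR : 51 ≤ R) (n k dim tot : ℕ) :
    (solverEnv R n k (2 * n + 2) dim tot).Cap :=
  ⟨rfl, Nat.min_le_right _ _, Nat.pow_le_pow_right (by norm_num) (by
    change 8 * (51 + n * n) ≤ 8 * (R + n * n); omega)⟩

/-- The parameters `n`, `k` and `lim` are all at most `2 * n + 2`, so their powers merge into a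
polynomial in `n`; only `dim` and `tot` are kept apart. -/
theorem time_solverEnv_le (R n k dim tot : ℕ) {lim : ℕ} (hlim : lim ≤ 2 * n + 2) (c : Cmd) :
    c.time (solverEnv R n k lim dim tot) ≤ c.const *
      ((2 * n + 3) ^ (c.deg .n + c.deg .k + c.deg .lim) * (dim + 1) ^ c.deg .dim *
        (tot + 1) ^ c.deg .tot) := by
  refine (c.time_le _).trans (Nat.mul_le_mul_left _ ?_)
  unfold Env.mon
  rw [pow_add, pow_add]
  refine Nat.mul_le_mul (Nat.mul_le_mul (Nat.mul_le_mul (Nat.mul_le_mul ?_ ?_) ?_) le_rfl) le_rfl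
  all_goals
    refine Nat.pow_le_pow_left ?_ _
    simp only [solverEnv]
    omega

/-- Determine the size of the tables. -/
def limCmd : Cmd := .set .lim (.add (.add (.add (.par .n) (.par .n)) .one) .one)

/-- The space for intermediate results. -/
def workspace : ℕ := 51 + limCmd.depth + prepare.depth + mainLoop.depth

/-- The algorithm. -/
def solver : Block :=
  (setup workspace).seq <| (limCmd.compile 51).seq <| (Block.copy Par.lim.cell Reg.lim.cell).seq <|
  (prepare.compile 51).seq <| (Block.copy Par.dim.cell Reg.dim.cell).seq <|
  (Block.copy Par.tot.cell Reg.tot.cell).seq (mainLoop.compile 51)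

theorem le_workspace : 51 ≤ workspace := by unfold workspace; omega

theorem inputMemory_le {n : ℕ} (G : SimpleGraph (Fin n)) (k : ℕ) {a : ℕ} (ha : 2 ≤ a) :
    inputMemory G k a ≤ 1 := by
  obtain ⟨a, rfl⟩ := Nat.exists_eq_add_of_le' ha
  rw [inputMemory]
  split_ifs <;> omega

theorem inputMemory_eq_zero {n : ℕ} (G : SimpleGraph (Fin n)) (k : ℕ) {a : ℕ}
    (ha : n * n + 2 ≤ a) : inputMemory G k a = 0 := by
  obtain ⟨a, rfl⟩ := Nat.exists_eq_add_of_le' (show 2 ≤ a by omega)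
  rw [inputMemory, if_neg]
  rintro ⟨u, v, h, -⟩
  have h1 : n * (u + 1) ≤ n * n := Nat.mul_le_mul_left _ u.2
  have h2 := v.2
  rw [mul_add] at h1
  omega

theorem inputMemory_entry {n : ℕ} (G : SimpleGraph (Fin n)) (k : ℕ) {u v : ℕ} (hu : u < n)
    (hv : v < n) : 0 < inputMemory G k (n * u + v + 2) ↔ natAdj G u v := by
  rw [inputMemory]
  have hn : 0 < n := by omega
  have key : (∃ u' v' : Fin n, n * u + v = n * (u' : ℕ) + (v' : ℕ) ∧ G.Adj u' v') ↔
      natAdj G u v := by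
    constructor
    · rintro ⟨u', v', h, hA⟩
      have e1 : v = v' := by
        have := congrArg (· % n) h
        simpa [Nat.mul_add_mod, Nat.mod_eq_of_lt hv, Nat.mod_eq_of_lt v'.2] using this
      have e2 : u = u' := Nat.eq_of_mul_eq_mul_left hn (by omega)
      rw [e1, e2]
      exact (natAdj_coe G u' v').2 hA
    · exact fun h => ⟨⟨u, hu⟩, ⟨v, hv⟩, rfl, (natAdj_coe G ⟨u, hu⟩ ⟨v, hv⟩).1 h⟩
  by_cases h : natAdj G u v
  · rw [if_pos (key.2 h)]; simp [h]
  · rw [if_neg fun h' => h (key.1 h')]; simp [h]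

theorem inputMemory_two {n : ℕ} (G : SimpleGraph (Fin n)) (k : ℕ) : inputMemory G k 2 = 0 := by
  rcases Nat.eq_zero_or_pos n with rfl | hn
  · exact inputMemory_eq_zero G k (by omega)
  · have := (inputMemory_entry G k hn hn).not.2 (isGraphOn_natAdj G).irrefl
    simpa using this

/-- Three programs run in succession, because `lim` must be known for the tables and `dim` and `tot`
for the main loop. The bound for `W` allows for array addresses and for the input `k`, which is the
only number that is not bounded in terms of `n`. -/
theorem wp_solver {n : ℕ} (G : SimpleGraph (Fin n)) (k : ℕ) {W : ℕ}
    (hW : 32 * 2 ^ (8 * (workspace + n * n)) + 64 * (workspace + n * n) + 64 + k ≤ W) :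
    ∃ tot, (tot = 0 ∨ k ≤ 2 * n + 1 ∧ ∃ i ≤ 2 * k, tot = weight i k) ∧
      solver.wp W (inputMemory G k) (100 * (workspace + n * n) + 106 +
        limCmd.time (solverEnv workspace n k 0 0 0) +
        prepare.time (solverEnv workspace n k (2 * n + 2) 0 0) +
        mainLoop.time (solverEnv workspace n k (2 * n + 2) (2 ^ min k (2 * n + 1)) tot))
      fun m => (ExactEdgeTwoColorable G k → m 0 = 1) ∧ (¬ ExactEdgeTwoColorable G k → m 0 = 0) := by
  have hR := le_workspace
  have hG := isGraphOn_natAdj G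
  have hdep : 51 + limCmd.depth ≤ workspace + n * n ∧ 51 + prepare.depth ≤ workspace + n * n ∧
      51 + mainLoop.depth ≤ workspace + n * n := by unfold workspace; omega
  unfold solver
  generalize workspace = R at *
  set V := 2 ^ (8 * (R + n * n)) with hV
  have hBV : 8 * (R + n * n) < V := Nat.lt_two_pow_self
  have hn : 2 * n ≤ n * n + 1 := by nlinarith [sq_nonneg ((n : ℤ) - 1)]
  have hok : ∀ lim dim tot, lim ≤ 2 * n + 2 → dim ≤ V → tot ≤ V →
      (solverEnv R n k lim dim tot).Ok (R + n * n) W := fun lim dim tot h1 h2 h3 =>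
    ok_solverEnv hR h1 h2 h3 (by omega)
  set σ₀ := setupSt (inputMemory G k) with hσ₀
  set σ₁ := limCmd.run (solverEnv R n k 0 0 0) σ₀ with hσ₁
  set σ₂ := prepare.run (solverEnv R n k (2 * n + 2) 0 0) σ₁ with hσ₂
  have hle₀ : σ₀.Le V := by
    refine ⟨fun _ => Nat.zero_le _, fun a i => ?_⟩
    have := inputMemory_le G k (show 2 ≤ i + 2 by omega)
    cases a <;> simp only [hσ₀, setupSt, Nat.zero_le]
    omega
  have hle₁ : σ₁.Le V := Cmd.run_le (hok 0 0 0 (by omega) (by omega) (by omega)) _ _ hle₀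
  have hle₂ : σ₂.Le V := Cmd.run_le (hok _ 0 0 le_rfl (by omega) (by omega)) _ _ hle₁
  have hlim : σ₁.r .lim = 2 * n + 2 := by
    have h1 : min (n + n) V = n + n := by omega
    have h2 : min (n + n + 1) V = n + n + 1 := by omega
    have h3 : min (n + n + 1 + 1) V = n + n + 1 + 1 := by omega
    simp [hσ₁, limCmd, solverEnv, ← hV, h1, h2, h3]
    omega
  have ha₁ : σ₁.a = σ₀.a := rfl
  obtain ⟨hP, hdim, hcase⟩ := run_prepare (E := solverEnv R n k (2 * n + 2) 0 0) (A := natAdj G)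
    (σ := σ₁) (k := k) (cap_solverEnv hR n k 0 0) hG rfl
    (fun u hu v hv => inputMemory_entry G k hu hv)
    (fun a ha => by rw [ha₁]; cases a <;> first | exact absurd rfl ha | rfl)
  rw [← hσ₂] at hP hdim hcase
  change σ₂.r .dim = 2 ^ min k (2 * n + 1) at hdim
  refine ⟨σ₂.r .tot, ?_, ?_⟩
  · rcases hcase with h | h | h
    · exact Or.inl h.2.1
    · exact Or.inl h.2.1
    · have h1 : min k (2 * n + 1) = k := h.2.1
      exact Or.inr ⟨by omega, _, h.2.2.1, h.2.2.2.1⟩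
  set E₃ := solverEnv R n k (2 * n + 2) (2 ^ min k (2 * n + 1)) (σ₂.r .tot) with hE₃
  have hok₃ : E₃.Ok (R + n * n) W := hok _ _ _ le_rfl (hdim ▸ hle₂.reg _) (hle₂.reg _)
  have hres : (ExactEdgeTwoColorable G k → (mainLoop.run E₃ σ₂).r .res = 1) ∧
      (¬ ExactEdgeTwoColorable G k → (mainLoop.run E₃ σ₂).r .res = 0) := by
    rw [← colorable_natAdj]
    rcases hcase with ⟨h1, h2, h3⟩ | ⟨h1, h2, h3⟩ | ⟨h1, h2, h3, h4, h5⟩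
    · rw [run_mainLoop_of_tot_eq_zero h2]
      exact ⟨fun _ => h1, fun h => absurd h3 h⟩
    · rw [run_mainLoop_of_tot_eq_zero h2]
      exact ⟨fun h => absurd h h3, fun _ => h1⟩
    · have hk : E₃.β .k = k := h2
      have hP' : Prepared E₃ (natAdj G) σ₂ := hP.of_eq rfl rfl rfl rfl rfl fun _ _ => rfl
      have := run_mainLoop (cap_solverEnv hR n k _ _) hG hP' rfl (by rw [hk]; exact h5)
        (by rw [hk]; exact h4) h1
      rwa [hk] at this
  refine Block.wp_seq_le (100 * (R + n * n) + 100) (6 + limCmd.time (solverEnv R n k 0 0 0) +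
    prepare.time (solverEnv R n k (2 * n + 2) 0 0) + mainLoop.time E₃) ?_ (by omega)
  refine (wp_setup (n := n) (k := k) rfl rfl (inputMemory_two G k) (fun a => inputMemory_le G k)
    (fun a => inputMemory_eq_zero G k) hR rfl (by omega)).mono le_rfl ?_
  rintro m ⟨hb, hrep⟩
  rw [setupEnv_eq] at hrep
  refine Block.wp_seq_le (limCmd.time (solverEnv R n k 0 0 0)) (6 +
    prepare.time (solverEnv R n k (2 * n + 2) 0 0) + mainLoop.time E₃) ?_ (by omega)
  refine (Cmd.wp_compile (hok 0 0 0 (by omega) (by omega) (by omega)) _ _ _ _ hrep hb hle₀ le_rfl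
    hdep.1).mono le_rfl ?_
  rintro m ⟨hb, hrep, -⟩
  refine Block.wp_seq_le 2 (4 +
    prepare.time (solverEnv R n k (2 * n + 2) 0 0) + mainLoop.time E₃) ?_ (by omega)
  refine Block.wp_copy (by decide) hb ?_
  have hrep' := hrep.setPar (E' := solverEnv R n k (2 * n + 2) 0 0) (by omega) .lim (2 * n + 2)
    rfl rfl (fun j hj => by cases j <;> first | rfl | exact absurd rfl hj)
  rw [← hlim, ← hrep.reg] at hrep'
  replace hb := hb.update Par.lim.cell (hb Reg.lim.cell)
  rw [hrep.reg, hlim] at hrep' hb ⊢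
  refine Block.wp_seq_le (prepare.time (solverEnv R n k (2 * n + 2) 0 0)) (4 + mainLoop.time E₃) ?_
    (by omega)
  refine (Cmd.wp_compile (hok _ 0 0 le_rfl (by omega) (by omega)) _ _ _ _ hrep' hb hle₁ le_rfl
    hdep.2.1).mono le_rfl ?_
  rintro m ⟨hb, hrep, -⟩
  refine Block.wp_seq_le 2 (2 + mainLoop.time E₃) ?_ (by omega)
  refine Block.wp_copy (by decide) hb ?_
  have hrep' := hrep.setPar
    (E' := solverEnv R n k (2 * n + 2) (2 ^ min k (2 * n + 1)) 0) (by omega) .dim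
    (2 ^ min k (2 * n + 1)) rfl rfl (fun j hj => by cases j <;> first | rfl | exact absurd rfl hj)
  replace hb := hb.update Par.dim.cell (hb Reg.dim.cell)
  rw [hrep.reg, hdim] at hb ⊢
  refine Block.wp_seq_le 2 (mainLoop.time E₃) ?_ (by omega)
  refine Block.wp_copy (by decide) hb ?_
  have hrep'' := hrep'.setPar (E' := E₃) (by omega) .tot (σ₂.r .tot)
    rfl rfl (fun j hj => by cases j <;> first | rfl | exact absurd rfl hj)
  replace hb := hb.update Par.tot.cell (hb Reg.tot.cell)
  rw [hrep'.reg] at hb ⊢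
  refine (Cmd.wp_compile hok₃ _ _ _ _ hrep'' hb hle₂ le_rfl hdep.2.2).mono le_rfl ?_
  rintro m ⟨-, hrep, -⟩
  have := hrep.reg .res
  change m 0 = _ at this
  rw [this]
  exact hres

/-- The binary length of `k` is at most `2 * n + 1` if `k` is. Otherwise no sequence is tried, and
the length is absorbed by `k ^ k`, since then the loops cost only 2^k. -/
theorem exists_steps_le : ∃ C, ∀ n k tot,
    (tot = 0 ∨ k ≤ 2 * n + 1 ∧ ∃ i ≤ 2 * k, tot = weight i k) →
      (2 ^ min k (2 * n + 1) + 1) * (tot + 1) * (1 + Nat.size k) ≤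
        C * (2 * n + 2) * (20 * k) ^ k := by
  obtain ⟨C, hC⟩ := exists_weight_le
  refine ⟨2 * C + 4, fun n k tot h => ?_⟩
  have hsize : Nat.size k ≤ k := Nat.size_le.2 Nat.lt_two_pow_self
  have h2 : 2 ^ k ≤ (20 * k) ^ k := by
    rcases Nat.eq_zero_or_pos k with rfl | hk
    · simp
    · exact Nat.pow_le_pow_left (by omega) k
  have h1 := Nat.one_le_two_pow (n := k)
  by_cases hk : k ≤ 2 * n + 1
  · rw [min_eq_left hk]
    have h3 : 2 ^ k * tot ≤ C * (20 * k) ^ k := by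
      rcases h with rfl | ⟨-, i, hi, rfl⟩
      · simp
      · exact hC k i hi
    calc (2 ^ k + 1) * (tot + 1) * (1 + Nat.size k)
        ≤ (2 * 2 ^ k) * (tot + 1) * (2 * n + 2) :=
          Nat.mul_le_mul (Nat.mul_le_mul_right _ (by omega)) (by omega)
      _ = 2 * (2 ^ k * tot + 2 ^ k) * (2 * n + 2) := by ring
      _ ≤ 2 * (C * (20 * k) ^ k + (20 * k) ^ k) * (2 * n + 2) := by gcongr
      _ = (2 * C + 2) * (2 * n + 2) * (20 * k) ^ k := by ring
      _ ≤ (2 * C + 4) * (2 * n + 2) * (20 * k) ^ k := by gcongr; omega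
  · obtain rfl : tot = 0 := by
      rcases h with h | h
      · exact h
      · exact absurd h.1 hk
    have hk1 : 1 ≤ k := by omega
    have h3 : 2 ^ min k (2 * n + 1) ≤ 2 ^ k := Nat.pow_le_pow_right (by norm_num) (Nat.min_le_left _ _)
    have h4 : k ≤ k ^ k := Nat.le_self_pow (by omega) k
    calc (2 ^ min k (2 * n + 1) + 1) * (0 + 1) * (1 + Nat.size k)
        ≤ (2 * 2 ^ k) * 1 * (2 * k ^ k) := by gcongr <;> omega
      _ = 4 * (2 * k) ^ k := by rw [mul_pow]; ring
      _ ≤ 4 * (20 * k) ^ k := by gcongr; omega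
      _ ≤ (2 * C + 4) * (2 * n + 2) * (20 * k) ^ k := by gcongr; nlinarith

theorem size_le (B k : ℕ) :
    Nat.size (32 * 2 ^ (8 * B) + 64 * B + 64 + k) ≤ 8 * B + 9 + Nat.size k := by
  rw [Nat.size_le]
  have h1 : 8 * B < 2 ^ (8 * B) := Nat.lt_two_pow_self
  have h2 : k < 2 ^ Nat.size k := Nat.lt_size_self k
  have h3 := Nat.one_le_two_pow (n := 8 * B)
  have h4 : 2 ^ (8 * B) * 1 ≤ 2 ^ (8 * B) * 2 ^ Nat.size k := by gcongr; omega
  have h5 : 1 * 2 ^ Nat.size k ≤ 2 ^ (8 * B) * 2 ^ Nat.size k := by gcongr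
  have h6 : 2 ^ (8 * B + 9 + Nat.size k) = 512 * (2 ^ (8 * B) * 2 ^ Nat.size k) := by
    rw [pow_add, pow_add]; ring
  rw [h6]
  omega

end RAM

theorem mainTheorem1 :
    ∃ (P : RAM.Program) (p : Polynomial ℕ),
      DecidesWithin P (fun {_} G k => ExactEdgeTwoColorable G k)
        (fun n k => (20 * k) ^ k * p.eval n) := by
  obtain ⟨C, hC⟩ := RAM.exists_steps_le
  let B : Polynomial ℕ := Polynomial.C RAM.workspace + Polynomial.X * Polynomial.X
  let q (c : RAM.Cmd) : Polynomial ℕ := Polynomial.C c.const *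
    (2 * Polynomial.X + 3) ^ (c.deg .n + c.deg .k + c.deg .lim)
  -- The three factors of the polynomial account for the number of steps apart from the exponential
  -- part, for the cost of a step, and for the constant and linear factor in `exists_steps_le`.
  refine ⟨RAM.solver.code 0, (100 * B + 106 + q RAM.limCmd + q RAM.prepare + q RAM.mainLoop) *
    (16 * B + 19) * (Polynomial.C C * (2 * Polynomial.X + 2)), fun n G k => ?_⟩
  have hB : B.eval n = RAM.workspace + n * n := by simp [B]
  have hq : ∀ c : RAM.Cmd, (q c).eval n =
      c.const * (2 * n + 3) ^ (c.deg .n + c.deg .k + c.deg .lim) := fun c => by simp [q]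
  obtain ⟨tot, htot, m, hm, hs⟩ := RAM.wp_solver G k le_rfl
  obtain ⟨τ, hτ, hs⟩ := hs (RAM.solver.code 0) 0 fun i _ => by rw [Nat.zero_add]
  obtain ⟨t, ht, hr⟩ := hs.runs (by
    rw [List.getElem?_eq_none_iff, RAM.solver.length_code, Nat.zero_add])
  refine ⟨_, t, hr, ?_, hm⟩
  have hsize := RAM.size_le (RAM.workspace + n * n) k
  have hlim := RAM.time_solverEnv_le RAM.workspace n k 0 0 (Nat.zero_le _) RAM.limCmd
  have hprep := RAM.time_solverEnv_le RAM.workspace n k 0 0 le_rfl RAM.prepare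
  have hmain := RAM.time_solverEnv_le RAM.workspace n k (2 ^ min k (2 * n + 1)) tot le_rfl
    RAM.mainLoop
  -- This decides the base of the exponential: the loops over sequences and over sets of colours are
  -- each nested only once, so neither factor gets squared.
  have hdeg : RAM.mainLoop.deg .dim = 1 ∧ RAM.mainLoop.deg .tot = 1 := by decide
  rw [hdeg.1, hdeg.2, pow_one, pow_one] at hmain
  simp only [Nat.zero_add, one_pow, mul_one] at hlim hprep
  rw [← hq] at hlim hprep
  rw [mul_assoc, ← mul_assoc, ← hq] at hmain
  specialize hC n k tot htot
  simp only [Polynomial.eval_mul, Polynomial.eval_add, Polynomial.eval_ofNat, Polynomial.eval_C,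
    Polynomial.eval_X, hB]
  generalize hF : (2 ^ min k (2 * n + 1) + 1) * (tot + 1) = F at hmain hC
  have hF' : 1 ≤ F := hF ▸ Nat.succ_le_of_lt (by positivity)
  generalize RAM.workspace + n * n = b at *
  generalize (q RAM.limCmd).eval n = ql at *
  generalize (q RAM.prepare).eval n = qp at *
  generalize (q RAM.mainLoop).eval n = qm at *
  calc t ≤ (100 * b + 106 + ql + qp + qm * F) * (1 + 2 * (8 * b + 9 + Nat.size k)) :=
        ht.trans (Nat.mul_le_mul (by omega) (by omega))
    _ ≤ ((100 * b + 106 + ql + qp) * F + qm * F) * ((16 * b + 19) * (1 + Nat.size k)) :=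
        Nat.mul_le_mul (Nat.add_le_add_right (Nat.le_mul_of_pos_right _ hF') _) (by nlinarith)
    _ = (100 * b + 106 + ql + qp + qm) * (16 * b + 19) * (F * (1 + Nat.size k)) := by ring
    _ ≤ (100 * b + 106 + ql + qp + qm) * (16 * b + 19) * (C * (2 * n + 2) * (20 * k) ^ k) :=
        Nat.mul_le_mul_left _ hC
    _ = (20 * k) ^ k * ((100 * b + 106 + ql + qp + qm) * (16 * b + 19) *
        (C * (2 * n + 2))) := by ring
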